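/- \textbf{Conventions.} All $C^*$-algebras denoted $A,C$ below are concrete, i.e. norm closed $*$-subalgebras of $\mathcal B(H)$ for a complex Hilbert space $H$. A $C^*$-subalgebra $D_A\subseteq A$ is \emph{nondegenerate} if it contains an approximate unit of $A$. Its set of normalisers is $\mathcal N_A(D_A)=\{a\in A: aD_Aa^*\subseteq D_A,\ a^*D_Aa\subseteq D_A\}$. If $A\subseteq\mathcal B(H)$ and $C\subseteq\mathcal B(K)$, then $A\oplus C$ acts on $H\oplus K$, the minimal tensor product $A\otimes C$ acts on $H\otimes K$ and is generated by the operators $a\otimes c$ (similarly for $D_A\otimes D_C$), and the matrix algebra $M_n(A)$ acts on $H^n$; $D_n(D_A)\subseteq M_n(A)$ is the algebra of diagonal matrices with entries in $D_A$. Approximate units are positive and contractive. A completely positive map $\varphi:X\to Y$ of $C^*$-algebras has \emph{order zero} if $\varphi(x)\varphi(x')=0$ for all positive $x,x'\in X$ with $xx'=0$. A \emph{supporting $*$-homomorphism} of an order zero map $\varphi:X\to A\subseteq\mathcal B(H)$ is a $*$-homomorphism $\pi:X\to \mathcal M(E)\cap\{h\}'$ with $\varphi(x)=h\pi(x)$ for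 all $x\in X$, where $E=C^*(\varphi(X))$, $h\in\mathcal M(E)\cap E'$ is positive with $\|h\|=\|\varphi\|$, and the multiplier algebra $\mathcal M(E)$ is realised on $\overline{EH}$ and extended by zero to all of $H$. \textbf{Generalised diagonal dimension.} Let $B$ be a $C^*$-algebra, $D_A\subseteq A\subseteq\mathcal B(H)$ a nondegenerate $C^*$-subalgebra and $d\in\{0,1,2,\dots\}$. Write $\dim(D_A\subseteq A;B)\le d$ if for every finite $\mathcal F\subseteq A$ and $\varepsilon>0$ there are a finite-dimensional $C^*$-algebra $F=F^{(0)}\oplus\dots\oplus F^{(d)}$, each $F^{(i)}$ being a (possibly zero) finite direct sum of matrix algebras over $\mathbb C$, with its canonical diagonal $D_F=D^{(0)}\oplus\dots\oplus D^{(d)}$, and completely positive maps $A\xrightarrow{\psi}F\otimes B\xrightarrow{\varphi}A$ such that \begin{enumerate} \item $\psi$ is contractive; \item $\|\varphi(\psi(a))-a\|<\varepsilon$ for every $a\in\mathcal F$; \item $\varphi^{(i)}:=\varphi|_{F^{(i)}\otimes B}$ is a contractive order zero map for each $i$; \item $\psi(D_A)\subseteq D_F\otimes B$; \item for each $i$,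 $\varphi^{(i)}(D^{(i)}\otimes B)\subseteq\mathcal N_A(D_A)$, and $\varphi^{(i)}(v\otimes B)\subseteq\mathcal N_A(D_A)$ for each matrix unit $v\in F^{(i)}$ with respect to $D^{(i)}$; \item for each $i$, if $\pi^{(i)}$ is a supporting $*$-homomorphism of $\varphi^{(i)}$ and $(u_\lambda)_\lambda$ is an approximate unit of $B$, then for each minimal projection $v\in D^{(i)}$ the limit of $\pi^{(i)}(v\otimes u_\lambda)$ in the strong operator topology of $\mathcal B(H)$ exists and lies in the commutant $(D_A)'$. \end{enumerate} Let $\dim(D_A\subseteq A;B)\in\{0,1,2,\dots\}\cup\{\infty\}$ be the least such $d$, and $\infty$ if there is none. \textbf{Proposition.} Let $B$ be a $C^*$-algebra and let $D_A\subseteq A\subseteq\mathcal B(H)$ and $D_C\subseteq C\subseteq\mathcal B(K)$ be nondegenerate $C^*$-subalgebras. Then \begin{enumerate} \item[(i)] $\dim(D_A\oplus D_C\subseteq A\oplus C;B)\le\max\{\dim(D_A\subseteq A;B),\dim(D_C\subseteq C;B)\}$; \item[(ii)] $\dim(D_A\otimes D_C\subseteq A\otimes C;B)+1\le(\dim(D_A\subseteq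 A;\mathbb C)+1)(\dim(D_C\subseteq C;B)+1)$; in particular, for each $n\in\mathbb N$, $\dim(D_n(D_A)\subseteq M_n(A);B)\le\dim(D_A\subseteq A;B)$. \end{enumerate} -/

import Mathlib

open Filter Topology
open scoped TensorProduct ComplexOrder InnerProduct

noncomputable section

namespace GenDiag

/-! ### Completely positive maps and order zero maps -/

section Maps

variable {X Y : Type*} [NonUnitalCStarAlgebra X] [NonUnitalCStarAlgebra Y]

/-- Positivity of an element of a C⋆-algebra (selfadjoint with nonnegative spectrum). -/
def IsPos (x : X) : Prop := (CStarAlgebra.spectralOrder X).le 0 x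

/-- A linear map between C⋆-algebras is completely positive, in the sense of Mathlib and with
respect to the canonical orders of the two C⋆-algebras. -/
def IsCP (φ : X →ₗ[ℂ] Y) : Prop :=
  letI := CStarAlgebra.spectralOrder X
  letI := CStarAlgebra.spectralOrder Y
  haveI := CStarAlgebra.spectralOrderedRing (A := X)
  haveI := CStarAlgebra.spectralOrderedRing (A := Y)
  ∃ f : CompletelyPositiveMap X Y, f.toLinearMap = φ

/-- Completely positive maps of order zero: positive orthogonal elements have orthogonal images. -/
def IsOrderZero (φ : X →ₗ[ℂ] Y) : Prop :=
  IsCP φ ∧ ∀ x x' : X, IsPos x → IsPos x' → x * x' = 0 → φ x * φ x' = 0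

def IsContractive (φ : X →ₗ[ℂ] Y) : Prop := ∀ x, ‖φ x‖ ≤ ‖x‖

end Maps

/-! ### Supporting `*`-homomorphisms -/

section Concrete

variable {H : Type*} [NormedAddCommGroup H] [InnerProductSpace ℂ H] [CompleteSpace H]

/-- The C⋆-algebra generated by a set of operators. -/
def cstarGenerated (S : Set (H →L[ℂ] H)) : NonUnitalStarSubalgebra ℂ (H →L[ℂ] H) :=
  (NonUnitalStarAlgebra.adjoin ℂ S).topologicalClosure

instance isClosed_cstarGenerated (S : Set (H →L[ℂ] H)) :
    IsClosed (cstarGenerated S : Set (H →L[ℂ] H)) :=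
  NonUnitalStarSubalgebra.isClosed_topologicalClosure _

/-- The closed linear span of `C H`. -/
def essentialSubspace (C : NonUnitalStarSubalgebra ℂ (H →L[ℂ] H)) : Submodule ℂ H :=
  (Submodule.span ℂ {ξ : H | ∃ c ∈ C, ∃ η : H, ξ = c η}).topologicalClosure

/-- The multiplier algebra of `C ⊆ B(H)`, realised on `H`: the operators on the closed linear span
of `C H` (extended by zero to the orthogonal complement) that multiply `C` into `C` from both
sides. -/
def multipliers (C : NonUnitalStarSubalgebra ℂ (H →L[ℂ] H)) : Set (H →L[ℂ] H) :=
  {T | (∀ c ∈ C, T * c ∈ C ∧ c * T ∈ C) ∧ (∀ ξ, T ξ ∈ essentialSubspace C) ∧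
    ∀ ξ ∈ (essentialSubspace C)ᗮ, T ξ = 0}

/-- `π` is a supporting `*`-homomorphism of the order zero map `φ : X → B(H)`: with `C` the
C⋆-algebra generated by `φ(X)`, there is a positive `h ∈ M(C) ∩ C'` of norm `‖φ‖` such that `π`
takes values in `M(C) ∩ {h}'` and `φ(x) = h π(x)`. -/
def IsSupportingHom {X : Type*} [NonUnitalCStarAlgebra X] (φ : X → (H →L[ℂ] H))
    (π : X →⋆ₙₐ[ℂ] (H →L[ℂ] H)) : Prop :=
  ∃ h : H →L[ℂ] H, 0 ≤ h ∧ h ∈ multipliers (cstarGenerated (Set.range φ)) ∧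
    (∀ c ∈ cstarGenerated (Set.range φ), h * c = c * h) ∧
    IsLUB ((fun x => ‖φ x‖) '' Metric.closedBall 0 1) ‖h‖ ∧
    (∀ x, π x ∈ multipliers (cstarGenerated (Set.range φ)) ∧ π x * h = h * π x) ∧
    ∀ x, φ x = h * π x

/-- The normalisers of `D` in `A`. -/
def normalisers (D A : NonUnitalStarSubalgebra ℂ (H →L[ℂ] H)) : Set (H →L[ℂ] H) :=
  {a | a ∈ A ∧ ∀ d ∈ D, a * d * star a ∈ D ∧ star a * d * a ∈ D}

/-- `D` is a nondegenerate C⋆-subalgebra of the C⋆-algebra `A ⊆ B(H)`: it is a norm closed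
`*`-subalgebra and contains an approximate unit of `A`. -/
def IsNondegenerateSubalgebra (D A : NonUnitalStarSubalgebra ℂ (H →L[ℂ] H))
    [IsClosed (A : Set (H →L[ℂ] H))] : Prop :=
  IsClosed (D : Set (H →L[ℂ] H)) ∧ D ≤ A ∧
    letI := CStarAlgebra.spectralOrder A
    ∃ l : Filter A, l.IsIncreasingApproximateUnit ∧ ∀ᶠ e : A in l, (e : H →L[ℂ] H) ∈ D

end Concrete

/-! ### Finite-dimensional C⋆-algebras with coefficients -/

section Coefficients

/-- `F ⊗ B` for the finite-dimensional C⋆-algebra `F = M_{r 0} ⊕ … ⊕ M_{r (s - 1)}`, that is,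
`M_{r 0}(B) ⊕ … ⊕ M_{r (s - 1)}(B)`. -/
abbrev MatSum {s : ℕ} (r : Fin s → ℕ) (B : Type*) : Type _ :=
  ∀ j : Fin s, CStarMatrix (Fin (r j)) (Fin (r j)) B

/-- `e_{kl} ⊗ b` for the matrix unit `e_{kl}` of the `j`-th summand. -/
def unitTensor {s : ℕ} {r : Fin s → ℕ} {B : Type*} [Zero B] (j : Fin s) (k l : Fin (r j)) (b : B) :
    MatSum r B :=
  Pi.single j (CStarMatrix.ofMatrix (Matrix.single k l b))

/-- Membership in `D_F ⊗ B`, where `D_F ⊆ F` is the canonical diagonal. -/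
def IsDiagonal {s : ℕ} {r : Fin s → ℕ} {B : Type*} [Zero B] (x : MatSum r B) : Prop :=
  ∀ j k l, k ≠ l → x j k l = 0

end Coefficients

/-! ### The generalised diagonal dimension -/

section Dimension

variable {H : Type*} [NormedAddCommGroup H] [InnerProductSpace ℂ H] [CompleteSpace H]
variable (B : Type*) [NonUnitalCStarAlgebra B] [PartialOrder B] [StarOrderedRing B]
variable (D A : NonUnitalStarSubalgebra ℂ (H →L[ℂ] H)) [IsClosed (A : Set (H →L[ℂ] H))]

/-- The restriction `φ⁽ⁱ⁾` of `φ` to the `i`-th summand `F⁽ⁱ⁾ ⊗ B`. -/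
def component {d : ℕ} {m : Fin (d + 1) → ℕ} {r : ∀ i, Fin (m i) → ℕ}
    (φ : (∀ i, MatSum (r i) B) →ₗ[ℂ] A) (i : Fin (d + 1)) : MatSum (r i) B →ₗ[ℂ] A :=
  φ ∘ₗ LinearMap.single ℂ (fun i => MatSum (r i) B) i

/-- `(F, D_F, ψ, φ)` is a c.p. approximation witnessing that the generalised diagonal dimension of
`(D ⊆ A)` with respect to `B` is at most `d`, for the set `S` within `ε`. Here
`F⁽ⁱ⁾ = ⨁_j M_{r i j}` for `i = 0, …, d`, with its canonical diagonal. -/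
structure IsApproximation {d : ℕ} {m : Fin (d + 1) → ℕ} {r : ∀ i, Fin (m i) → ℕ}
    (S : Set A) (ε : ℝ) (ψ : A →ₗ[ℂ] ∀ i, MatSum (r i) B)
    (φ : (∀ i, MatSum (r i) B) →ₗ[ℂ] A) : Prop where
  cp_psi : IsCP ψ
  cp_phi : IsCP φ
  contractive_psi : IsContractive ψ
  approx : ∀ a ∈ S, ‖φ (ψ a) - a‖ < ε
  orderZero : ∀ i, IsOrderZero (component B A φ i)
  contractive_phi : ∀ i, IsContractive (component B A φ i)
  map_diagonal : ∀ a : A, (a : H →L[ℂ] H) ∈ D → ∀ i, IsDiagonal (ψ a i)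
  diagonal_normaliser : ∀ i, ∀ x : MatSum (r i) B, IsDiagonal x →
    (component B A φ i x : H →L[ℂ] H) ∈ normalisers D A
  unit_normaliser : ∀ i j k l, ∀ b : B,
    (component B A φ i (unitTensor j k l b) : H →L[ℂ] H) ∈ normalisers D A
  commutant : ∀ i, ∀ π : MatSum (r i) B →⋆ₙₐ[ℂ] (H →L[ℂ] H),
    IsSupportingHom (fun x => (component B A φ i x : H →L[ℂ] H)) π →
    ∀ l : Filter B, l.IsIncreasingApproximateUnit → ∀ j k,
      ∃ T : H →L[ℂ] H, (∀ ξ, Tendsto (fun u => π (unitTensor j k k u) ξ) l (𝓝 (T ξ))) ∧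
        ∀ a ∈ D, T * a = a * T

/-- The generalised diagonal dimension of `(D ⊆ A)` with respect to `B` is at most `d`. -/
def DimLE (d : ℕ) : Prop :=
  ∀ S : Set A, S.Finite → ∀ ε : ℝ, 0 < ε →
    ∃ (m : Fin (d + 1) → ℕ) (r : ∀ i, Fin (m i) → ℕ)
      (ψ : A →ₗ[ℂ] ∀ i, MatSum (r i) B) (φ : (∀ i, MatSum (r i) B) →ₗ[ℂ] A),
      IsApproximation B D A S ε ψ φ

/-- The generalised diagonal dimension of `(D ⊆ A)` with respect to `B`; it is `⊤` if there is no
upper bound. -/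
def genDiagDim : ℕ∞ := ⨅ (d : ℕ) (_ : DimLE B D A d), (d : ℕ∞)

end Dimension

/-! ### Direct sums, tensor products and matrix algebras -/

section Constructions

variable {H K : Type*} [NormedAddCommGroup H] [InnerProductSpace ℂ H] [CompleteSpace H]
  [NormedAddCommGroup K] [InnerProductSpace ℂ K] [CompleteSpace K]

/-- The operator `a ⊕ c` on the Hilbert space `H ⊕ K`. -/
def sumOp (a : H →L[ℂ] H) (c : K →L[ℂ] K) : WithLp 2 (H × K) →L[ℂ] WithLp 2 (H × K) :=
  ((WithLp.prodContinuousLinearEquiv 2 ℂ H K).symm : H × K →L[ℂ] WithLp 2 (H × K)) ∘L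
    (a.prodMap c) ∘L (WithLp.prodContinuousLinearEquiv 2 ℂ H K : WithLp 2 (H × K) →L[ℂ] H × K)

theorem sumOp_apply (a : H →L[ℂ] H) (c : K →L[ℂ] K) (ξ : WithLp 2 (H × K)) :
    sumOp a c ξ = WithLp.toLp 2 (a ξ.fst, c ξ.snd) := rfl

theorem star_sumOp (a : H →L[ℂ] H) (c : K →L[ℂ] K) :
    star (sumOp a c) = sumOp (star a) (star c) := by
  symm
  rw [ContinuousLinearMap.star_eq_adjoint (sumOp a c), ContinuousLinearMap.eq_adjoint_iff]
  intro x y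
  simp [WithLp.prod_inner_apply, sumOp_apply, ContinuousLinearMap.star_eq_adjoint,
    ContinuousLinearMap.adjoint_inner_left]

/-- The direct sum `A ⊕ C`, represented on `H ⊕ K`. -/
def directSum (A : NonUnitalStarSubalgebra ℂ (H →L[ℂ] H))
    (C : NonUnitalStarSubalgebra ℂ (K →L[ℂ] K)) :
    NonUnitalStarSubalgebra ℂ (WithLp 2 (H × K) →L[ℂ] WithLp 2 (H × K)) where
  carrier := {T | ∃ a ∈ A, ∃ c ∈ C, T = sumOp a c}
  add_mem' := by
    rintro _ _ ⟨a, ha, c, hc, rfl⟩ ⟨a', ha', c', hc', rfl⟩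
    exact ⟨a + a', add_mem ha ha', c + c', add_mem hc hc', rfl⟩
  zero_mem' := ⟨0, zero_mem A, 0, zero_mem C, rfl⟩
  mul_mem' := by
    rintro _ _ ⟨a, ha, c, hc, rfl⟩ ⟨a', ha', c', hc', rfl⟩
    exact ⟨a * a', mul_mem ha ha', c * c', mul_mem hc hc', rfl⟩
  smul_mem' := by
    rintro z _ ⟨a, ha, c, hc, rfl⟩
    exact ⟨z • a, SMulMemClass.smul_mem z ha, z • c, SMulMemClass.smul_mem z hc, rfl⟩
  star_mem' := by
    rintro _ ⟨a, ha, c, hc, rfl⟩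
    exact ⟨star a, star_mem ha, star c, star_mem hc, star_sumOp a c⟩

instance isClosed_directSum (A : NonUnitalStarSubalgebra ℂ (H →L[ℂ] H))
    (C : NonUnitalStarSubalgebra ℂ (K →L[ℂ] K)) [hA : IsClosed (A : Set (H →L[ℂ] H))]
    [hC : IsClosed (C : Set (K →L[ℂ] K))] :
    IsClosed (directSum A C : Set (WithLp 2 (H × K) →L[ℂ] WithLp 2 (H × K))) := by
  let e := WithLp.prodContinuousLinearEquiv 2 ℂ H K
  let p : (WithLp 2 (H × K) →L[ℂ] WithLp 2 (H × K)) → (H →L[ℂ] H) := fun T =>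
    ContinuousLinearMap.fst ℂ H K ∘L (e : WithLp 2 (H × K) →L[ℂ] H × K) ∘L T ∘L
      (e.symm : H × K →L[ℂ] WithLp 2 (H × K)) ∘L ContinuousLinearMap.inl ℂ H K
  let q : (WithLp 2 (H × K) →L[ℂ] WithLp 2 (H × K)) → (K →L[ℂ] K) := fun T =>
    ContinuousLinearMap.snd ℂ H K ∘L (e : WithLp 2 (H × K) →L[ℂ] H × K) ∘L T ∘L
      (e.symm : H × K →L[ℂ] WithLp 2 (H × K)) ∘L ContinuousLinearMap.inr ℂ H K
  have hp : Continuous p := by fun_prop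
  have hq : Continuous q := by fun_prop
  have hset : (directSum A C : Set (WithLp 2 (H × K) →L[ℂ] WithLp 2 (H × K))) =
      p ⁻¹' A ∩ q ⁻¹' C ∩ {T | ∀ ξ, T ξ = sumOp (p T) (q T) ξ} := by
    ext T
    constructor
    · rintro ⟨a, ha, c, hc, rfl⟩
      have h1 : p (sumOp a c) = a := rfl
      have h2 : q (sumOp a c) = c := rfl
      refine ⟨⟨?_, ?_⟩, ?_⟩
      · exact h1.symm ▸ ha
      · exact h2.symm ▸ hc
      · intro ξ
        rw [h1, h2]
    · rintro ⟨⟨h1, h2⟩, h3⟩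
      exact ⟨p T, h1, q T, h2, ContinuousLinearMap.ext h3⟩
  rw [hset]
  refine ((hA.preimage hp).inter (hC.preimage hq)).inter ?_
  simp only [Set.ofPred_forall]
  refine isClosed_iInter fun ξ => isClosed_eq (by fun_prop) ?_
  have h : (fun T => sumOp (p T) (q T) ξ) = fun T => e.symm (p T ξ.fst, q T ξ.snd) := rfl
  rw [h]
  fun_prop

/-- The Hilbert space tensor product of `H` and `K`. -/
abbrev HilbertTensor (H K : Type*) [NormedAddCommGroup H] [InnerProductSpace ℂ H]
    [NormedAddCommGroup K] [InnerProductSpace ℂ K] : Type _ :=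
  UniformSpace.Completion (H ⊗[ℂ] K)

/-- The operator `a ⊗ c` on the Hilbert space tensor product. -/
def tensorOp (a : H →L[ℂ] H) (c : K →L[ℂ] K) : HilbertTensor H K →L[ℂ] HilbertTensor H K :=
  (TensorProduct.mapL a c).completion

/-- The (minimal, i.e. spatial) tensor product `A ⊗ C`: the C⋆-algebra generated by the elementary
tensors on the Hilbert space tensor product. -/
def tensor (A : NonUnitalStarSubalgebra ℂ (H →L[ℂ] H))
    (C : NonUnitalStarSubalgebra ℂ (K →L[ℂ] K)) :
    NonUnitalStarSubalgebra ℂ (HilbertTensor H K →L[ℂ] HilbertTensor H K) :=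
  cstarGenerated {T | ∃ a ∈ A, ∃ c ∈ C, T = tensorOp a c}

instance isClosed_tensor (A : NonUnitalStarSubalgebra ℂ (H →L[ℂ] H))
    (C : NonUnitalStarSubalgebra ℂ (K →L[ℂ] K)) :
    IsClosed (tensor A C : Set (HilbertTensor H K →L[ℂ] HilbertTensor H K)) :=
  isClosed_cstarGenerated _

/-- The `(k, l)` entry of an operator on `Hⁿ`; the adjoint of a coordinate projection is the
corresponding coordinate inclusion. -/
def entry {n : ℕ} (T : PiLp 2 (fun _ : Fin n => H) →L[ℂ] PiLp 2 (fun _ : Fin n => H))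
    (k l : Fin n) : H →L[ℂ] H :=
  (PiLp.proj 2 (fun _ : Fin n => H) k : PiLp 2 (fun _ : Fin n => H) →L[ℂ] H) ∘L T ∘L
    ContinuousLinearMap.adjoint
      (PiLp.proj 2 (fun _ : Fin n => H) l : PiLp 2 (fun _ : Fin n => H) →L[ℂ] H)

theorem entry_star {n : ℕ} (T : PiLp 2 (fun _ : Fin n => H) →L[ℂ] PiLp 2 (fun _ : Fin n => H))
    (k l : Fin n) : entry (star T) k l = star (entry T l k) := by
  simp [entry, ContinuousLinearMap.star_eq_adjoint, ContinuousLinearMap.adjoint_comp,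
    ContinuousLinearMap.comp_assoc]

theorem sum_adjoint_proj_comp_proj (H : Type*) [NormedAddCommGroup H] [InnerProductSpace ℂ H]
    [CompleteSpace H] (n : ℕ) :
    ∑ k, ContinuousLinearMap.adjoint
      (PiLp.proj 2 (fun _ : Fin n => H) k : PiLp 2 (fun _ : Fin n => H) →L[ℂ] H) ∘L
      (PiLp.proj 2 (fun _ : Fin n => H) k : PiLp 2 (fun _ : Fin n => H) →L[ℂ] H) =
    ContinuousLinearMap.id ℂ _ := by
  ext1 x
  refine ext_inner_right ℂ fun y => ?_
  simp [sum_inner, ContinuousLinearMap.adjoint_inner_left, PiLp.inner_apply]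

theorem entry_mul {n : ℕ} (S T : PiLp 2 (fun _ : Fin n => H) →L[ℂ] PiLp 2 (fun _ : Fin n => H))
    (k l : Fin n) : entry (S * T) k l = ∑ i, entry S k i * entry T i l := by
  have h : S * T = S ∘L (ContinuousLinearMap.id ℂ _) ∘L T := rfl
  rw [h, ← sum_adjoint_proj_comp_proj]
  ext ξ
  simp [entry]

theorem continuous_entry {n : ℕ} (k l : Fin n) :
    Continuous fun T : PiLp 2 (fun _ : Fin n => H) →L[ℂ] PiLp 2 (fun _ : Fin n => H) =>
      entry T k l := by
  unfold entry
  fun_prop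

/-- The matrix algebra `Mₙ(A)`, represented on `Hⁿ`. -/
def matrixAlgebra (n : ℕ) (A : NonUnitalStarSubalgebra ℂ (H →L[ℂ] H)) :
    NonUnitalStarSubalgebra ℂ (PiLp 2 (fun _ : Fin n => H) →L[ℂ] PiLp 2 (fun _ : Fin n => H)) where
  carrier := {T | ∀ k l, entry T k l ∈ A}
  add_mem' := by
    intro S T hS hT k l
    have h : entry (S + T) k l = entry S k l + entry T k l := by ext; simp [entry]
    rw [h]
    exact add_mem (hS k l) (hT k l)
  zero_mem' := by
    intro k l
    have h : entry (0 : PiLp 2 (fun _ : Fin n => H) →L[ℂ] PiLp 2 (fun _ : Fin n => H)) k l = 0 := by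
      ext; simp [entry]
    rw [h]
    exact zero_mem A
  mul_mem' := by
    intro S T hS hT k l
    rw [entry_mul]
    exact sum_mem fun i _ => mul_mem (hS k i) (hT i l)
  smul_mem' := by
    intro z T hT k l
    have h : entry (z • T) k l = z • entry T k l := by ext; simp [entry]
    rw [h]
    exact SMulMemClass.smul_mem z (hT k l)
  star_mem' := by
    intro T hT k l
    rw [entry_star]
    exact star_mem (hT l k)

instance isClosed_matrixAlgebra (n : ℕ) (A : NonUnitalStarSubalgebra ℂ (H →L[ℂ] H))
    [hA : IsClosed (A : Set (H →L[ℂ] H))] :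
    IsClosed (matrixAlgebra n A :
      Set (PiLp 2 (fun _ : Fin n => H) →L[ℂ] PiLp 2 (fun _ : Fin n => H))) := by
  have h : (matrixAlgebra n A :
      Set (PiLp 2 (fun _ : Fin n => H) →L[ℂ] PiLp 2 (fun _ : Fin n => H))) =
      ⋂ k, ⋂ l, (fun T => entry T k l) ⁻¹' (A : Set (H →L[ℂ] H)) := by
    ext T
    simp only [Set.mem_iInter, Set.mem_preimage]
    rfl
  rw [h]
  exact isClosed_iInter fun k => isClosed_iInter fun l => hA.preimage (continuous_entry k l)

/-- The algebra `Dₙ(D)` of diagonal `n × n` matrices with entries in `D`, represented on `Hⁿ`. -/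
def diagonalAlgebra (n : ℕ) (D : NonUnitalStarSubalgebra ℂ (H →L[ℂ] H)) :
    NonUnitalStarSubalgebra ℂ (PiLp 2 (fun _ : Fin n => H) →L[ℂ] PiLp 2 (fun _ : Fin n => H)) where
  carrier := {T | T ∈ matrixAlgebra n D ∧ ∀ k l, k ≠ l → entry T k l = 0}
  add_mem' := by
    rintro S T ⟨hS, hS'⟩ ⟨hT, hT'⟩
    refine ⟨add_mem hS hT, fun k l hkl => ?_⟩
    have h : entry (S + T) k l = entry S k l + entry T k l := by ext; simp [entry]
    rw [h, hS' k l hkl, hT' k l hkl, add_zero]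
  zero_mem' := ⟨zero_mem _, fun k l _ => by ext; simp [entry]⟩
  mul_mem' := by
    rintro S T ⟨hS, hS'⟩ ⟨hT, hT'⟩
    refine ⟨mul_mem hS hT, fun k l hkl => ?_⟩
    rw [entry_mul]
    refine Finset.sum_eq_zero fun i _ => ?_
    by_cases hki : k = i
    · subst hki
      rw [hT' k l hkl, mul_zero]
    · rw [hS' k i hki, zero_mul]
  smul_mem' := by
    rintro z T ⟨hT, hT'⟩
    refine ⟨SMulMemClass.smul_mem z hT, fun k l hkl => ?_⟩
    have h : entry (z • T) k l = z • entry T k l := by ext; simp [entry]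
    rw [h, hT' k l hkl, smul_zero]
  star_mem' := by
    rintro T ⟨hT, hT'⟩
    refine ⟨star_mem hT, fun k l hkl => ?_⟩
    rw [entry_star, hT' l k (Ne.symm hkl), star_zero]

end Constructions

end GenDiag

end

noncomputable section

namespace GenDiag

/-! ### Positivity and Gram matrices -/

section Gram

variable {X Y Z : Type*} [NonUnitalCStarAlgebra X] [NonUnitalCStarAlgebra Y]
  [NonUnitalCStarAlgebra Z]

/-! Order zero and the commutant condition are hard to check for direct sums and tensor products of
maps, so both are traded for conditions that pass through these constructions. For a completely
positive map `φ`, order zero is equivalent to the identity φ(x)φ(yz) = φ(xy)φ(z). The substantial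
direction is `IsOrderZero.map_mul_map_mul`, which rests on the fact that a bounded bilinear map
vanishing on pairs with zero product satisfies W(y,1) = W(1,y) (`bilinear_apply_one`).

For the commutant condition, let π be any supporting homomorphism and u run through any increasing
approximate unit. Then π(e_kk ⊗ u) converges strongly to the projection onto the closed span of the
ranges of the operators φ(e_kl ⊗ b), the k-th row space (`IsSupportingHom.tendsto_blockUnit`). So
the condition says precisely that the diagonal algebra leaves each closed row space invariant. Since
the definition quantifies over all π, extracting this information requires that some π exists;
`exists_supportingHom` builds one from the identity above. The outcome is `dimLE_iff`, in which the
blocks have arbitrary finite index sets and the summand number is a colour attached to each block.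

Direct sums: all conditions hold componentwise, and blocks of the two sides may share a colour, so
the number of colours is the maximum (`Approx.directSum`).

Tensor products: the maps are ψ ⊗ ψ' and φ ⊗ φ', and the colours are pairs, which gives the product
(d+1)(d'+1). Complete positivity is handled by Gram matrices: entrywise products of Gram matrices
are again Gram matrices. The map ψ ⊗ ψ' is obtained from slice maps on the spatial tensor product.
Contractivity of completely positive maps follows from a Schwarz inequality tested on an approximate
unit (`IsCP.isContractive`). Normalisers do not form a linear space, but where a whole linear space
consists of normalisers, polarisation controls the cross terms in sums of elementary tensors
(`TensorModel.up_mem_normalisers`). Finally φψ ⊗ φ'ψ' is bounded by the number of colours, so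
closeness to the identity on elementary tensors extends to all elements
(`TensorModel.exists_norm_sub_lt`).

Matrix algebras: M_n(A) is M_n ⊗ A, and the diagonal matrices in M_n have dimension zero by the
identity factorisation (`dimLE_scalarDiagonal`), so the tensor product bound applies with a factor
one. To serve both purposes, tensor products are studied for an abstract `TensorModel`. -/

theorem isPos_iff {x : X} : IsPos x ↔ ∃ y, x = star y * y := by
  let _ := CStarAlgebra.spectralOrder X
  have _ := CStarAlgebra.spectralOrderedRing (A := X)
  exact CStarAlgebra.nonneg_iff_eq_star_mul_self (A := X)

theorem nonneg_iff_exists_star_mul_self [PartialOrder X] [StarOrderedRing X] {x : X} :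
    0 ≤ x ↔ ∃ y, x = star y * y :=
  CStarAlgebra.nonneg_iff_eq_star_mul_self

/-- In particular a C⋆-algebra is the linear span of its products. Identities known only for φ(xy)
are thereby transferred to φ(x), without factorisation theorems. -/
theorem exists_sum_star_mul_self (x : X) :
    ∃ y : Fin 4 → X, x = ∑ i : Fin 4, Complex.I ^ (i : ℕ) • (star (y i) * y i) := by
  let _ := CStarAlgebra.spectralOrder X
  have _ := CStarAlgebra.spectralOrderedRing (A := X)
  obtain ⟨z, hz, -, h⟩ := CStarAlgebra.exists_sum_four_nonneg x
  choose y hy using fun i => CStarAlgebra.nonneg_iff_eq_star_mul_self.1 (hz i)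
  exact ⟨y, by simpa only [← hy] using h⟩

/-- The matrices of the form `∑ κ, R κ i ^* R κ j`. -/
def IsGram {n : Type} (M : n → n → X) : Prop :=
  ∃ (κ : Type) (_ : Fintype κ) (R : κ → n → X), ∀ i j, M i j = ∑ k, star (R k i) * R k j

theorem isGram_star_mul {n : Type} (x : n → X) : IsGram fun i j => star (x i) * x j :=
  ⟨Unit, inferInstance, fun _ => x, fun i j => by simp⟩

theorem IsGram.comp {n m : Type} {M : n → n → X} (h : IsGram M) (f : m → n) :
    IsGram fun i j => M (f i) (f j) := by
  obtain ⟨κ, _, R, hR⟩ := h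
  exact ⟨κ, inferInstance, fun k i => R k (f i), fun i j => hR _ _⟩

theorem IsGram.sum {n α : Type} [Fintype α] {M : α → n → n → X} (h : ∀ a, IsGram (M a)) :
    IsGram fun i j => ∑ a, M a i j := by
  choose κ hκ R hR using h
  refine ⟨Σ a, κ a, inferInstance, fun k => R k.1 k.2, fun i j => ?_⟩
  rw [Fintype.sum_sigma]
  exact Finset.sum_congr rfl fun a _ => hR a i j

theorem IsGram.add {n : Type} {M N : n → n → X} (hM : IsGram M) (hN : IsGram N) :
    IsGram fun i j => M i j + N i j := by
  have h := IsGram.sum (M := fun b : Bool => if b then M else N) (by intro b; cases b <;> simpa)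
  simpa using h

theorem IsGram.congr {n : Type} {M N : n → n → X} (hM : IsGram M) (h : ∀ i j, N i j = M i j) :
    IsGram N := by
  obtain rfl : N = M := funext fun i => funext fun j => h i j
  exact hM

/-- Sum the vectors `R k (i, a)` over `a`; the double sum is then the expansion of a product of two
sums. -/
theorem IsGram.collapse {n p : Type} [Fintype p] {M : n × p → n × p → X} (h : IsGram M) :
    IsGram fun i j => ∑ a, ∑ b, M (i, a) (j, b) := by
  obtain ⟨κ, _, R, hR⟩ := h
  refine ⟨κ, inferInstance, fun k i => ∑ a, R k (i, a), fun i j => ?_⟩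
  have h1 : ∀ k, star (∑ a, R k (i, a)) * ∑ b, R k (j, b) =
      ∑ a, ∑ b, star (R k (i, a)) * R k (j, b) := fun k => by
    rw [star_sum, Finset.sum_mul_sum]
  simp only [hR, h1]
  rw [Finset.sum_comm' (t' := Finset.univ) (s' := fun _ => Finset.univ) (by simp)]
  rw [Finset.sum_comm (γ := κ)]
  rw [Finset.sum_comm (γ := p)]
  exact Finset.sum_congr rfl fun b _ => Finset.sum_comm

theorem IsGram.map {n : Type} {M : n → n → X} (h : IsGram M) (σ : X →⋆ₙₐ[ℂ] Y) :
    IsGram fun i j => σ (M i j) := by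
  obtain ⟨κ, _, R, hR⟩ := h
  exact ⟨κ, inferInstance, fun k i => σ (R k i), fun i j => by simp [hR, map_star]⟩

/-- The Schur product theorem: the vectors T(R_k i, R'_k' i), indexed by pairs (k, k'), have the
required Gram matrix. This is the source of complete positivity for all tensor product maps below.
-/
theorem IsGram.map₂ {n : Type} {M : n → n → X} {N : n → n → Y} (hM : IsGram M) (hN : IsGram N)
    (T : X →ₗ[ℂ] Y →ₗ[ℂ] Z) (hmul : ∀ x y x' y', T (x * x') (y * y') = T x y * T x' y')
    (hstar : ∀ x y, T (star x) (star y) = star (T x y)) :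
    IsGram fun i j => T (M i j) (N i j) := by
  obtain ⟨κ, _, R, hR⟩ := hM
  obtain ⟨κ', _, R', hR'⟩ := hN
  refine ⟨κ × κ', inferInstance, fun k i => T (R k.1 i) (R' k.2 i), fun i j => ?_⟩
  simp [hR, hR', hmul, hstar, Fintype.sum_prod_type, Finset.sum_comm (γ := κ)]

theorem isGram_pi {n ι : Type} [Fintype ι] {Y : ι → Type*}
    [∀ i, NonUnitalCStarAlgebra (Y i)] {M : n → n → ∀ i, Y i}
    (h : ∀ a, IsGram fun i j => M i j a) : IsGram M := by
  classical
  choose κ hκ R hR using h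
  refine ⟨Σ a, κ a, inferInstance, fun k i => Pi.single k.1 (R k.1 k.2 i), fun i j => ?_⟩
  ext a
  rw [Fintype.sum_sigma, Finset.sum_apply, Finset.sum_eq_single a, Finset.sum_apply]
  · simpa using hR a i j
  · intro b _ hb
    simp [Finset.sum_apply, hb.symm]
  · simp

/-- The element of `M_R(B)` with the given entries. -/
def mkMat {R B : Type*} (f : R → R → B) : CStarMatrix R R B := CStarMatrix.ofMatrix (Matrix.of f)

@[simp]
theorem mkMat_apply {R B : Type*} (f : R → R → B) (k l : R) : mkMat f k l = f k l := rfl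

theorem sum_matrix_apply {B ι m n : Type*} [AddCommMonoid B] (s : Finset ι)
    (f : ι → CStarMatrix m n B) (k : m) (l : n) : (∑ a ∈ s, f a) k l = ∑ a ∈ s, f a k l := by
  classical
  induction s using Finset.induction_on with
  | empty => simp
  | insert a s ha ih => rw [Finset.sum_insert ha, Finset.sum_insert ha, CStarMatrix.add_apply, ih]

variable {B : Type*} [NonUnitalCStarAlgebra B] [PartialOrder B] [StarOrderedRing B]

/-- Each row vector over `R` is placed in row `k₀` of a square matrix that is zero elsewhere. Then
star(S) * S' has as entries the products of the entries of the two rows. -/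
theorem IsGram.toMatrix {n R : Type} [Fintype R] {M : n × R → n × R → B} (h : IsGram M) :
    IsGram fun i j => (mkMat fun k l => M (i, k) (j, l) : CStarMatrix R R B) := by
  classical
  obtain ⟨κ, _, r, hr⟩ := h
  rcases isEmpty_or_nonempty R with hR | ⟨⟨k₀⟩⟩
  · exact ⟨κ, inferInstance, fun _ _ => 0, fun i j => by ext k; exact hR.elim k⟩
  · refine ⟨κ, inferInstance, fun a i =>
      mkMat fun k l => if k = k₀ then r a (i, l) else 0, fun i j => ?_⟩
    ext k l
    rw [sum_matrix_apply]
    simp only [CStarMatrix.mul_apply, CStarMatrix.star_apply, mkMat_apply, hr]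
    refine Finset.sum_congr rfl fun a _ => ?_
    rw [Finset.sum_eq_single k₀] <;> simp +contextual

theorem IsGram.ofMatrix {n R : Type} [Fintype R] {M : n → n → CStarMatrix R R B} (h : IsGram M) :
    IsGram fun p q : n × R => M p.1 q.1 p.2 q.2 := by
  obtain ⟨κ, _, r, hr⟩ := h
  refine ⟨κ × R, inferInstance, fun a p => r a.1 p.1 a.2 p.2, fun p q => ?_⟩
  simp [hr, sum_matrix_apply, CStarMatrix.mul_apply, CStarMatrix.star_apply,
    Fintype.sum_prod_type]

/-- Positivity in M_n(B) is expressed by entries alone, which allows index sets to be reshuffled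
without carrying the matrix structure along. -/
theorem nonneg_iff_isGram {n : Type} [Fintype n] (M : CStarMatrix n n B) :
    0 ≤ M ↔ IsGram (X := B) (fun i j : n => M i j) := by
  constructor
  · intro h
    obtain ⟨N, rfl⟩ := nonneg_iff_exists_star_mul_self.1 h
    exact ⟨n, inferInstance, fun k i => N k i, fun i j =>
      CStarMatrix.mul_apply⟩
  · intro h
    -- Regarding M as a 1 × 1 matrix over M_n(B) turns the Gram vectors into matrices whose squares
    -- sum to M.
    have h2 : IsGram (n := Unit × n) (fun p q => M p.2 q.2) := h.comp Prod.snd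
    obtain ⟨κ, _, r, hr⟩ := h2.toMatrix
    have h3 : M = ∑ k, star (r k ()) * r k () := (hr () ()).symm ▸ rfl
    rw [h3]
    exact Finset.sum_nonneg fun k _ => star_mul_self_nonneg _

/-- The positive cone of M_n(B) is closed, and convergence of matrices is convergence of entries. -/
theorem IsGram.of_tendsto {n : Type} [Fintype n] {α : Type*} {l : Filter α} [l.NeBot]
    {M : α → n → n → B} {N : n → n → B} (hM : ∀ᶠ a in l, IsGram (M a))
    (h : ∀ i j, Tendsto (fun a => M a i j) l (𝓝 (N i j))) : IsGram N := by
  have h1 : Tendsto (fun a => (mkMat (M a) : CStarMatrix n n B)) l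
      (𝓝 (mkMat N)) :=
    tendsto_pi_nhds.2 fun i => tendsto_pi_nhds.2 fun j => h i j
  exact (nonneg_iff_isGram (mkMat N)).1 (ge_of_tendsto h1
    (hM.mono fun a ha => (nonneg_iff_isGram (mkMat (M a))).2 ha))

end Gram

/-! ### Completely positive maps -/

section CP

variable {X Y Z : Type*} [NonUnitalCStarAlgebra X] [NonUnitalCStarAlgebra Y]
  [NonUnitalCStarAlgebra Z]

theorem IsCP.isGram {φ : X →ₗ[ℂ] Y} (hφ : IsCP φ) {n : Type} [Fintype n] {M : n → n → X}
    (hM : IsGram M) : IsGram fun i j => φ (M i j) := by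
  let _ := CStarAlgebra.spectralOrder X
  let _ := CStarAlgebra.spectralOrder Y
  have _ := CStarAlgebra.spectralOrderedRing (A := X)
  have _ := CStarAlgebra.spectralOrderedRing (A := Y)
  obtain ⟨f, rfl⟩ := hφ
  exact (nonneg_iff_isGram _).1 (f.map_cstarMatrix_nonneg (mkMat M)
    ((nonneg_iff_isGram _).2 hM))

/-- A positive matrix is a sum of matrices of the form (x_i^* x_j), so only these have to be tested.
-/
theorem isCP_of_isGram {φ : X →ₗ[ℂ] Y}
    (h : ∀ (n : Type) [Fintype n] (x : n → X), IsGram fun i j => φ (star (x i) * x j)) :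
    IsCP φ := by
  let _ := CStarAlgebra.spectralOrder X
  let _ := CStarAlgebra.spectralOrder Y
  have _ := CStarAlgebra.spectralOrderedRing (A := X)
  have _ := CStarAlgebra.spectralOrderedRing (A := Y)
  refine ⟨⟨φ, fun k M hM => ?_⟩, rfl⟩
  obtain ⟨κ, _, r, hr⟩ := (nonneg_iff_isGram _).1 hM
  refine (nonneg_iff_isGram _).2 ?_
  beta_reduce at hr
  refine (IsGram.sum fun a => h (Fin k) (r a)).congr fun i j => ?_
  rw [CStarMatrix.map_apply, hr, map_sum]

theorem IsCP.comp {φ : X →ₗ[ℂ] Y} {χ : Y →ₗ[ℂ] Z} (hχ : IsCP χ) (hφ : IsCP φ) :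
    IsCP (χ ∘ₗ φ) :=
  isCP_of_isGram fun _ _ x => hχ.isGram (hφ.isGram (isGram_star_mul x))

theorem isCP_starHom (σ : X →⋆ₙₐ[ℂ] Y) : IsCP (σ : X →ₗ[ℂ] Y) :=
  isCP_of_isGram fun _ _ x => (isGram_star_mul x).map σ

theorem IsCP.exists_bound {φ : X →ₗ[ℂ] Y} (hφ : IsCP φ) : ∃ C : ℝ, 0 ≤ C ∧ ∀ x, ‖φ x‖ ≤ C * ‖x‖ := by
  let _ := CStarAlgebra.spectralOrder X
  let _ := CStarAlgebra.spectralOrder Y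
  have _ := CStarAlgebra.spectralOrderedRing (A := X)
  have _ := CStarAlgebra.spectralOrderedRing (A := Y)
  obtain ⟨f, rfl⟩ := hφ
  obtain ⟨C, hC⟩ := PositiveLinearMap.exists_norm_apply_le (.ofClass f)
  exact ⟨C, C.2, hC⟩

theorem IsCP.continuous {φ : X →ₗ[ℂ] Y} (hφ : IsCP φ) : Continuous φ := by
  obtain ⟨C, -, hC⟩ := hφ.exists_bound
  exact (φ.mkContinuous C hC).continuous

theorem IsCP.exists_eq_star_mul_self {φ : X →ₗ[ℂ] Y} (hφ : IsCP φ) (x : X) :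
    ∃ y, φ (star x * x) = star y * y := by
  obtain ⟨κ, _, r, hr⟩ := hφ.isGram (isGram_star_mul (fun _ : Unit => x))
  let _ := CStarAlgebra.spectralOrder Y
  have _ := CStarAlgebra.spectralOrderedRing (A := Y)
  rw [← CStarAlgebra.nonneg_iff_eq_star_mul_self]
  rw [show φ (star x * x) = _ from hr () ()]
  exact Finset.sum_nonneg fun k _ => star_mul_self_nonneg _

theorem IsCP.map_star {φ : X →ₗ[ℂ] Y} (hφ : IsCP φ) (x : X) : φ (star x) = star (φ x) := by
  obtain ⟨y, rfl⟩ := exists_sum_star_mul_self x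
  simp only [star_sum, map_sum, star_smul, map_smul, star_mul, star_star]
  refine Finset.sum_congr rfl fun i _ => ?_
  obtain ⟨z, hz⟩ := hφ.exists_eq_star_mul_self (y i)
  rw [hz, star_mul, star_star]

/-- The Cauchy–Schwarz inequality in the Hilbert C⋆-module Y^κ. -/
theorem norm_sum_star_mul_sq_le {κ : Type} [Fintype κ] (a b : κ → Y) :
    ‖∑ k, star (a k) * b k‖ ^ 2 ≤ ‖∑ k, star (a k) * a k‖ * ‖∑ k, star (b k) * b k‖ := by
  let _ := CStarAlgebra.spectralOrder Y
  have _ := CStarAlgebra.spectralOrderedRing (A := Y)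
  let v : WithCStarModule Y (κ → Y) := (WithCStarModule.equiv Y (κ → Y)).symm fun k => star (b k)
  let w : WithCStarModule Y (κ → Y) := (WithCStarModule.equiv Y (κ → Y)).symm fun k => star (a k)
  have h := CStarModule.norm_inner_le (A := Y) (E := WithCStarModule Y (κ → Y)) (x := v) (y := w)
  have hv := WithCStarModule.pi_norm_sq v
  have hw := WithCStarModule.pi_norm_sq w
  rw [WithCStarModule.pi_inner] at h
  simp only [WithCStarModule.inner_def, v, w, WithCStarModule.equiv_symm_pi_apply, star_star] at h hv hw
  rw [mul_comm, ← hv, ← hw, ← mul_pow]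
  exact pow_le_pow_left₀ (norm_nonneg _) h 2

/-- The image of the 2 × 2 Gram matrix of the pair (u^*, x) is again a Gram matrix; the
Cauchy–Schwarz inequality applies to its off-diagonal entry. No unit is needed, `u` plays its part.
-/
theorem IsCP.norm_map_mul_sq_le {φ : X →ₗ[ℂ] Y} (hφ : IsCP φ) (u x : X) :
    ‖φ (u * x)‖ ^ 2 ≤ ‖φ (u * star u)‖ * ‖φ (star x * x)‖ := by
  obtain ⟨κ, _, r, hr⟩ := hφ.isGram
    (isGram_star_mul (fun b : Bool => if b then star u else x))
  have h1 := hr true false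
  have h2 := hr true true
  have h3 := hr false false
  simp only [if_true, star_star, Bool.false_eq_true, if_false] at h1 h2 h3
  rw [h1, h2, h3]
  exact norm_sum_star_mul_sq_le _ _

/-- A function on a C⋆-algebra that grows at most linearly and satisfies a Schwarz inequality with
constant `c` is bounded by `c`. -/
theorem le_of_sq_le {f : X → ℝ} {c C : ℝ} (hf : ∀ x, 0 ≤ f x) (hc : 0 ≤ c)
    (hsq : ∀ x, f x ^ 2 ≤ c * f (star x * x)) (hC : ∀ x, f x ≤ C * ‖x‖) (x : X) :
    f x ≤ c * ‖x‖ := by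
  have hb : BddAbove (Set.range fun y => f y / ‖y‖) := by
    refine ⟨max C 0, ?_⟩
    rintro _ ⟨y, rfl⟩
    refine div_le_of_le_mul₀ (norm_nonneg _) (le_max_right _ _) ((hC y).trans ?_)
    gcongr
    exact le_max_left _ _
  -- The linear growth makes K finite. The Schwarz inequality then gives K ≤ √(cK), which forces K ≤
  -- c.
  set K := ⨆ y, f y / ‖y‖ with hK
  have h0 : ∀ y, f y ≤ K * ‖y‖ := fun y => by
    rcases eq_or_ne y 0 with rfl | hy
    · simpa using hC 0
    · have := le_ciSup hb y
      rwa [div_le_iff₀ (norm_pos_iff.2 hy)] at this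
  have hK0 : 0 ≤ K := Real.iSup_nonneg fun y => div_nonneg (hf y) (norm_nonneg _)
  have h1 : ∀ y, f y / ‖y‖ ≤ Real.sqrt (c * K) := fun y => by
    refine Real.le_sqrt_of_sq_le ?_
    rcases eq_or_ne y 0 with rfl | hy
    · simpa using mul_nonneg hc hK0
    · rw [div_pow, div_le_iff₀ (by positivity)]
      calc f y ^ 2 ≤ c * f (star y * y) := hsq y
        _ ≤ c * (K * ‖star y * y‖) := by gcongr; exact h0 _
        _ = c * K * ‖y‖ ^ 2 := by rw [CStarRing.norm_star_mul_self]; ring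
  have h2 : K ≤ Real.sqrt (c * K) := ciSup_le h1
  have h3 : K ≤ c := by
    have := Real.sq_sqrt (mul_nonneg hc hK0)
    by_contra! hlt
    nlinarith [Real.sqrt_nonneg (c * K)]
  exact (h0 x).trans (by gcongr)

/-- Let u tend to the unit in ‖φ(ux)‖² ≤ ‖φ(uu^*)‖ ‖φ(x^*x)‖; the limit is the hypothesis of
`le_of_sq_le` with constant 1. Contractivity thus has to be checked only on the elements uu^*. -/
theorem IsCP.isContractive {φ : X →ₗ[ℂ] Y} (hφ : IsCP φ) {α : Type*} {l : Filter α} [l.NeBot]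
    {u : α → X} (hu : ∀ x, Tendsto (fun a => u a * x) l (𝓝 x))
    (h1 : ∀ᶠ a in l, ‖φ (u a * star (u a))‖ ≤ 1) : IsContractive φ := by
  obtain ⟨C, hC0, hC⟩ := hφ.exists_bound
  intro x
  have h := le_of_sq_le (f := fun x => ‖φ x‖) (c := 1) (C := C) (fun _ => norm_nonneg _)
    zero_le_one (fun x => ?_) hC x
  · simpa using h
  · have h2 : Tendsto (fun a => ‖φ (u a * x)‖ ^ 2) l (𝓝 (‖φ x‖ ^ 2)) :=
      (((hφ.continuous.tendsto x).comp (hu x)).norm).pow 2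
    refine le_of_tendsto h2 (h1.mono fun a ha => ?_)
    refine (hφ.norm_map_mul_sq_le _ _).trans ?_
    gcongr

theorem isContractive_starHom (σ : X →⋆ₙₐ[ℂ] Y) (x : X) : ‖σ x‖ ≤ ‖x‖ :=
  NonUnitalStarAlgHom.norm_apply_le σ x

end CP

end GenDiag
end

noncomputable section

namespace GenDiag

/-! ### Bilinear maps that vanish on pairs with zero product -/

section Bilinear

/-- The truncation of a real number to the unit interval. -/
def clamp (v : ℝ) : ℝ := max 0 (min 1 v)

theorem continuous_clamp : Continuous clamp := by unfold clamp; fun_prop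

/-- The piecewise linear function with support `[-1, 1]` and value `1` at `0`. -/
def hat (v : ℝ) : ℝ := clamp (v + 1) - clamp v

theorem continuous_hat : Continuous hat := by
  unfold hat
  exact (continuous_clamp.comp (by fun_prop)).sub continuous_clamp

theorem hat_nonneg (v : ℝ) : 0 ≤ hat v := by
  unfold hat clamp
  rcases max_cases 0 (min 1 (v + 1)) with h | h <;> rcases max_cases 0 (min 1 v) with h' | h' <;>
  rcases min_cases 1 (v + 1) with k | k <;> rcases min_cases 1 v with k' | k' <;> linarith

theorem hat_eq_zero {v : ℝ} (h : 1 ≤ |v|) : hat v = 0 := by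
  unfold hat clamp
  rcases le_abs.1 h with h | h
  · rw [min_eq_left (by linarith), min_eq_left h, sub_self]
  · rw [max_eq_left (by rw [min_le_iff]; right; linarith),
      max_eq_left (by rw [min_le_iff]; right; linarith), sub_self]

theorem hat_mul_hat {u v : ℝ} (h : 2 ≤ |u - v|) : hat u * hat v = 0 := by
  by_cases hu : 1 ≤ |u|
  · rw [hat_eq_zero hu, zero_mul]
  · rw [hat_eq_zero (v := v), mul_zero]
    have := abs_sub u v
    linarith

/-- With e(v) = clamp v · (1 − clamp v) this reads v · hat v = e(v) − e(v+1), so sums of these terms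
over integer translates telescope, as do those of `hat` itself. -/
theorem mul_hat (v : ℝ) :
    v * hat v = clamp v * (1 - clamp v) - clamp (v + 1) * (1 - clamp (v + 1)) := by
  rcases le_or_gt v (-1) with h | h
  · have h1 : clamp v = 0 := max_eq_left (by rw [min_le_iff]; right; linarith)
    have h2 : clamp (v + 1) = 0 := max_eq_left (by rw [min_le_iff]; right; linarith)
    simp [hat, h1, h2]
  rcases le_or_gt v 0 with h' | h'
  · have h1 : clamp v = 0 := max_eq_left (by rw [min_le_iff]; right; linarith)
    have h2 : clamp (v + 1) = v + 1 := by
      rw [clamp, min_eq_right (by linarith), max_eq_right (by linarith)]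
    simp only [hat, h1, h2]; ring
  have h2 : clamp (v + 1) = 1 := by
    rw [clamp, min_eq_left (by linarith), max_eq_right (by linarith)]
  simp only [hat, h2]
  rcases le_or_gt v 1 with h3 | h3
  · have h1 : clamp v = v := by rw [clamp, min_eq_right (by linarith), max_eq_right (by linarith)]
    rw [h1]; ring
  · have h1 : clamp v = 1 := by rw [clamp, min_eq_left (by linarith), max_eq_right (by linarith)]
    rw [h1]; ring

theorem sum_hat {s : ℝ} (n : ℕ) (h0 : 0 ≤ s) (hn : s ≤ n) :
    ∑ j ∈ Finset.range (n + 1), hat (s - j) = 1 := by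
  have h := Finset.sum_range_sub' (fun j : ℕ => clamp (s - j + 1)) (n + 1)
  have h1 : clamp (s + 1) = 1 := by
    rw [clamp, min_eq_left (by linarith), max_eq_right (by linarith)]
  have h2 : clamp (s - n) = 0 := max_eq_left (by rw [min_le_iff]; right; linarith)
  calc _ = ∑ j ∈ Finset.range (n + 1), (clamp (s - j + 1) - clamp (s - (j + 1 : ℕ) + 1)) := by
        refine Finset.sum_congr rfl fun j _ => ?_
        rw [hat]; push_cast; congr 2; ring
    _ = 1 := by
        rw [h]; push_cast
        rw [show s - (n + 1 : ℝ) + 1 = s - n by ring, h2, sub_zero (s : ℝ), h1, sub_zero]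

/-- Telescoping gives Σ (s − j) hat(s − j) = 0, and the values hat(s − j) sum to 1. -/
theorem sum_mul_hat {s : ℝ} (n : ℕ) (h0 : 0 ≤ s) (hn : s ≤ n) :
    ∑ j ∈ Finset.range (n + 1), (j : ℝ) * hat (s - j) = s := by
  set e : ℝ → ℝ := fun v => clamp v * (1 - clamp v) with he
  have h := Finset.sum_range_sub' (fun j : ℕ => e (s - j + 1)) (n + 1)
  have h1 : clamp (s + 1) = 1 := by
    rw [clamp, min_eq_left (by linarith), max_eq_right (by linarith)]
  have h2 : clamp (s - n) = 0 := max_eq_left (by rw [min_le_iff]; right; linarith)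
  have h3 : ∑ j ∈ Finset.range (n + 1), (s - j) * hat (s - j) = 0 := by
    calc _ = -∑ j ∈ Finset.range (n + 1), (e (s - j + 1) - e (s - (j + 1 : ℕ) + 1)) := by
          rw [← Finset.sum_neg_distrib]
          refine Finset.sum_congr rfl fun j _ => ?_
          rw [mul_hat]; push_cast
          rw [show s - (j + 1 : ℝ) + 1 = s - j by ring]; ring
      _ = 0 := by
          rw [h]; push_cast
          rw [show s - (n + 1 : ℝ) + 1 = s - n by ring]
          simp [he, h1, h2]
  have h4 := sum_hat n h0 hn
  simp only [sub_mul, Finset.sum_sub_distrib, ← Finset.mul_sum, h4] at h3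
  linarith

variable {E Y : Type*} [CStarAlgebra E] [PartialOrder E] [StarOrderedRing E]
  [NormedAddCommGroup Y] [NormedSpace ℂ Y]

/-- The elements are d_j = hat(ny − j) in the continuous functional calculus. They form a partition
of unity in which only neighbours overlap, and ny is recovered as Σ j d_j. -/
theorem exists_hat_partition {y : E} (hy : 0 ≤ y) (hy1 : ‖y‖ ≤ 1) (n : ℕ) :
    ∃ d : ℕ → E, ∑ j ∈ Finset.range (n + 1), d j = 1 ∧
      ∑ j ∈ Finset.range (n + 1), (j : ℂ) • d j = (n : ℂ) • y ∧
      (∀ i j, i + 2 ≤ j → d i * d j = 0 ∧ d j * d i = 0) ∧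
      ∀ s ⊆ Finset.range (n + 1), ‖∑ j ∈ s, d j‖ ≤ 1 := by
  have hsa : IsSelfAdjoint y := .of_nonneg hy
  have hsp : ∀ t ∈ spectrum ℝ y, 0 ≤ (n : ℝ) * t ∧ (n : ℝ) * t ≤ n := fun t ht => by
    have h0 : 0 ≤ t := spectrum_nonneg_of_nonneg hy ht
    have h1 : ‖t‖ ≤ 1 := by
      rcases subsingleton_or_nontrivial E with hE | hE
      · simp [spectrum.of_subsingleton] at ht
      exact (spectrum.norm_le_norm_of_mem ht).trans hy1
    rw [Real.norm_of_nonneg h0] at h1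
    exact ⟨by positivity, mul_le_of_le_one_right (by positivity) h1⟩
  have hc : ∀ j : ℕ, Continuous fun t : ℝ => hat (n * t - j) := fun j =>
    continuous_hat.comp (by fun_prop)
  refine ⟨fun j => cfc (fun t : ℝ => hat (n * t - j)) y, ?_, ?_, ?_, ?_⟩
  · rw [← cfc_sum _ _ _ fun j _ => (hc j).continuousOn, ← cfc_one ℝ y]
    exact cfc_congr fun t ht => by simpa using sum_hat n (hsp t ht).1 (hsp t ht).2
  · have h : ∀ j : ℕ, (j : ℂ) • cfc (fun t : ℝ => hat (n * t - j)) y =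
        cfc (fun t : ℝ => (j : ℝ) * hat (n * t - j)) y := fun j => by
      rw [cfc_const_mul _ _ _ (hc j).continuousOn]; norm_cast
    simp only [h]
    rw [← cfc_sum (fun (j : ℕ) (t : ℝ) => (j : ℝ) * hat (n * t - j)) _ _ fun j _ =>
      (continuous_const.mul (hc j)).continuousOn]
    have h2 : (n : ℂ) • y = cfc (fun t : ℝ => (n : ℝ) * t) y := by
      rw [cfc_const_mul_id _ y]; norm_cast
    rw [h2]
    exact cfc_congr fun t ht => by simpa using sum_mul_hat n (hsp t ht).1 (hsp t ht).2
  · intro i j hij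
    have h : ∀ i j : ℕ, (i + 2 ≤ j ∨ j + 2 ≤ i) →
        cfc (fun t : ℝ => hat (n * t - i)) y * cfc (fun t : ℝ => hat (n * t - j)) y = 0 := by
      intro i j hij
      rw [← cfc_mul _ _ y (hc i).continuousOn (hc j).continuousOn, ← cfc_zero ℝ y]
      congr 1
      ext t
      refine hat_mul_hat ?_
      rw [le_abs]
      rcases hij with h | h
      · left
        have : (i : ℝ) + 2 ≤ j := by exact_mod_cast h
        linarith
      · right
        have : (j : ℝ) + 2 ≤ i := by exact_mod_cast h
        linarith
    exact ⟨h i j (.inl hij), h j i (.inr hij)⟩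
  · intro s hs
    rw [← cfc_sum _ _ _ fun j _ => (hc j).continuousOn]
    refine norm_cfc_le zero_le_one fun t ht => ?_
    rw [Finset.sum_apply, Real.norm_of_nonneg (Finset.sum_nonneg fun j _ => hat_nonneg _)]
    rw [← sum_hat n (hsp t ht).1 (hsp t ht).2]
    exact Finset.sum_le_sum_of_subset_of_nonneg hs fun j _ _ => hat_nonneg _

/-- Expanding in the partition, n(W(y,1) − W(1,y)) = Σ (i − j) W(d_i, d_j), where only |i − j| = 1
contributes because distant d_i, d_j have product zero. These near-diagonal terms are grouped into
six values of W on contractions, so n‖W(y,1) − W(1,y)‖ ≤ 6M for every n. -/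
theorem bilinear_apply_one_of_norm_le {W : E →ₗ[ℂ] E →ₗ[ℂ] Y} {M : ℝ}
    (hM : ∀ a b, ‖W a b‖ ≤ M * ‖a‖ * ‖b‖) (hW : ∀ a b, a * b = 0 → W a b = 0)
    {y : E} (hy : 0 ≤ y) (hy1 : ‖y‖ ≤ 1) : W y 1 = W 1 y := by
  rcases subsingleton_or_nontrivial E with hE | hE
  · rw [Subsingleton.elim y 1]
  have hM0 : 0 ≤ M := by simpa using (norm_nonneg _).trans (hM 1 1)
  have key : ∀ n : ℕ, n * ‖W y 1 - W 1 y‖ ≤ 6 * M := by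
    intro n
    obtain ⟨d, h1, h2, h3, h4⟩ := exists_hat_partition hy hy1 n
    set s := Finset.range (n + 1)
    -- Residues modulo 3 separate the two sides of the diagonal: among indices that differ by at
    -- most one, i ≡ j + 1 modulo 3 happens exactly for i = j + 1. So each W(P r, P q) with r ≠ q
    -- collects terms from one off-diagonal only.
    let P : ℕ → E := fun r => ∑ j ∈ s with j % 3 = r, d j
    have hP : ∀ r q, ‖W (P r) (P q)‖ ≤ M := fun r q => by
      have ha := h4 _ (Finset.filter_subset (fun j => j % 3 = r) s)
      have hb := h4 _ (Finset.filter_subset (fun j => j % 3 = q) s)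
      calc _ ≤ M * ‖P r‖ * ‖P q‖ := hM _ _
        _ ≤ M * 1 * 1 := by gcongr
        _ = M := by ring
    have hWP : ∀ r q, W (P r) (P q) = ∑ i ∈ s, ∑ j ∈ s,
        if i % 3 = r ∧ j % 3 = q then W (d i) (d j) else 0 := fun r q => by
      simp only [P, map_sum, LinearMap.sum_apply, Finset.sum_filter]
      rw [Finset.sum_comm]
      refine Finset.sum_congr rfl fun i _ => ?_
      by_cases hi : i % 3 = r
      · simp only [hi, if_true, true_and]
        exact Finset.sum_congr rfl fun j _ => by split_ifs <;> simp
      · simp [hi]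
    have h5 : (n : ℂ) • (W y 1 - W 1 y) = W (P 1) (P 0) - W (P 0) (P 1) + (W (P 2) (P 1) -
        W (P 1) (P 2)) + (W (P 0) (P 2) - W (P 2) (P 0)) := by
      have e1 : (n : ℂ) • W y 1 = ∑ i ∈ s, ∑ j ∈ s, (i : ℂ) • W (d i) (d j) := by
        rw [← LinearMap.smul_apply, ← map_smul, ← h2, ← h1]
        simp only [map_sum, LinearMap.sum_apply, map_smul, LinearMap.smul_apply]
        rw [Finset.sum_comm]
      have e2 : (n : ℂ) • W 1 y = ∑ i ∈ s, ∑ j ∈ s, (j : ℂ) • W (d i) (d j) := by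
        rw [← map_smul, ← h2, ← h1]
        simp only [map_sum, LinearMap.sum_apply, map_smul, Finset.smul_sum]
        rw [Finset.sum_comm]
      rw [smul_sub, e1, e2]
      simp only [hWP, ← Finset.sum_sub_distrib, ← Finset.sum_add_distrib]
      refine Finset.sum_congr rfl fun i _ => Finset.sum_congr rfl fun j _ => ?_
      by_cases hij : i + 2 ≤ j
      · simp [hW _ _ (h3 i j hij).1]
      by_cases hji : j + 2 ≤ i
      · simp [hW _ _ (h3 j i hji).2]
      obtain rfl | rfl | rfl : i = j ∨ i = j + 1 ∨ j = i + 1 := by omega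
      · simp only [sub_self]
        have : i % 3 < 3 := Nat.mod_lt _ (by norm_num)
        interval_cases i % 3 <;> simp
      · have : j % 3 < 3 := Nat.mod_lt _ (by norm_num)
        have h6 : (j + 1) % 3 = (j % 3 + 1) % 3 := by omega
        rw [h6]
        push_cast
        interval_cases j % 3 <;> simp [add_smul]
      · have : i % 3 < 3 := Nat.mod_lt _ (by norm_num)
        have h6 : (i + 1) % 3 = (i % 3 + 1) % 3 := by omega
        rw [h6]
        push_cast
        interval_cases i % 3 <;> simp [add_smul]
    have h7 : (n : ℝ) * ‖W y 1 - W 1 y‖ = ‖(n : ℂ) • (W y 1 - W 1 y)‖ := by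
      rw [norm_smul]; simp
    rw [h7, h5]
    refine (norm_add₃_le).trans ?_
    have := norm_sub_le (W (P 1) (P 0)) (W (P 0) (P 1))
    have := norm_sub_le (W (P 2) (P 1)) (W (P 1) (P 2))
    have := norm_sub_le (W (P 0) (P 2)) (W (P 2) (P 0))
    linarith [hP 1 0, hP 0 1, hP 2 1, hP 1 2, hP 0 2, hP 2 0]
  by_contra hne
  have hpos : 0 < ‖W y 1 - W 1 y‖ := norm_pos_iff.2 (sub_ne_zero.2 hne)
  obtain ⟨n, hn⟩ := exists_nat_gt (6 * M / ‖W y 1 - W 1 y‖)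
  rw [div_lt_iff₀ hpos] at hn
  exact absurd (key n) (not_le.2 hn)

/-- A bounded bilinear map on a C⋆-algebra that vanishes on pairs with zero product. -/
theorem bilinear_apply_one {W : E →ₗ[ℂ] E →ₗ[ℂ] Y} {M : ℝ}
    (hM : ∀ a b, ‖W a b‖ ≤ M * ‖a‖ * ‖b‖) (hW : ∀ a b, a * b = 0 → W a b = 0)
    (y : E) : W y 1 = W 1 y := by
  have hpos : ∀ z : E, 0 ≤ z → W z 1 = W 1 z := fun z hz => by
    rcases eq_or_ne z 0 with rfl | hz0
    · simp
    have hn : ‖z‖ ≠ 0 := norm_ne_zero_iff.2 hz0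
    have h := bilinear_apply_one_of_norm_le hM hW (y := ‖z‖⁻¹ • z)
      (smul_nonneg (by positivity) hz) (by rw [norm_smul]; simp [hn])
    have h2 : (‖z‖⁻¹ • z : E) = ((‖z‖⁻¹ : ℝ) : ℂ) • z := by norm_cast
    rw [h2, map_smul, map_smul, LinearMap.smul_apply] at h
    exact smul_right_injective _ (by simpa using hn) h
  obtain ⟨x, hx, -, rfl⟩ := CStarAlgebra.exists_sum_four_nonneg y
  simp [map_sum, LinearMap.sum_apply, hpos _ (hx _)]

end Bilinear

/-! ### Order zero maps -/

section OrderZero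

variable {X Y : Type*} [NonUnitalCStarAlgebra X] [NonUnitalCStarAlgebra Y]

theorem exists_approximateUnit (X : Type*) [NonUnitalCStarAlgebra X] :
    ∃ l : Filter X, l.NeBot ∧ (∀ x, Tendsto (fun u => u * x) l (𝓝 x)) ∧
      (∀ x, Tendsto (fun u => x * u) l (𝓝 x)) ∧ (∀ᶠ u in l, ‖u‖ ≤ 1) ∧
      ∀ᶠ u in l, ∃ v, u = star v * v := by
  let _ := CStarAlgebra.spectralOrder X
  have _ := CStarAlgebra.spectralOrderedRing (A := X)
  have h := CStarAlgebra.increasingApproximateUnit X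
  exact ⟨_, h.neBot, h.tendsto_mul_right, h.tendsto_mul_left, h.eventually_norm,
    h.eventually_nonneg.mono fun u hu => nonneg_iff_exists_star_mul_self.1 hu⟩

/-- If φ(x^*x) = Σ r_k^* r_k, then φ(x^*x)y = 0 forces r_k y = 0 for all k. The same vectors occur
on the right in the expansion of φ(ux), so φ(ux)y = 0, and u tends to the unit. -/
theorem IsCP.map_mul_eq_zero {φ : X →ₗ[ℂ] Y} (hφ : IsCP φ) {x : X} {y : Y}
    (h : φ (star x * x) * y = 0) : φ x * y = 0 := by
  obtain ⟨l, _, hl, -⟩ := exists_approximateUnit X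
  have h1 : ∀ u, φ (u * x) * y = 0 := fun u => by
    obtain ⟨κ, _, r, hr⟩ := hφ.isGram (isGram_star_mul (fun b : Bool => if b then star u else x))
    have h2 := hr true false
    have h3 := hr false false
    simp only [if_true, star_star, Bool.false_eq_true, if_false] at h2 h3
    let _ := CStarAlgebra.spectralOrder Y
    have _ := CStarAlgebra.spectralOrderedRing (A := Y)
    have h4 : ∑ k, star (r k false * y) * (r k false * y) = 0 := by
      calc _ = star y * ((∑ k, star (r k false) * r k false) * y) := by
            simp [Finset.sum_mul, Finset.mul_sum, mul_assoc]
        _ = 0 := by rw [← h3, h, mul_zero]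
    rw [Finset.sum_eq_zero_iff_of_nonneg fun k _ => star_mul_self_nonneg _] at h4
    rw [h2, Finset.sum_mul]
    refine Finset.sum_eq_zero fun k hk => ?_
    rw [mul_assoc, (CStarRing.star_mul_self_eq_zero_iff _).1 (h4 k hk), mul_zero]
  have h2 : Tendsto (fun u => φ (u * x) * y) l (𝓝 (φ x * y)) :=
    ((hφ.continuous.tendsto x).comp (hl x)).mul_const y
  simp only [h1] at h2
  exact tendsto_nhds_unique h2 tendsto_const_nhds

/-- Positivity of the two elements can be dropped: xx' = 0 gives (x^*x)(x'x'^*) = 0, and the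
preceding cancellation is applied once on each side. -/
theorem IsOrderZero.map_mul_map_eq_zero {φ : X →ₗ[ℂ] Y} (hφ : IsOrderZero φ) {x x' : X}
    (h : x * x' = 0) : φ x * φ x' = 0 := by
  have h1 : φ (star x * x) * φ (x' * star x') = 0 := by
    refine hφ.2 _ _ (isPos_iff.2 ⟨x, rfl⟩) (isPos_iff.2 ⟨star x', by rw [star_star]⟩) ?_
    rw [mul_assoc, ← mul_assoc x, h, zero_mul, mul_zero]
  have h2 := hφ.1.map_mul_eq_zero h1
  have h3 : φ (star (star x') * star x') * star (φ x) = 0 := by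
    rw [star_star, ← star_eq_zero, star_mul, star_star, ← hφ.1.map_star, star_mul, star_star, h2]
  have h4 := hφ.1.map_mul_eq_zero h3
  rw [← star_eq_zero, star_mul, ← hφ.1.map_star, h4]

open scoped CStarAlgebra in
-- The bilinear map W(a, b) = φ(xa)φ(bz) on the unitisation vanishes whenever ab = 0, because then
-- (xa)(bz) = 0. Hence W(1, y) = W(y, 1), which is the assertion.
theorem IsOrderZero.map_mul_map_mul {φ : X →ₗ[ℂ] Y} (hφ : IsOrderZero φ) (x y z : X) :
    φ x * φ (y * z) = φ (x * y) * φ z := by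
  obtain ⟨C, hC0, hC⟩ := hφ.1.exists_bound
  -- Only elements of the ideal X are fed into `s`: the products xa and bz have scalar part zero.
  let s : Unitization ℂ X →ₗ[ℂ] X := Unitization.sndHom ℂ ℂ X
  let W : Unitization ℂ X →ₗ[ℂ] Unitization ℂ X →ₗ[ℂ] Y :=
    (LinearMap.mul ℂ Y).compl₁₂ (φ ∘ₗ s ∘ₗ LinearMap.mulLeft ℂ (x : Unitization ℂ X))
      (φ ∘ₗ s ∘ₗ LinearMap.mulRight ℂ (z : Unitization ℂ X))
  have hWdef : ∀ a b, W a b = φ (a.fst • x + x * a.snd) * φ (b.fst • z + b.snd * z) := by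
    intro a b
    simp [W, s, add_mul, smul_mul_assoc]
  have hinr : ∀ a b : Unitization ℂ X, (x : Unitization ℂ X) * a =
      ((a.fst • x + x * a.snd : X) : Unitization ℂ X) ∧ b * (z : Unitization ℂ X) =
      ((b.fst • z + b.snd * z : X) : Unitization ℂ X) := fun a b =>
    ⟨by ext <;> simp, by ext <;> simp⟩
  have hM : ∀ a b, ‖W a b‖ ≤ (C * ‖x‖ * (C * ‖z‖)) * ‖a‖ * ‖b‖ := by
    intro a b
    rw [hWdef]
    have h1 : ‖a.fst • x + x * a.snd‖ ≤ ‖x‖ * ‖a‖ := by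
      rw [← Unitization.norm_inr (𝕜 := ℂ), ← (hinr a b).1, ← Unitization.norm_inr (𝕜 := ℂ) (a := x)]
      exact norm_mul_le _ _
    have h2 : ‖b.fst • z + b.snd * z‖ ≤ ‖b‖ * ‖z‖ := by
      rw [← Unitization.norm_inr (𝕜 := ℂ), ← (hinr a b).2, ← Unitization.norm_inr (𝕜 := ℂ) (a := z)]
      exact norm_mul_le _ _
    calc _ ≤ ‖φ (a.fst • x + x * a.snd)‖ * ‖φ (b.fst • z + b.snd * z)‖ := norm_mul_le _ _
      _ ≤ (C * (‖x‖ * ‖a‖)) * (C * (‖b‖ * ‖z‖)) := by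
        gcongr
        · exact (hC _).trans (by gcongr)
        · exact (hC _).trans (by gcongr)
      _ = _ := by ring
  have hW : ∀ a b, a * b = 0 → W a b = 0 := by
    intro a b hab
    rw [hWdef]
    refine hφ.map_mul_map_eq_zero (Unitization.inr_injective (R := ℂ) ?_)
    rw [Unitization.inr_mul, ← (hinr a b).1, ← (hinr a b).2, mul_assoc, ← mul_assoc a, hab]
    simp
  have h := bilinear_apply_one hM hW (y : Unitization ℂ X)
  rw [hWdef, hWdef] at h
  simpa using h.symm

end OrderZero
end GenDiag
end

noncomputable section

namespace GenDiag

open scoped InnerProductSpace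

/-! ### Existence of supporting homomorphisms -/

section Hilbert

variable {H : Type*} [NormedAddCommGroup H] [InnerProductSpace ℂ H] [CompleteSpace H]

theorem clm_ext_of_submodule {L : Submodule ℂ H} {S T : H →L[ℂ] H} (h1 : ∀ ξ ∈ L, S ξ = T ξ)
    (h2 : ∀ ξ ∈ Lᗮ, S ξ = T ξ) : S = T := by
  have h3 : ∀ ξ ∈ L.topologicalClosure, S ξ = T ξ := fun ξ hξ =>
    (isClosed_eq S.continuous T.continuous).closure_subset_iff.2 h1 hξ
  ext ξ
  obtain ⟨y, hy, z, hz, rfl⟩ := L.topologicalClosure.exists_add_mem_mem_orthogonal ξ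
  rw [Submodule.orthogonal_closure] at hz
  rw [map_add, map_add, h3 y hy, h2 z hz]

/-- If `‖Ψ v‖ ≤ C ‖Φ v‖`, then `Φ v ↦ Ψ v` defines a bounded operator. -/
theorem exists_clm_of_norm_le {V : Type*} [AddCommGroup V] [Module ℂ V] (Φ Ψ : V →ₗ[ℂ] H) {C : ℝ}
    (hC0 : 0 ≤ C) (hC : ∀ v, ‖Ψ v‖ ≤ C * ‖Φ v‖) :
    ∃ T : H →L[ℂ] H, ‖T‖ ≤ C ∧ (∀ v, T (Φ v) = Ψ v) ∧
      ∀ ξ ∈ (LinearMap.range Φ)ᗮ, T ξ = 0 := by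
  set L := (LinearMap.range Φ).topologicalClosure with hL
  have hmem : ∀ v, Φ v ∈ L := fun v => Submodule.le_topologicalClosure _ ⟨v, rfl⟩
  let e : V →ₗ[ℂ] L := Φ.codRestrict L hmem
  have he : DenseRange e := by
    rw [DenseRange, dense_iff_closure_eq, Set.eq_univ_iff_forall]
    rintro ⟨ξ, hξ⟩
    rw [closure_subtype]
    have h1 : (Subtype.val '' Set.range e : Set H) = (LinearMap.range Φ : Set H) := by
      ext; simp [e]
    rw [h1]
    exact hξ
  have hn : ∀ v, ‖Ψ v‖ ≤ C * ‖e v‖ := hC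
  refine ⟨(Ψ.extendOfNorm e) ∘L L.orthogonalProjectionOnto, ?_, ?_, ?_⟩
  · refine ContinuousLinearMap.opNorm_le_bound _ hC0 fun ξ => ?_
    refine (LinearMap.norm_extendOfNorm_apply_le he C hn _).trans ?_
    gcongr
    exact L.norm_orthogonalProjectionOnto_apply_le ξ
  · intro v
    have h1 : L.orthogonalProjectionOnto (Φ v) = e v :=
      Submodule.orthogonalProjectionOnto_mem_subspace_eq_self (K := L) (e v)
    rw [ContinuousLinearMap.comp_apply, h1]
    exact LinearMap.extendOfNorm_eq he ⟨C, hn⟩ v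
  · intro ξ hξ
    rw [← Submodule.orthogonal_closure] at hξ
    rw [ContinuousLinearMap.comp_apply,
      Submodule.orthogonalProjectionOnto_apply_of_mem_orthogonal hξ, map_zero]

/-- As `S` is stable under adjoints, its generated *-algebra is the algebra generated by `S`, and
`p` need not be stable under adjoints. -/
theorem cstarGenerated_induction {S : Set (H →L[ℂ] H)} (hS : ∀ s ∈ S, star s ∈ S)
    {p : (H →L[ℂ] H) → Prop} (hp : IsClosed {c | p c}) (mem : ∀ s ∈ S, p s) (zero : p 0)
    (add : ∀ a b, p a → p b → p (a + b)) (smul : ∀ (z : ℂ) a, p a → p (z • a))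
    (mul : ∀ a ∈ cstarGenerated S, ∀ b ∈ cstarGenerated S, p a → p b → p (a * b))
    {c : H →L[ℂ] H} (hc : c ∈ cstarGenerated S) : p c := by
  refine (hp.closure_subset_iff (s := (NonUnitalStarAlgebra.adjoin ℂ S : Set (H →L[ℂ] H)))).2
    (fun a ha => ?_) hc
  have hle : ∀ a ∈ NonUnitalStarAlgebra.adjoin ℂ S, a ∈ cstarGenerated S := fun a ha =>
    subset_closure ha
  have hadj : ∀ a, a ∈ NonUnitalStarAlgebra.adjoin ℂ S ↔ a ∈ NonUnitalAlgebra.adjoin ℂ S := by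
    intro a
    have h1 : S ∪ star S = S := Set.union_eq_self_of_subset_right fun s hs => by
      simpa using hS _ (Set.mem_star.1 hs)
    have h2 := NonUnitalStarAlgebra.adjoin_toNonUnitalSubalgebra ℂ S
    rw [h1] at h2
    rw [← h2]
    rfl
  refine NonUnitalAlgebra.adjoin_induction (R := ℂ) (s := S) (p := fun a _ => p a)
    (fun s hs => mem s hs) (fun a b _ _ => add a b) zero
    (fun a b ha hb => mul a (hle a ((hadj a).2 ha)) b (hle b ((hadj b).2 hb)))
    (fun z a _ => smul z a) ((hadj a).1 ha)

theorem subset_cstarGenerated (S : Set (H →L[ℂ] H)) {s : H →L[ℂ] H} (hs : s ∈ S) :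
    s ∈ cstarGenerated S :=
  subset_closure (NonUnitalStarAlgebra.subset_adjoin ℂ S hs)

variable {X : Type*} [NonUnitalCStarAlgebra X]

/-- The linear span of the ranges of the operators `φ x`. -/
def orbitSpan (φ : X → (H →L[ℂ] H)) : Submodule ℂ H :=
  Submodule.span ℂ {ξ : H | ∃ x η, ξ = φ x η}

theorem mem_orbitSpan (φ : X → (H →L[ℂ] H)) (x : X) (ξ : H) : φ x ξ ∈ orbitSpan φ :=
  Submodule.subset_span ⟨x, ξ, rfl⟩

theorem map_eq_zero_of_mem_orthogonal {φ : X → (H →L[ℂ] H)} (hstar : ∀ x, φ (star x) = star (φ x))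
    {ξ : H} (hξ : ξ ∈ (orbitSpan φ)ᗮ) (x : X) : φ x ξ = 0 := by
  refine ext_inner_left ℂ fun v => ?_
  have h : φ x = star (φ (star x)) := by rw [hstar, star_star]
  rw [inner_zero_right, h, ContinuousLinearMap.star_eq_adjoint,
    ContinuousLinearMap.adjoint_inner_right]
  exact (Submodule.mem_orthogonal _ _).1 hξ _ (mem_orbitSpan φ _ _)

theorem star_mem_range {φ : X → (H →L[ℂ] H)} (hstar : ∀ x, φ (star x) = star (φ x)) :
    ∀ s ∈ Set.range φ, star s ∈ Set.range φ := by
  rintro _ ⟨x, rfl⟩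
  exact ⟨star x, hstar x⟩

theorem essentialSubspace_eq {φ : X → (H →L[ℂ] H)} (hstar : ∀ x, φ (star x) = star (φ x)) :
    essentialSubspace (cstarGenerated (Set.range φ)) = (orbitSpan φ).topologicalClosure := by
  apply le_antisymm
  · refine Submodule.topologicalClosure_minimal _ (Submodule.span_le.2 ?_)
      (Submodule.isClosed_topologicalClosure _)
    rintro _ ⟨c, hc, η, rfl⟩
    revert η
    refine cstarGenerated_induction (star_mem_range hstar)
      (p := fun c => ∀ η, c η ∈ (orbitSpan φ).topologicalClosure) ?_ ?_ ?_ ?_ ?_ ?_ hc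
    · simp only [Set.ofPred_forall]
      refine isClosed_iInter fun η => ?_
      exact (Submodule.isClosed_topologicalClosure _).preimage
        (ContinuousLinearMap.apply ℂ H η).continuous
    · rintro _ ⟨x, rfl⟩ η
      exact Submodule.le_topologicalClosure _ (mem_orbitSpan φ x η)
    · intro η; exact zero_mem _
    · intro a b ha hb η; exact add_mem (ha η) (hb η)
    · intro z a ha η; exact Submodule.smul_mem _ z (ha η)
    · intro a _ b _ ha _ η; exact ha (b η)
  · refine Submodule.topologicalClosure_mono (Submodule.span_mono ?_)
    rintro _ ⟨x, η, rfl⟩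
    exact ⟨φ x, subset_cstarGenerated _ ⟨x, rfl⟩, η, rfl⟩

/-- Multiplying the generators φ(x) into the algebra is enough: in T(ab) = (Ta)b and (ab)T = a(bT)
the other factor already lies in it. -/
theorem mem_multipliers {φ : X → (H →L[ℂ] H)} (hstar : ∀ x, φ (star x) = star (φ x))
    {T : H →L[ℂ] H} (h1 : ∀ x, T * φ x ∈ cstarGenerated (Set.range φ))
    (h2 : ∀ x, φ x * T ∈ cstarGenerated (Set.range φ))
    (h3 : ∀ x ξ, T (φ x ξ) ∈ (orbitSpan φ).topologicalClosure)
    (h4 : ∀ ξ ∈ (orbitSpan φ)ᗮ, T ξ = 0) :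
    T ∈ multipliers (cstarGenerated (Set.range φ)) := by
  rw [multipliers, essentialSubspace_eq hstar, Submodule.orthogonal_closure]
  refine ⟨fun c hc => ?_, fun ξ => ?_, h4⟩
  · have hcl : IsClosed (cstarGenerated (Set.range φ) : Set (H →L[ℂ] H)) := inferInstance
    refine cstarGenerated_induction (star_mem_range hstar) (p := fun c =>
      T * c ∈ cstarGenerated (Set.range φ) ∧ c * T ∈ cstarGenerated (Set.range φ))
      ?_ ?_ ?_ ?_ ?_ ?_ hc
    · exact (hcl.preimage (continuous_const.mul continuous_id)).inter
        (hcl.preimage (continuous_id.mul continuous_const))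
    · rintro _ ⟨x, rfl⟩; exact ⟨h1 x, h2 x⟩
    · simp [zero_mem]
    · rintro a b ⟨ha, ha'⟩ ⟨hb, hb'⟩
      rw [mul_add, add_mul]
      exact ⟨add_mem ha hb, add_mem ha' hb'⟩
    · rintro z a ⟨ha, ha'⟩
      rw [mul_smul_comm, smul_mul_assoc]
      exact ⟨SMulMemClass.smul_mem z ha, SMulMemClass.smul_mem z ha'⟩
    · rintro a hae b hbe ⟨ha, ha'⟩ ⟨hb, hb'⟩
      rw [← mul_assoc, mul_assoc a]
      exact ⟨mul_mem ha hbe, mul_mem hae hb'⟩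
  · obtain ⟨y, hy, z, hz, rfl⟩ := (orbitSpan φ).topologicalClosure.exists_add_mem_mem_orthogonal ξ
    rw [Submodule.orthogonal_closure] at hz
    rw [map_add, h4 z hz, add_zero]
    have hcl : IsClosed {y | T y ∈ (orbitSpan φ).topologicalClosure} :=
      (Submodule.isClosed_topologicalClosure _).preimage T.continuous
    refine hcl.closure_subset_iff.2 (fun y hy => ?_) hy
    refine Submodule.span_induction (p := fun y _ => T y ∈ (orbitSpan φ).topologicalClosure)
      ?_ (by simp) (fun a b _ _ ha hb => by rw [map_add]; exact add_mem ha hb)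
      (fun z a _ ha => by rw [map_smul]; exact Submodule.smul_mem _ z ha) hy
    rintro _ ⟨x, η, rfl⟩
    exact h3 x η

end Hilbert

section Structure

variable {H : Type*} [NormedAddCommGroup H] [InnerProductSpace ℂ H] [CompleteSpace H]
variable {X : Type*} [NonUnitalCStarAlgebra X]

/-- The linear map `x ⊗ ξ ↦ φ x ξ`. -/
def evalMap (φ : X →ₗ[ℂ] (H →L[ℂ] H)) : X ⊗[ℂ] H →ₗ[ℂ] H :=
  TensorProduct.lift (ContinuousLinearMap.coeLM ℂ ∘ₗ φ)

@[simp]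
theorem evalMap_tmul (φ : X →ₗ[ℂ] (H →L[ℂ] H)) (x : X) (ξ : H) : evalMap φ (x ⊗ₜ ξ) = φ x ξ := rfl

theorem range_evalMap (φ : X →ₗ[ℂ] (H →L[ℂ] H)) :
    LinearMap.range (evalMap φ) = orbitSpan fun x => φ x := by
  apply le_antisymm
  · rintro _ ⟨v, rfl⟩
    induction v using TensorProduct.induction_on with
    | zero => simp
    | tmul x ξ => exact mem_orbitSpan (fun x => φ x) x ξ
    | add v w hv hw => rw [map_add]; exact add_mem hv hw
  · refine Submodule.span_le.2 ?_
    rintro _ ⟨x, η, rfl⟩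
    exact ⟨x ⊗ₜ η, rfl⟩

variable {φ : X →ₗ[ℂ] (H →L[ℂ] H)}

theorem clm_ext_of_orbit {S T : H →L[ℂ] H} (h1 : ∀ x ξ, S (φ x ξ) = T (φ x ξ))
    (h2 : ∀ ξ ∈ (orbitSpan fun x => φ x)ᗮ, S ξ = T ξ) : S = T := by
  refine clm_ext_of_submodule (fun ξ hξ => ?_) h2
  refine Submodule.span_induction (p := fun y _ => S y = T y) ?_ (by simp)
    (fun a b _ _ ha hb => by rw [map_add, map_add, ha, hb])
    (fun z a _ ha => by rw [map_smul, map_smul, ha]) hξ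
  rintro _ ⟨x, η, rfl⟩
  exact h1 x η

/-- The operator is the value at `y` of the supporting homomorphism, φ(x)ξ ↦ φ(yx)ξ. It is well
defined and bounded because, by the identity, left multiplication by y^* is formally adjoint to left
multiplication by y for the form ⟨φ(x)ξ, φ(x')ξ'⟩. So f(y) = ‖Σ φ(y x_i)ξ_i‖ satisfies f(y)² ≤ f(1)
f(y^*y) with f(1) = ‖Σ φ(x_i)ξ_i‖, and `le_of_sq_le` gives f(y) ≤ f(1)‖y‖. -/
theorem exists_leftMul (hφ : IsCP φ)
    (hoz : ∀ x y z, φ x * φ (y * z) = φ (x * y) * φ z) (y : X) :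
    ∃ T : H →L[ℂ] H, (∀ x ξ, T (φ x ξ) = φ (y * x) ξ) ∧
      ∀ ξ ∈ (orbitSpan fun x => φ x)ᗮ, T ξ = 0 := by
  obtain ⟨C, hC0, hC⟩ := hφ.exists_bound
  let Λ : X → X ⊗[ℂ] H →ₗ[ℂ] X ⊗[ℂ] H := fun y => (LinearMap.mulLeft ℂ y).rTensor H
  have hadj : ∀ y u v, ⟪evalMap φ (Λ y u), evalMap φ v⟫_ℂ =
      ⟪evalMap φ u, evalMap φ (Λ (star y) v)⟫_ℂ := by
    intro y u v
    induction u using TensorProduct.induction_on with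
    | zero => simp
    | add u u' hu hu' => simp only [map_add, inner_add_left, hu, hu']
    | tmul x ξ =>
      induction v using TensorProduct.induction_on with
      | zero => simp
      | add v v' hv hv' => simp only [map_add, inner_add_right, hv, hv']
      | tmul x' ξ' =>
        simp only [Λ, LinearMap.rTensor_tmul, LinearMap.mulLeft_apply, evalMap_tmul]
        have h1 : ∀ a b : X, ⟪φ a ξ, φ b ξ'⟫_ℂ = ⟪ξ, (φ (star a) * φ b) ξ'⟫_ℂ := fun a b => by
          rw [hφ.map_star, ContinuousLinearMap.star_eq_adjoint, mul_apply_eq_comp,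
            ContinuousLinearMap.adjoint_inner_right]
        rw [h1, h1, hoz, star_mul]
  have hmul : ∀ y z v, Λ (y * z) v = Λ y (Λ z v) := by
    intro y z v
    induction v using TensorProduct.induction_on with
    | zero => simp
    | add v v' hv hv' => simp only [map_add, hv, hv']
    | tmul x ξ => simp [Λ]
  have hbd : ∀ v, ∃ K : ℝ, ∀ y, ‖evalMap φ (Λ y v)‖ ≤ K * ‖y‖ := by
    intro v
    induction v using TensorProduct.induction_on with
    | zero => exact ⟨0, by simp⟩
    | add v v' hv hv' =>
      obtain ⟨K, hK⟩ := hv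
      obtain ⟨K', hK'⟩ := hv'
      refine ⟨K + K', fun y => ?_⟩
      rw [map_add, map_add, add_mul]
      exact (norm_add_le _ _).trans (add_le_add (hK y) (hK' y))
    | tmul x ξ =>
      refine ⟨C * ‖x‖ * ‖ξ‖, fun y => ?_⟩
      simp only [Λ, LinearMap.rTensor_tmul, LinearMap.mulLeft_apply, evalMap_tmul]
      calc _ ≤ ‖φ (y * x)‖ * ‖ξ‖ := ContinuousLinearMap.le_opNorm _ _
        _ ≤ C * (‖y‖ * ‖x‖) * ‖ξ‖ := by
          gcongr
          exact (hC _).trans (by gcongr; exact norm_mul_le _ _)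
        _ = _ := by ring
  have hle : ∀ v, ‖evalMap φ (Λ y v)‖ ≤ ‖y‖ * ‖evalMap φ v‖ := by
    intro v
    obtain ⟨K, hK⟩ := hbd v
    rw [mul_comm]
    refine le_of_sq_le (f := fun y => ‖evalMap φ (Λ y v)‖) (fun _ => norm_nonneg _)
      (norm_nonneg _) (fun x => ?_) hK y
    have h1 : ‖evalMap φ (Λ x v)‖ ^ 2 = ‖⟪evalMap φ v, evalMap φ (Λ (star x * x) v)⟫_ℂ‖ := by
      rw [hmul, ← hadj, inner_self_eq_norm_sq_to_K]
      simp
    rw [h1]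
    exact norm_inner_le_norm _ _
  obtain ⟨T, -, hT, hT0⟩ := exists_clm_of_norm_le (evalMap φ) (evalMap φ ∘ₗ Λ y) (norm_nonneg y) hle
  refine ⟨T, fun x ξ => ?_, by rwa [range_evalMap] at hT0⟩
  simpa [Λ] using hT (x ⊗ₜ ξ)

/-- The element h would be φ(1). On vectors φ(xy)ξ it is the strong limit of φ(u) along an
approximate unit, since φ(u)φ(xy) = φ(ux)φ(y) tends to φ(x)φ(y). Positivity and the norm bound pass
to the limit from φ(u). -/
theorem exists_centralElement (hφ : IsCP φ)
    (hoz : ∀ x y z, φ x * φ (y * z) = φ (x * y) * φ z) :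
    ∃ h : H →L[ℂ] H, 0 ≤ h ∧ (∀ x y, h * φ (x * y) = φ x * φ y) ∧
      (∀ ξ ∈ (orbitSpan fun x => φ x)ᗮ, h ξ = 0) ∧
      ∀ M : ℝ, (∀ x, ‖x‖ ≤ 1 → ‖φ x‖ ≤ M) → ‖h‖ ≤ M := by
  obtain ⟨l, _, hl, -, hl1, hpos⟩ := exists_approximateUnit X
  let Φ : X ⊗[ℂ] (X ⊗[ℂ] H) →ₗ[ℂ] H :=
    evalMap φ ∘ₗ (LinearMap.mul' ℂ X).rTensor H ∘ₗ (TensorProduct.assoc ℂ X X H).symm.toLinearMap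
  let Ψ : X ⊗[ℂ] (X ⊗[ℂ] H) →ₗ[ℂ] H := evalMap φ ∘ₗ (evalMap φ).lTensor X
  have hΦ : ∀ x y ξ, Φ (x ⊗ₜ (y ⊗ₜ ξ)) = φ (x * y) ξ := fun x y ξ => by simp [Φ]
  have hΨ : ∀ x y ξ, Ψ (x ⊗ₜ (y ⊗ₜ ξ)) = φ x (φ y ξ) := fun x y ξ => by simp [Ψ]
  have hlim : ∀ v, Tendsto (fun u => φ u (Φ v)) l (𝓝 (Ψ v)) := by
    intro v
    induction v using TensorProduct.induction_on with
    | zero => simp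
    | add v v' hv hv' => simpa only [map_add] using hv.add hv'
    | tmul x w =>
      induction w using TensorProduct.induction_on with
      | zero => simp
      | add w w' hw hw' => simpa only [TensorProduct.tmul_add, map_add] using hw.add hw'
      | tmul y ξ =>
        rw [hΨ]
        simp only [hΦ]
        have h1 : ∀ u, φ u (φ (x * y) ξ) = φ (u * x) (φ y ξ) := fun u =>
          congrArg (fun T : H →L[ℂ] H => T ξ) (hoz u x y)
        simp only [h1]
        exact ((ContinuousLinearMap.apply ℂ H (φ y ξ)).continuous.tendsto _).comp
          ((hφ.continuous.tendsto x).comp (hl x))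
  have hbd : ∀ M : ℝ, (∀ x, ‖x‖ ≤ 1 → ‖φ x‖ ≤ M) → ∀ v, ‖Ψ v‖ ≤ M * ‖Φ v‖ := fun M hM v =>
    le_of_tendsto (hlim v).norm (hl1.mono fun u hu =>
      (ContinuousLinearMap.le_opNorm _ _).trans (by gcongr; exact hM u hu))
  have hrange : LinearMap.range Φ = orbitSpan fun x => φ x := by
    apply le_antisymm
    · rw [← range_evalMap]
      exact LinearMap.range_comp_le_range _ _
    · refine Submodule.span_le.2 ?_
      rintro _ ⟨x, η, rfl⟩
      obtain ⟨y, rfl⟩ := exists_sum_star_mul_self x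
      simp only [map_sum, map_smul, sum_apply, smul_apply]
      exact sum_mem fun i _ => Submodule.smul_mem _ _ ⟨star (y i) ⊗ₜ (y i ⊗ₜ η), hΦ _ _ _⟩
  obtain ⟨C, hC0, hC⟩ := hφ.exists_bound
  have hC' : ∀ x, ‖x‖ ≤ 1 → ‖φ x‖ ≤ C := fun x hx =>
    (hC x).trans (mul_le_of_le_one_right hC0 hx)
  obtain ⟨h, -, h1, h2⟩ := exists_clm_of_norm_le Φ Ψ hC0 (hbd C hC')
  rw [hrange] at h2
  have hprod : ∀ x y, h * φ (x * y) = φ x * φ y := by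
    intro x y
    ext ξ
    have := h1 (x ⊗ₜ (y ⊗ₜ ξ))
    rwa [hΦ, hΨ] at this
  refine ⟨h, ?_, hprod, h2, fun M hM => ?_⟩
  · rw [ContinuousLinearMap.nonneg_iff_isPositive, ContinuousLinearMap.isPositive_iff_complex]
    have hmain : ∀ ξ, (0 : ℂ) ≤ ⟪h ξ, ξ⟫_ℂ := by
      have hcl : ∀ ξ ∈ (orbitSpan fun x => φ x).topologicalClosure, (0 : ℂ) ≤ ⟪h ξ, ξ⟫_ℂ ∧
          h ξ ∈ (orbitSpan fun x => φ x).topologicalClosure := by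
        intro ξ hξ
        have hc1 : IsClosed {ξ | (0 : ℂ) ≤ ⟪h ξ, ξ⟫_ℂ} :=
          isClosed_le continuous_const (h.continuous.inner continuous_id)
        have hc : IsClosed {ξ | (0 : ℂ) ≤ ⟪h ξ, ξ⟫_ℂ ∧
            h ξ ∈ (orbitSpan fun x => φ x).topologicalClosure} :=
          hc1.inter ((Submodule.isClosed_topologicalClosure _).preimage h.continuous)
        refine hc.closure_subset_iff.2 (fun ξ hξ => ?_) hξ
        rw [← hrange] at hξ
        obtain ⟨v, rfl⟩ := hξ
        constructor
        · rw [h1]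
          refine ge_of_tendsto ((hlim v).inner tendsto_const_nhds) (hpos.mono ?_)
          rintro u ⟨w, rfl⟩
          obtain ⟨y, hy⟩ := hφ.exists_eq_star_mul_self w
          rw [hy, mul_apply_eq_comp, ContinuousLinearMap.star_eq_adjoint,
            ContinuousLinearMap.adjoint_inner_left, inner_self_eq_norm_sq_to_K]
          positivity
        · rw [h1]
          refine Submodule.le_topologicalClosure _ ?_
          rw [← range_evalMap]
          exact ⟨_, rfl⟩
      intro ξ
      obtain ⟨y, hy, z, hz, rfl⟩ :=
        (orbitSpan fun x => φ x).topologicalClosure.exists_add_mem_mem_orthogonal ξ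
      have hz' := hz
      rw [Submodule.orthogonal_closure] at hz'
      rw [map_add, h2 z hz', add_zero, inner_add_right,
        (Submodule.mem_orthogonal _ _).1 hz _ (hcl y hy).2, add_zero]
      exact (hcl y hy).1
    intro ξ
    have := hmain ξ
    rw [Complex.le_def] at this
    refine ⟨?_, by simpa using this.1⟩
    apply Complex.ext
    · simp
    · simpa using this.2
  · have hM0 : 0 ≤ M := (norm_nonneg _).trans (hM 0 (by simp))
    -- The construction is repeated with the sharper bound M. The result agrees with `h` on the
    -- range of Φ and on its orthogonal complement.
    obtain ⟨h', h1', h2', h3'⟩ := exists_clm_of_norm_le Φ Ψ hM0 (hbd M hM)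
    rw [hrange] at h3'
    have : h = h' := by
      refine clm_ext_of_submodule (L := LinearMap.range Φ) ?_ ?_
      · rintro _ ⟨v, rfl⟩
        rw [h1, h2']
      · rw [hrange]
        intro ξ hξ
        rw [h2 ξ hξ, h3' ξ hξ]
    rwa [this]

theorem exists_supportingHom (hφ : IsCP φ)
    (hoz : ∀ x y z, φ x * φ (y * z) = φ (x * y) * φ z) :
    ∃ π : X →⋆ₙₐ[ℂ] (H →L[ℂ] H), IsSupportingHom (fun x => φ x) π := by
  choose p hp hp0 using exists_leftMul hφ hoz
  obtain ⟨h, hpos, hh, hh0, hnorm⟩ := exists_centralElement hφ hoz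
  have hstar : ∀ x, φ (star x) = star (φ x) := hφ.map_star
  have hφ0 : ∀ ξ ∈ (orbitSpan fun x => φ x)ᗮ, ∀ x, φ x ξ = 0 := fun ξ hξ =>
    map_eq_zero_of_mem_orthogonal hstar hξ
  have hpm : ∀ y x, p y * φ x = φ (y * x) := fun y x => by ext ξ; exact hp y x ξ
  -- On vectors φ(z)ξ this is the adjoint of the relation φ(x)p(y) = φ(xy). On the orthogonal
  -- complement of these vectors both sides vanish, since p(y) takes values in their closed span.
  have hadj : ∀ y, star (p y) = p (star y) := by
    intro y
    have hx : ∀ x, φ x * p y = φ (x * y) := by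
      intro x
      refine clm_ext_of_orbit (φ := φ) (fun z ξ => ?_) (fun ξ hξ => ?_)
      · rw [mul_apply_eq_comp, hp]
        exact congrArg (fun T : H →L[ℂ] H => T ξ) (hoz x y z)
      · rw [mul_apply_eq_comp, hp0 y ξ hξ, map_zero, hφ0 ξ hξ]
    refine clm_ext_of_orbit (φ := φ) (fun z ξ => ?_) (fun ξ hξ => ?_)
    · rw [hp]
      have h1 : star (p y) * φ z = φ (star y * z) := by
        have h2 := congrArg star (hx (star z))
        rw [star_mul, ← hstar, ← hstar, star_mul, star_star] at h2
        exact h2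
      exact congrArg (fun T : H →L[ℂ] H => T ξ) h1
    · rw [hp0 _ ξ hξ]
      refine ext_inner_left ℂ fun v => ?_
      rw [inner_zero_right, ContinuousLinearMap.star_eq_adjoint,
        ContinuousLinearMap.adjoint_inner_right]
      obtain ⟨a, ha, b, hb, rfl⟩ :=
        (orbitSpan fun x => φ x).topologicalClosure.exists_add_mem_mem_orthogonal v
      rw [Submodule.orthogonal_closure] at hb
      rw [map_add, hp0 _ b hb, add_zero]
      have hcl : IsClosed {a | ⟪p y a, ξ⟫_ℂ = 0} :=
        isClosed_eq ((p y).continuous.inner continuous_const) continuous_const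
      refine hcl.closure_subset_iff.2 (fun a ha => ?_) ha
      refine Submodule.span_induction (p := fun a _ => ⟪p y a, ξ⟫_ℂ = 0)
        ?_ (by simp) (fun a b _ _ ha hb => by rw [map_add, inner_add_left, ha, hb, add_zero])
        (fun z a _ ha => by rw [map_smul, inner_smul_left, ha, mul_zero]) ha
      rintro _ ⟨x, η, rfl⟩
      rw [hp]
      exact (Submodule.mem_orthogonal _ _).1 hξ _ (mem_orbitSpan _ _ _)
  have hmp : ∀ x y, φ x * p y = φ (x * y) := fun x y => by
    have h2 := congrArg star (hpm (star y) (star x))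
    rw [star_mul, ← hstar, ← hstar, ← star_mul, star_star, star_star, hadj, star_star] at h2
    exact h2
  have hhsa : star h = h := (IsSelfAdjoint.of_nonneg hpos).star_eq
  have hh' : ∀ x y, φ (x * y) * h = φ x * φ y := fun x y => by
    have h2 := congrArg star (hh (star y) (star x))
    rw [star_mul, star_mul, ← hstar, ← hstar, ← hstar, star_mul, star_star, star_star, hhsa] at h2
    exact h2
  -- Both hφ(xy) and φ(xy)h equal φ(x)φ(y), and the products xy span X.
  have hhφ : ∀ x, h * φ x = φ x * h := by
    intro x
    obtain ⟨y, rfl⟩ := exists_sum_star_mul_self x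
    simp only [map_sum, map_smul, Finset.mul_sum, Finset.sum_mul, mul_smul_comm, smul_mul_assoc,
      hh, hh']
  have hhmem : ∀ x, h * φ x ∈ cstarGenerated (Set.range fun x => φ x) := by
    intro x
    obtain ⟨y, rfl⟩ := exists_sum_star_mul_self x
    simp only [map_sum, map_smul, Finset.mul_sum, mul_smul_comm, hh]
    exact sum_mem fun i _ => SMulMemClass.smul_mem _
      (mul_mem (subset_cstarGenerated _ ⟨_, rfl⟩) (subset_cstarGenerated _ ⟨_, rfl⟩))
  let π : X →⋆ₙₐ[ℂ] (H →L[ℂ] H) :=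
    { toFun := p
      map_smul' := fun z y => clm_ext_of_orbit (φ := φ)
        (fun x ξ => by simp [hp, smul_mul_assoc]) (fun ξ hξ => by simp [hp0 _ ξ hξ])
      map_zero' := clm_ext_of_orbit (φ := φ) (fun x ξ => by simp [hp])
        (fun ξ hξ => by simp [hp0 _ ξ hξ])
      map_add' := fun y z => clm_ext_of_orbit (φ := φ)
        (fun x ξ => by simp [hp, add_mul]) (fun ξ hξ => by simp [hp0 _ ξ hξ])
      map_mul' := fun y z => clm_ext_of_orbit (φ := φ)
        (fun x ξ => by simp [hp, mul_assoc]) (fun ξ hξ => by simp [hp0 _ ξ hξ])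
      map_star' := fun y => (hadj y).symm }
  have hπ : ∀ y, π y = p y := fun y => rfl
  have hhp : ∀ x, φ x = h * p x := fun x => by
    refine clm_ext_of_orbit (φ := φ) (fun z ξ => ?_) (fun ξ hξ => ?_)
    · rw [mul_apply_eq_comp, hp]
      exact congrArg (fun T : H →L[ℂ] H => T ξ) (hh x z).symm
    · rw [mul_apply_eq_comp, hp0 x ξ hξ, map_zero, hφ0 ξ hξ]
  refine ⟨π, h, hpos, ?_, ?_, ?_, ?_, hhp⟩
  · refine mem_multipliers hstar hhmem (fun x => hhφ x ▸ hhmem x) (fun x ξ => ?_) hh0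
    have := congrArg (fun T : H →L[ℂ] H => T ξ) (hhφ x)
    simp only [mul_apply_eq_comp] at this
    rw [this]
    exact Submodule.le_topologicalClosure _ (mem_orbitSpan _ _ _)
  · intro c hc
    refine cstarGenerated_induction (star_mem_range hstar) (p := fun c => h * c = c * h)
      (isClosed_eq (continuous_const.mul continuous_id) (continuous_id.mul continuous_const))
      ?_ (by simp) (fun a b ha hb => by rw [mul_add, add_mul, ha, hb])
      (fun z a ha => by rw [mul_smul_comm, smul_mul_assoc, ha])
      (fun a _ b _ ha hb => by rw [← mul_assoc, ha, mul_assoc, hb, mul_assoc]) hc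
    rintro _ ⟨x, rfl⟩
    exact hhφ x
  · refine ⟨?_, fun M hM => hnorm M fun x hx => hM ⟨x, by simpa using hx, rfl⟩⟩
    rintro _ ⟨x, hx, rfl⟩
    have h1 : ‖p x‖ ≤ 1 := (NonUnitalStarAlgHom.norm_apply_le π x).trans (by simpa using hx)
    calc ‖φ x‖ ≤ ‖h‖ * ‖p x‖ := by rw [hhp]; exact norm_mul_le _ _
      _ ≤ ‖h‖ * 1 := by gcongr
      _ = ‖h‖ := mul_one _
  · intro y
    rw [hπ]
    refine ⟨mem_multipliers hstar (fun x => ?_) (fun x => ?_) (fun x ξ => ?_) (hp0 y), ?_⟩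
    · exact hpm y x ▸ subset_cstarGenerated _ ⟨_, rfl⟩
    · exact hmp x y ▸ subset_cstarGenerated _ ⟨_, rfl⟩
    · rw [hp]
      exact Submodule.le_topologicalClosure _ (mem_orbitSpan _ _ _)
    · refine clm_ext_of_orbit (φ := φ) (fun x ξ => ?_) (fun ξ hξ => ?_)
      · simp only [mul_apply_eq_comp]
        have h1 : p y * h * φ x = h * p y * φ x := by
          rw [mul_assoc, mul_assoc, hpm, hhφ, ← mul_assoc, hpm, hhφ]
        exact congrArg (fun T : H →L[ℂ] H => T ξ) h1
      · simp [hp0 y ξ hξ, hh0 ξ hξ]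

end Structure
end GenDiag
end

noncomputable section

namespace GenDiag

open scoped InnerProductSpace

/-! ### Strong limits of supporting homomorphisms -/

section StrongLimit

variable {H : Type*} [NormedAddCommGroup H] [InnerProductSpace ℂ H] [CompleteSpace H]

theorem tendsto_apply_of_topologicalClosure {E : Type*} [SeminormedAddCommGroup E] [NormedSpace ℂ E]
    {α : Type*} {l : Filter α} {f : α → (E →L[ℂ] E)} (hf : ∀ᶠ a in l, ‖f a‖ ≤ 1) {T : E →L[ℂ] E}
    {L : Submodule ℂ E} (h : ∀ ξ ∈ L, Tendsto (fun a => f a ξ) l (𝓝 (T ξ))) {ξ : E}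
    (hξ : ξ ∈ L.topologicalClosure) : Tendsto (fun a => f a ξ) l (𝓝 (T ξ)) := by
  rw [Metric.tendsto_nhds]
  intro ε hε
  have hT : 0 < ‖T‖ + 2 := by positivity
  obtain ⟨η, hη, hd⟩ := Metric.mem_closure_iff.1 hξ (ε / (‖T‖ + 2)) (by positivity)
  have h1 := Metric.tendsto_nhds.1 (h η hη) (ε / (‖T‖ + 2)) (by positivity)
  filter_upwards [h1, hf] with a ha hfa
  rw [dist_eq_norm] at ha hd ⊢
  have h2 : f a ξ - T ξ = f a (ξ - η) + (f a η - T η) - T (ξ - η) := by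
    rw [map_sub, map_sub]; abel
  have h3 : ‖f a (ξ - η)‖ ≤ ‖ξ - η‖ := by
    simpa using (f a).le_of_opNorm_le hfa (ξ - η)
  have h4 : ‖T (ξ - η)‖ ≤ ‖T‖ * (ε / (‖T‖ + 2)) := (T.le_opNorm _).trans (by gcongr)
  calc ‖f a ξ - T ξ‖ ≤ ‖f a (ξ - η)‖ + ‖f a η - T η‖ + ‖T (ξ - η)‖ := by
        rw [h2]
        exact (norm_sub_le _ _).trans (add_le_add_left (norm_add_le _ _) _)
    _ < ε / (‖T‖ + 2) + ε / (‖T‖ + 2) + ‖T‖ * (ε / (‖T‖ + 2)) :=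
        add_lt_add_of_lt_of_le (add_lt_add (h3.trans_lt hd) ha) h4
    _ = ε := by field_simp; ring

variable {X : Type*} [NonUnitalCStarAlgebra X]

/-- From φ = hπ with h commuting with π one gets π(q)φ(x) = φ(qx), so on the essential subspace the
limit is dictated by φ alone; off it every π vanishes. Hence the limit does not depend on the choice
of π. The orthogonality hypothesis on `row` identifies it as a projection. -/
theorem IsSupportingHom.tendsto {φ : X →ₗ[ℂ] (H →L[ℂ] H)}
    (hstar : ∀ x, φ (star x) = star (φ x)) {π : X →⋆ₙₐ[ℂ] (H →L[ℂ] H)}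
    (hπ : IsSupportingHom (fun x => φ x) π) {α : Type*} {l : Filter α} {q : α → X}
    (hq : ∀ᶠ a in l, ‖q a‖ ≤ 1) {row : X → X} (hrow : ∀ x, Tendsto (fun a => q a * x) l (𝓝 (row x)))
    (horth : ∀ x y, star (x - row x) * row y = 0) (ξ : H) :
    Tendsto (fun a => π (q a) ξ) l
      (𝓝 ((Submodule.span ℂ {ζ | ∃ x η, ζ = φ (row x) η}).topologicalClosure.starProjection ξ)) := by
  obtain ⟨h, -, -, -, -, hm, hφ⟩ := hπ
  set W := (Submodule.span ℂ {ζ | ∃ x η, ζ = φ (row x) η}).topologicalClosure with hW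
  have hess := essentialSubspace_eq hstar
  have hφ' : ∀ x, φ x = h * π x := hφ
  have hcont : Continuous φ := by
    refine (φ.mkContinuous ‖h‖ fun x => ?_).continuous
    rw [hφ']
    exact (norm_mul_le _ _).trans (by gcongr; exact isContractive_starHom π x)
  have hmul : ∀ x y, φ x * φ y = h * (h * π (x * y)) := fun x y => by
    rw [hφ', hφ', map_mul, mul_assoc, ← mul_assoc (π x), (hm x).2, mul_assoc]
  have hW1 : ∀ x η, φ (row x) η ∈ W := fun x η =>
    Submodule.le_topologicalClosure _ (Submodule.subset_span ⟨x, η, rfl⟩)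
  have hWV : W ≤ (orbitSpan fun x => φ x).topologicalClosure := by
    refine Submodule.topologicalClosure_mono (Submodule.span_le.2 ?_)
    rintro _ ⟨x, η, rfl⟩
    exact mem_orbitSpan (fun x => φ x) _ _
  have hf : ∀ᶠ a in l, ‖π (q a)‖ ≤ 1 := hq.mono fun a ha => (isContractive_starHom π _).trans ha
  have h1 : ∀ ζ ∈ orbitSpan (fun x => φ x),
      Tendsto (fun a => π (q a) ζ) l (𝓝 (W.starProjection ζ)) := by
    intro ζ hζ
    induction hζ using Submodule.span_induction with
    | mem ζ hζ =>
      obtain ⟨x, η, rfl⟩ := hζ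
      -- The vector φ(row x)η lies in W, and the remainder φ(x − row x)η is orthogonal to W, because
      -- φ(x − row x)^* φ(row y) = h²π((x − row x)^* row y) = 0.
      have h2 : W.starProjection (φ x η) = φ (row x) η := by
        refine Submodule.eq_starProjection_of_mem_of_inner_eq_zero (hW1 x η) fun w hw => ?_
        have hc : IsClosed {w | ⟪φ x η - φ (row x) η, w⟫_ℂ = 0} :=
          isClosed_eq (by fun_prop) continuous_const
        refine hc.closure_subset_iff.2 ?_ hw
        intro w hw
        induction hw using Submodule.span_induction with
        | mem w hw =>
          obtain ⟨y, ζ, rfl⟩ := hw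
          have h3 : star (φ (x - row x)) * φ (row y) = 0 := by
            rw [← hstar, hmul, horth, map_zero, mul_zero, mul_zero]
          change ⟪φ x η - φ (row x) η, φ (row y) ζ⟫_ℂ = 0
          rw [← _root_.sub_apply, ← map_sub, ← ContinuousLinearMap.adjoint_inner_right,
            ← ContinuousLinearMap.star_eq_adjoint, ← mul_apply_eq_comp, h3]
          simp
        | zero => exact inner_zero_right _
        | add u v _ _ hu hv =>
          change ⟪_, u + v⟫_ℂ = 0
          rw [inner_add_right, show ⟪_, u⟫_ℂ = 0 from hu, show ⟪_, v⟫_ℂ = 0 from hv, add_zero]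
        | smul z u _ hu =>
          change ⟪_, z • u⟫_ℂ = 0
          rw [inner_smul_right, show ⟪_, u⟫_ℂ = 0 from hu, mul_zero]
      have h3 : ∀ a, π (q a) (φ x η) = φ (q a * x) η := fun a => by
        rw [← mul_apply_eq_comp, hφ', hφ', ← mul_assoc, (hm _).2, mul_assoc, map_mul]
      change Tendsto (fun a => π (q a) (φ x η)) l (𝓝 (W.starProjection (φ x η)))
      simp only [h2, h3]
      have hcη : Continuous fun y => φ y η := by fun_prop
      exact (hcη.tendsto _).comp (hrow x)
    | zero => simpa using tendsto_const_nhds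
    | add u v _ _ hu hv => simpa using hu.add hv
    | smul z u _ hu => simpa using hu.const_smul z
  obtain ⟨y, hy, z, hz, rfl⟩ :=
    (orbitSpan fun x => φ x).topologicalClosure.exists_add_mem_mem_orthogonal ξ
  have h2 := tendsto_apply_of_topologicalClosure hf h1 hy
  have h3 : W.starProjection z = 0 :=
    (Submodule.starProjection_apply_eq_zero_iff W).2 (Submodule.orthogonal_le hWV hz)
  have h4 : ∀ x, π x z = 0 := fun x => (hm x).1.2.2 z (by rw [hess]; exact hz)
  change Tendsto (fun a => π (q a) (y + z)) l (𝓝 (W.starProjection (y + z)))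
  simpa only [map_add, h3, h4, add_zero] using h2

end StrongLimit

/-! ### Finite direct sums of matrix algebras with arbitrary index sets -/

section BlockSum

variable {J : Type} {R : J → Type} {B : Type*}

/-- The direct sum of the matrix algebras over `B` with index sets `R j`. -/
abbrev BlockSum (R : J → Type) (B : Type*) : Type _ := ∀ j : J, CStarMatrix (R j) (R j) B

/-- The elementary tensor of a matrix unit and `b`. -/
def blockUnit [DecidableEq J] [∀ j, DecidableEq (R j)] [Zero B] (j : J) (k l : R j) (b : B) :
    BlockSum R B :=
  Pi.single j (CStarMatrix.ofMatrix (Matrix.single k l b))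

/-- All blocks are diagonal matrices. -/
def IsDiag [Zero B] (x : BlockSum R B) : Prop := ∀ j k l, k ≠ l → x j k l = 0

/-- The blocks outside `P` vanish. -/
def SuppIn [Zero B] (P : Set J) (x : BlockSum R B) : Prop := ∀ j ∉ P, x j = 0

/-- All elements of `P` have the same colour. -/
def Mono {ι : Type} (c : J → ι) (P : Set J) : Prop := ∀ j ∈ P, ∀ j' ∈ P, c j = c j'

section Units

variable [DecidableEq J] [∀ j, DecidableEq (R j)] [Zero B]

theorem blockUnit_self (j : J) (k l : R j) (b : B) (k' l' : R j) :
    blockUnit j k l b j k' l' = if k = k' ∧ l = l' then b else 0 := by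
  rw [blockUnit, Pi.single_eq_same]
  exact Matrix.single_apply k l b k' l'

theorem blockUnit_of_ne {j j' : J} (h : j' ≠ j) (k l : R j) (b : B) :
    (blockUnit j k l b : BlockSum R B) j' = 0 := by
  rw [blockUnit, Pi.single_eq_of_ne h]

theorem isDiag_blockUnit (j : J) (k : R j) (b : B) : IsDiag (blockUnit j k k b : BlockSum R B) := by
  intro j' k' l' h
  rcases eq_or_ne j' j with rfl | hj
  · rw [blockUnit_self, if_neg]
    rintro ⟨rfl, rfl⟩
    exact h rfl
  · rw [blockUnit_of_ne hj]; rfl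

theorem suppIn_blockUnit (j : J) (k l : R j) (b : B) :
    SuppIn {j} (blockUnit j k l b : BlockSum R B) :=
  fun _ h => blockUnit_of_ne h k l b

end Units

variable [Fintype J] [∀ j, Fintype (R j)] [NonUnitalCStarAlgebra B]
variable {H : Type*} [NormedAddCommGroup H] [InnerProductSpace ℂ H] [CompleteSpace H]

section RowSpace

variable [DecidableEq J] [∀ j, DecidableEq (R j)]

/-- The span of the ranges of the images of the elementary tensors in row `k` of block `j`. -/
def rowSpace (φ : BlockSum R B → (H →L[ℂ] H)) (j : J) (k : R j) : Submodule ℂ H :=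
  Submodule.span ℂ {ζ | ∃ l b ξ, ζ = φ (blockUnit j k l b) ξ}

/-- Row `k` of block `j`. -/
def rowPart (j : J) (k : R j) (x : BlockSum R B) : BlockSum R B :=
  Pi.single j (mkMat fun k' l => if k = k' then x j k l else 0)

theorem rowPart_self (j : J) (k : R j) (x : BlockSum R B) (k' l : R j) :
    rowPart j k x j k' l = if k = k' then x j k l else 0 := by
  rw [rowPart, Pi.single_eq_same, mkMat_apply]

theorem rowPart_of_ne {j j' : J} (h : j' ≠ j) (k : R j) (x : BlockSum R B) :
    rowPart j k x j' = 0 := by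
  rw [rowPart, Pi.single_eq_of_ne h]

theorem rowPart_eq_sum (j : J) (k : R j) (x : BlockSum R B) :
    rowPart j k x = ∑ l, blockUnit j k l (x j k l) := by
  ext j' k' l'
  rw [Finset.sum_apply, sum_matrix_apply]
  rcases eq_or_ne j' j with rfl | hj
  · rw [rowPart_self]
    simp only [blockUnit_self]
    by_cases h : k = k' <;> simp [h]
  · simp [rowPart_of_ne hj, blockUnit_of_ne hj]

theorem rowPart_blockUnit (j : J) (k l : R j) (b : B) :
    rowPart j k (blockUnit j k l b : BlockSum R B) = blockUnit j k l b := by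
  ext j' k' l'
  rcases eq_or_ne j' j with rfl | hj
  · rw [rowPart_self, blockUnit_self, blockUnit_self]
    by_cases h : k = k' <;> simp [h]
  · simp [rowPart_of_ne hj, blockUnit_of_ne hj]

theorem blockUnit_mul (j : J) (k : R j) (u : B) (x : BlockSum R B) :
    blockUnit j k k u * x = rowPart j k (fun j => mkMat fun k l => u * x j k l) := by
  ext j' k' l'
  rw [Pi.mul_apply]
  rcases eq_or_ne j' j with rfl | hj
  · rw [rowPart_self, CStarMatrix.mul_apply]
    simp only [blockUnit_self, mkMat_apply]
    by_cases h : k = k'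
    · simp [h]
    · simp [h]
  · rw [rowPart_of_ne hj, blockUnit_of_ne hj, zero_mul]

theorem rowSpace_eq (φ : BlockSum R B →ₗ[ℂ] (H →L[ℂ] H)) (j : J) (k : R j) :
    rowSpace (fun x => φ x) j k = Submodule.span ℂ {ζ | ∃ x η, ζ = φ (rowPart j k x) η} := by
  refine le_antisymm (Submodule.span_le.2 ?_) (Submodule.span_le.2 ?_)
  · rintro _ ⟨l, b, ξ, rfl⟩
    exact Submodule.subset_span ⟨blockUnit j k l b, ξ, by rw [rowPart_blockUnit]⟩
  · rintro _ ⟨x, η, rfl⟩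
    rw [rowPart_eq_sum, map_sum, _root_.sum_apply]
    exact Submodule.sum_mem _ fun l _ => Submodule.subset_span ⟨l, _, _, rfl⟩

variable [PartialOrder B] [StarOrderedRing B]

/-- The corner embedding `b ↦ e_{kk} ⊗ b`. -/
def cornerHom (j : J) (k : R j) : B →⋆ₙₐ[ℂ] BlockSum R B where
  toFun := blockUnit j k k
  map_smul' z b := by
    ext j' k' l'
    rcases eq_or_ne j' j with rfl | hj
    · simp [blockUnit_self]
    · simp [blockUnit_of_ne hj]
  map_zero' := by
    ext j' k' l'
    rcases eq_or_ne j' j with rfl | hj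
    · simp [blockUnit_self]
    · simp [blockUnit_of_ne hj]
  map_add' a b := by
    ext j' k' l'
    rcases eq_or_ne j' j with rfl | hj
    · simp only [CStarMatrix.add_apply, Pi.add_apply, blockUnit_self]
      split_ifs <;> simp
    · simp [blockUnit_of_ne hj]
  map_mul' a b := by
    rw [blockUnit_mul]
    ext j' k' l'
    rcases eq_or_ne j' j with rfl | hj
    · rw [rowPart_self, mkMat_apply, blockUnit_self, blockUnit_self]
      by_cases h : k = k' <;> by_cases h' : k = l' <;> simp [h, h']
    · simp [rowPart_of_ne hj, blockUnit_of_ne hj]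
  map_star' b := by
    ext j' k' l'
    rw [Pi.star_apply, CStarMatrix.star_apply]
    rcases eq_or_ne j' j with rfl | hj
    · rw [blockUnit_self, blockUnit_self, apply_ite star, star_zero]
      exact if_congr and_comm rfl rfl
    · simp [blockUnit_of_ne hj]

theorem norm_blockUnit_le (j : J) (k : R j) (b : B) :
    ‖(blockUnit j k k b : BlockSum R B)‖ ≤ ‖b‖ :=
  isContractive_starHom (cornerHom j k : B →⋆ₙₐ[ℂ] BlockSum R B) b

/-- Left multiplication by e_kk ⊗ u tends pointwise to the cut-down to row k. This turns the
commutant condition into a statement about row spaces in which neither π nor the approximate unit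
occurs. -/
theorem IsSupportingHom.tendsto_blockUnit {φ : BlockSum R B →ₗ[ℂ] (H →L[ℂ] H)}
    (hstar : ∀ x, φ (star x) = star (φ x)) {π : BlockSum R B →⋆ₙₐ[ℂ] (H →L[ℂ] H)}
    (hπ : IsSupportingHom (fun x => φ x) π) {l : Filter B}
    (hl : l.IsIncreasingApproximateUnit) (j : J) (k : R j) (ξ : H) :
    Tendsto (fun u => π (blockUnit j k k u) ξ) l
      (𝓝 ((rowSpace (fun x => φ x) j k).topologicalClosure.starProjection ξ)) := by
  simp only [rowSpace_eq]
  refine hπ.tendsto hstar (hl.eventually_norm.mono fun u hu => (norm_blockUnit_le j k u).trans hu)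
    (row := rowPart j k) (fun x => ?_) (fun x y => ?_) ξ
  · simp only [blockUnit_mul]
    refine tendsto_pi_nhds.2 fun j' => ?_
    rcases eq_or_ne j' j with rfl | hj
    · refine tendsto_pi_nhds.2 fun k' => tendsto_pi_nhds.2 fun l' => ?_
      simp only [rowPart_self, mkMat_apply]
      by_cases h : k = k'
      · simp only [h, if_true]
        exact hl.tendsto_mul_right _
      · simp only [h, if_false]
        exact tendsto_const_nhds
    · simp only [rowPart_of_ne hj]
      exact tendsto_const_nhds
  · ext j' k' l'
    rw [Pi.mul_apply]
    rcases eq_or_ne j' j with rfl | hj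
    · rw [CStarMatrix.mul_apply]
      refine Finset.sum_eq_zero fun i _ => ?_
      rw [Pi.star_apply, CStarMatrix.star_apply, Pi.sub_apply, CStarMatrix.sub_apply, rowPart_self,
        rowPart_self]
      by_cases h : k = i <;> simp [h]
    · rw [rowPart_of_ne hj, mul_zero]; rfl

end RowSpace

end BlockSum

end GenDiag
end

noncomputable section

namespace GenDiag

/-! ### Approximations indexed by arbitrary finite sets -/

section Approx

variable {H : Type*} [NormedAddCommGroup H] [InnerProductSpace ℂ H] [CompleteSpace H]
variable (B : Type*) [NonUnitalCStarAlgebra B] [PartialOrder B] [StarOrderedRing B]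
variable (D A : NonUnitalStarSubalgebra ℂ (H →L[ℂ] H)) [IsClosed (A : Set (H →L[ℂ] H))]

/-- An approximation through a direct sum of matrix algebras with arbitrary finite index sets, whose
summands carry colours. The order zero condition is replaced by an algebraic identity, and
the condition on supporting homomorphisms by an invariance condition. -/
structure Approx {J : Type} [Fintype J] [DecidableEq J] {R : J → Type} [∀ j, Fintype (R j)]
    [∀ j, DecidableEq (R j)] {ι : Type} (c : J → ι) (S : Set A) (ε : ℝ)
    (ψ : A →ₗ[ℂ] BlockSum R B) (φ : BlockSum R B →ₗ[ℂ] A) : Prop where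
  cp_psi : IsCP ψ
  cp_phi : IsCP φ
  contractive_psi : IsContractive ψ
  approx : ∀ a ∈ S, ‖φ (ψ a) - a‖ < ε
  map_mul_map_mul : ∀ P, Mono c P → ∀ x y z, SuppIn P x → SuppIn P y → SuppIn P z →
    φ x * φ (y * z) = φ (x * y) * φ z
  contractive_phi : ∀ P, Mono c P → ∀ x, SuppIn P x → ‖φ x‖ ≤ ‖x‖
  map_diagonal : ∀ a : A, (a : H →L[ℂ] H) ∈ D → IsDiag (ψ a)
  diagonal_normaliser : ∀ P, Mono c P → ∀ x, SuppIn P x → IsDiag x →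
    (φ x : H →L[ℂ] H) ∈ normalisers D A
  unit_normaliser : ∀ j k l, ∀ b : B, (φ (blockUnit j k l b) : H →L[ℂ] H) ∈ normalisers D A
  invariant : ∀ j k, ∀ a ∈ D, ∀ l b ξ, a ((φ (blockUnit j k l b) : H →L[ℂ] H) ξ) ∈
    (rowSpace (fun x => (φ x : H →L[ℂ] H)) j k).topologicalClosure

/-- The inclusion of a `*`-subalgebra. -/
def inclusionHom (A : NonUnitalStarSubalgebra ℂ (H →L[ℂ] H)) : A →⋆ₙₐ[ℂ] (H →L[ℂ] H) :=
  NonUnitalStarSubalgebraClass.subtype A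

variable {B D A}

/-- Refining the colouring only shrinks the class of monochromatic sets of blocks. In particular
colours may be renamed along an injection. -/
theorem Approx.recolour {J : Type} [Fintype J] [DecidableEq J] {R : J → Type} [∀ j, Fintype (R j)]
    [∀ j, DecidableEq (R j)] {ι ι' : Type} {c : J → ι} {c' : J → ι'} {S : Set A} {ε : ℝ}
    {ψ : A →ₗ[ℂ] BlockSum R B} {φ : BlockSum R B →ₗ[ℂ] A} (h : Approx B D A c S ε ψ φ)
    (hc : ∀ j j', c' j = c' j' → c j = c j') : Approx B D A c' S ε ψ φ :=
  have hP : ∀ P, Mono c' P → Mono c P := fun _ h j hj j' hj' => hc j j' (h j hj j' hj')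
  { h with
    map_mul_map_mul := fun P h' => h.map_mul_map_mul P (hP P h')
    contractive_phi := fun P h' => h.contractive_phi P (hP P h')
    diagonal_normaliser := fun P h' => h.diagonal_normaliser P (hP P h') }

section Reindex

variable {J : Type} [Fintype J] [DecidableEq J] {R : J → Type} [∀ j, Fintype (R j)]
  [∀ j, DecidableEq (R j)] {d : ℕ} {m : Fin (d + 1) → ℕ} {r : ∀ i, Fin (m i) → ℕ}
  (g : (Σ i, Fin (m i)) ≃ J) (f : ∀ p : Σ i, Fin (m i), Fin (r p.1 p.2) ≃ R (g p))

variable (B) in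
/-- Relabelling of the index sets of a direct sum of matrix algebras. -/
def reindexHom : BlockSum R B →⋆ₙₐ[ℂ] ∀ i, MatSum (r i) B where
  toFun x := fun i t => mkMat fun k l => x (g ⟨i, t⟩) (f ⟨i, t⟩ k) (f ⟨i, t⟩ l)
  map_smul' _ _ := rfl
  map_zero' := rfl
  map_add' _ _ := rfl
  map_mul' x y := by
    ext i t k l
    simp only [Pi.mul_apply, mkMat_apply, CStarMatrix.mul_apply]
    exact (Equiv.sum_comp (f ⟨i, t⟩) fun k' => x (g ⟨i, t⟩) (f ⟨i, t⟩ k) k' *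
      y (g ⟨i, t⟩) k' (f ⟨i, t⟩ l)).symm
  map_star' _ := rfl

theorem reindexHom_apply (x : BlockSum R B) (i : Fin (d + 1)) (t : Fin (m i)) (k l) :
    reindexHom B g f x i t k l = x (g ⟨i, t⟩) (f ⟨i, t⟩ k) (f ⟨i, t⟩ l) := rfl

theorem bijective_reindexHom : Function.Bijective (reindexHom B g f) := by
  constructor
  · intro x y h
    ext j k l
    obtain ⟨⟨i, t⟩, rfl⟩ := g.surjective j
    obtain ⟨k, rfl⟩ := (f ⟨i, t⟩).surjective k
    obtain ⟨l, rfl⟩ := (f ⟨i, t⟩).surjective l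
    rw [← reindexHom_apply g f x, h, reindexHom_apply]
  · intro y
    obtain ⟨x, hx⟩ := (Equiv.piCongrLeft' (fun j => CStarMatrix (R j) (R j) B) g.symm).surjective
      (fun p => mkMat fun k l => y p.1 p.2 ((f p).symm k) ((f p).symm l))
    refine ⟨x, ?_⟩
    ext i t k l
    have h := congrFun hx ⟨i, t⟩
    have h2 : x (g ⟨i, t⟩) (f ⟨i, t⟩ k) (f ⟨i, t⟩ l) =
        (mkMat fun k l => y i t ((f ⟨i, t⟩).symm k) ((f ⟨i, t⟩).symm l))
          (f ⟨i, t⟩ k) (f ⟨i, t⟩ l) := congrFun (congrFun h _) _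
    rw [reindexHom_apply, h2, mkMat_apply, Equiv.symm_apply_apply, Equiv.symm_apply_apply]

variable (B) in
/-- Relabelling as an isomorphism. -/
def reindexEquiv : BlockSum R B ≃⋆ₐ[ℂ] ∀ i, MatSum (r i) B :=
  StarAlgEquiv.ofBijective (reindexHom B g f) (bijective_reindexHom g f)

theorem reindexEquiv_apply (x : BlockSum R B) (i : Fin (d + 1)) (t : Fin (m i)) (k l) :
    reindexEquiv B g f x i t k l = x (g ⟨i, t⟩) (f ⟨i, t⟩ k) (f ⟨i, t⟩ l) := rfl

theorem reindexEquiv_blockUnit (i : Fin (d + 1)) (t : Fin (m i)) (k l) (b : B) :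
    reindexEquiv B g f (blockUnit (g ⟨i, t⟩) (f ⟨i, t⟩ k) (f ⟨i, t⟩ l) b) =
      Pi.single i (unitTensor t k l b) := by
  ext i' t' k' l'
  rw [reindexEquiv_apply]
  rcases eq_or_ne i' i with rfl | hi
  · rw [Pi.single_eq_same]
    change _ = blockUnit (R := fun t => Fin (r i' t)) t k l b t' k' l'
    rcases eq_or_ne t' t with rfl | ht
    · simp [blockUnit_self]
    · rw [blockUnit_of_ne ht, blockUnit_of_ne]
      · rfl
      · intro h
        exact ht (by simpa using g.injective h)
  · rw [Pi.single_eq_of_ne hi, blockUnit_of_ne]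
    · rfl
    · intro h
      exact hi (congrArg Sigma.fst (g.injective h))

variable (B) in
/-- The inverse of the relabelling. -/
def reindexSymm : (∀ i, MatSum (r i) B) →⋆ₙₐ[ℂ] BlockSum R B :=
  ((reindexEquiv B g f).symm : (∀ i, MatSum (r i) B) →⋆ₙₐ[ℂ] BlockSum R B)

variable (B) in
/-- Relabelling as a linear map. -/
abbrev reindexMap : BlockSum R B →ₗ[ℂ] ∀ i, MatSum (r i) B :=
  (reindexHom B g f : BlockSum R B →ₗ[ℂ] ∀ i, MatSum (r i) B)

variable (B) in
/-- The inverse of the relabelling as a linear map. -/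
abbrev reindexSymmMap : (∀ i, MatSum (r i) B) →ₗ[ℂ] BlockSum R B :=
  (reindexSymm B g f : (∀ i, MatSum (r i) B) →ₗ[ℂ] BlockSum R B)

theorem reindexHom_reindexSymm (y : ∀ i, MatSum (r i) B) :
    reindexHom B g f (reindexSymm B g f y) = y :=
  (reindexEquiv B g f).apply_symm_apply y

theorem reindexSymm_reindexHom (x : BlockSum R B) :
    reindexSymm B g f (reindexHom B g f x) = x :=
  (reindexEquiv B g f).symm_apply_apply x

theorem reindexSymm_apply (y : ∀ i, MatSum (r i) B) (p : Σ i, Fin (m i)) (k l) :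
    reindexSymm B g f y (g p) (f p k) (f p l) = y p.1 p.2 k l := by
  have h := congrFun (congrFun (congrFun (congrFun (reindexHom_reindexSymm g f y) p.1) p.2) k) l
  exact h

theorem reindexSymm_unitTensor (i : Fin (d + 1)) (t : Fin (m i)) (k l) (b : B) :
    reindexSymm B g f (Pi.single i (unitTensor t k l b)) =
      blockUnit (g ⟨i, t⟩) (f ⟨i, t⟩ k) (f ⟨i, t⟩ l) b := by
  rw [← reindexEquiv_blockUnit g f]
  exact reindexSymm_reindexHom g f _

theorem isDiag_reindexSymm {i : Fin (d + 1)} {y : MatSum (r i) B} (hy : IsDiagonal y) :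
    IsDiag (reindexSymm B g f (Pi.single i y)) := by
  intro j k l h
  obtain ⟨p, rfl⟩ := g.surjective j
  obtain ⟨k, rfl⟩ := (f p).surjective k
  obtain ⟨l, rfl⟩ := (f p).surjective l
  rw [reindexSymm_apply]
  obtain ⟨i', t⟩ := p
  rcases eq_or_ne i' i with rfl | hi
  · rw [Pi.single_eq_same]
    exact hy _ _ _ fun h' => h (congrArg _ h')
  · rw [Pi.single_eq_of_ne hi]; rfl

theorem isDiagonal_reindexHom {x : BlockSum R B} (hx : IsDiag x) (i : Fin (d + 1)) :
    IsDiagonal (reindexHom B g f x i) :=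
  fun t _ _ h => hx _ _ _ fun h' => h ((f ⟨i, t⟩).injective h')

variable {c : J → Fin (d + 1)}

theorem suppIn_reindexSymm (hc : ∀ p, c (g p) = p.1) (i : Fin (d + 1)) (y : MatSum (r i) B) :
    SuppIn {j | c j = i} (reindexSymm B g f (Pi.single i y)) := by
  intro j hj
  obtain ⟨p, rfl⟩ := g.surjective j
  have hi : p.1 ≠ i := by rw [← hc]; exact hj
  ext k l
  obtain ⟨k, rfl⟩ := (f p).surjective k
  obtain ⟨l, rfl⟩ := (f p).surjective l
  rw [reindexSymm_apply, Pi.single_eq_of_ne hi]; rfl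

/-- A monochromatic set of blocks lies in a single summand F⁽ⁱ⁾, so conditions on monochromatic
supports are conditions on the components of the map. -/
theorem exists_eq_reindexSymm (hc : ∀ p, c (g p) = p.1) {P : Set J} (hP : Mono c P) :
    ∃ i, ∀ x : BlockSum R B, SuppIn P x →
      x = reindexSymm B g f (Pi.single i (reindexHom B g f x i)) := by
  have h0 : ∃ i, ∀ j ∈ P, c j = i := by
    rcases P.eq_empty_or_nonempty with rfl | ⟨j, hj⟩
    -- An empty set of blocks has no colour of its own; any colour will do, and there is always the
    -- colour 0.
    · exact ⟨0, by simp⟩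
    · exact ⟨c j, fun j' hj' => hP _ hj' _ hj⟩
  obtain ⟨i, hi⟩ := h0
  refine ⟨i, fun x hx => (bijective_reindexHom g f).1 ?_⟩
  rw [reindexHom_reindexSymm]
  ext i' t k l
  rcases eq_or_ne i' i with rfl | h
  · rw [Pi.single_eq_same]
  · rw [Pi.single_eq_of_ne h, reindexHom_apply, hx]
    · rfl
    · intro h'
      exact h (by rw [← hi _ h', hc])

theorem rowSpace_component (φ : BlockSum R B →ₗ[ℂ] A) (i : Fin (d + 1)) (t : Fin (m i)) (k) :
    rowSpace (R := fun t => Fin (r i t)) (fun x => (component B A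
      (φ ∘ₗ reindexSymmMap B g f) i x : H →L[ℂ] H)) t k =
    rowSpace (fun x => (φ x : H →L[ℂ] H)) (g ⟨i, t⟩) (f ⟨i, t⟩ k) := by
  have h : ∀ l b, component B A (φ ∘ₗ reindexSymmMap B g f) i
      (blockUnit (R := fun t => Fin (r i t)) t k l b) =
      φ (blockUnit (g ⟨i, t⟩) (f ⟨i, t⟩ k) (f ⟨i, t⟩ l) b) := fun l b => by
    rw [← reindexSymm_unitTensor g f]; rfl
  unfold rowSpace
  simp only [h]
  congr 1
  ext ζ
  exact (f ⟨i, t⟩).exists_congr_left.trans (by simp)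

end Reindex

/-- A subspace invariant under an operator and its adjoint is reducing. -/
theorem mul_starProjection_comm {W : Submodule ℂ H} [W.HasOrthogonalProjection] {a : H →L[ℂ] H}
    (h : ∀ w ∈ W, a w ∈ W) (h' : ∀ w ∈ W, star a w ∈ W) :
    W.starProjection * a = a * W.starProjection := by
  ext ξ
  rw [mul_apply_eq_comp, mul_apply_eq_comp]
  refine Submodule.eq_starProjection_of_mem_orthogonal'
    (z := a (ξ - W.starProjection ξ)) (h _ (W.starProjection_apply_mem ξ)) ?_ ?_
  · rw [Submodule.mem_orthogonal]
    intro w hw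
    rw [← ContinuousLinearMap.adjoint_inner_left, ← ContinuousLinearMap.star_eq_adjoint]
    exact (Submodule.mem_orthogonal _ _).1 (W.sub_starProjection_mem_orthogonal ξ) _ (h' w hw)
  · rw [← map_add, add_sub_cancel]

theorem map_mem_topologicalClosure {K : Type*} [NormedAddCommGroup K] [InnerProductSpace ℂ K]
    {S : Set H} {S' : Set K} {a : H →L[ℂ] K}
    (h : ∀ s ∈ S, a s ∈ (Submodule.span ℂ S').topologicalClosure) {w : H}
    (hw : w ∈ (Submodule.span ℂ S).topologicalClosure) :
    a w ∈ (Submodule.span ℂ S').topologicalClosure := by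
  have h1 : Submodule.span ℂ S ≤ (Submodule.span ℂ S').topologicalClosure.comap
      (a : H →ₗ[ℂ] K) := Submodule.span_le.2 h
  have h2 : IsClosed (a ⁻¹' ((Submodule.span ℂ S').topologicalClosure : Set K)) :=
    (Submodule.isClosed_topologicalClosure _).preimage a.continuous
  exact h2.closure_subset_iff.2 h1 hw

section Equivalence

variable {J : Type} [Fintype J] [DecidableEq J] {R : J → Type} [∀ j, Fintype (R j)]
  [∀ j, DecidableEq (R j)] {d : ℕ} {m : Fin (d + 1) → ℕ} {r : ∀ i, Fin (m i) → ℕ}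
  (g : (Σ i, Fin (m i)) ≃ J) (f : ∀ p : Σ i, Fin (m i), Fin (r p.1 p.2) ≃ R (g p))
  {c : J → Fin (d + 1)} {S : Set A} {ε : ℝ}

/-- The algebraic identity implies order zero, and invariance of the row spaces under the
selfadjoint algebra `D` implies that `D` commutes with the row projections, which are the strong
limits in the commutant condition. -/
theorem Approx.isApproximation (hc : ∀ p, c (g p) = p.1) {ψ : A →ₗ[ℂ] BlockSum R B}
    {φ : BlockSum R B →ₗ[ℂ] A} (h : Approx B D A c S ε ψ φ) :
    IsApproximation B D A S ε (reindexMap B g f ∘ₗ ψ)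
      (φ ∘ₗ reindexSymmMap B g f) := by
  have hcp := h.cp_phi.comp (isCP_starHom (reindexSymm B g f))
  have hmono : ∀ i, Mono c {j | c j = i} := fun i j hj j' hj' => hj.trans hj'.symm
  let σ : ∀ i, MatSum (r i) B →⋆ₙₐ[ℂ] ∀ i, MatSum (r i) B := fun i =>
    { toFun := fun x => Pi.single i x
      map_smul' := (LinearMap.single ℂ (fun i => MatSum (r i) B) i).map_smul
      map_zero' := Pi.single_zero i
      map_add' := (LinearMap.single ℂ (fun i => MatSum (r i) B) i).map_add
      map_mul' := fun x y => Pi.single_mul (α := fun i => MatSum (r i) B) i x y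
      map_star' := fun x => Pi.single_star (f := fun i => MatSum (r i) B) i x }
  have hσ : ∀ i x, σ i x = Pi.single i x := fun _ _ => rfl
  have hcpi : ∀ i, IsCP (component B A (φ ∘ₗ reindexSymmMap B g f) i) :=
    fun i => hcp.comp (isCP_starHom (σ i))
  have happ : ∀ i x, component B A (φ ∘ₗ reindexSymmMap B g f) i x =
    φ (reindexSymm B g f (Pi.single i x)) := fun _ _ => rfl
  refine ⟨(isCP_starHom (reindexHom B g f)).comp h.cp_psi, hcp, fun a =>
    (isContractive_starHom (reindexHom B g f) _).trans (h.contractive_psi a), fun a ha => ?_,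
    fun i => ⟨hcpi i, fun x x' _ hx' hxx' => ?_⟩, fun i x => ?_, fun a ha i => ?_, fun i x hx => ?_,
    fun i j k l b => ?_, fun i π hπ l hl j k => ?_⟩
  · have h1 := h.approx a ha
    rw [← reindexSymm_reindexHom g f (ψ a)] at h1
    exact h1
  · obtain ⟨s, rfl⟩ := isPos_iff.1 hx'
    -- With x' = s^*s and xx' = 0 also xs^* = 0, so φ(x)φ(s^*s) = φ(xs^*)φ(s) = 0.
    have h1 : x * star s = 0 := by
      rw [← CStarRing.mul_star_self_eq_zero_iff, star_mul, star_star, mul_assoc,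
        ← mul_assoc (star s), ← mul_assoc, hxx', zero_mul]
    rw [happ, happ, Pi.single_mul, map_mul,
      h.map_mul_map_mul _ (hmono i) _ _ _ (suppIn_reindexSymm g f hc i x)
      (suppIn_reindexSymm g f hc i _) (suppIn_reindexSymm g f hc i _), ← map_mul (reindexSymm B g f), ← Pi.single_mul,
      h1, Pi.single_zero, map_zero, map_zero, zero_mul]
  · rw [happ]
    refine (h.contractive_phi _ (hmono i) _ (suppIn_reindexSymm g f hc i x)).trans ?_
    exact (isContractive_starHom (reindexSymm B g f) _).trans (isContractive_starHom (σ i) x)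
  · exact isDiagonal_reindexHom g f (h.map_diagonal a ha) i
  · rw [happ]
    exact h.diagonal_normaliser _ (hmono i) _ (suppIn_reindexSymm g f hc i x)
      (isDiag_reindexSymm g f hx)
  · rw [happ, reindexSymm_unitTensor]
    exact h.unit_normaliser _ _ _ b
  · have hcpi' := (isCP_starHom (inclusionHom A)).comp (hcpi i)
    refine ⟨_, IsSupportingHom.tendsto_blockUnit (R := fun t => Fin (r i t)) (φ := _)
      hcpi'.map_star hπ hl j k, fun a ha => ?_⟩
    have h1 := rowSpace_component g f φ i j k
    have h2 : ∀ a ∈ D, ∀ w ∈ (rowSpace (R := fun t => Fin (r i t)) (fun x => (component B A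
        (φ ∘ₗ reindexSymmMap B g f) i x : H →L[ℂ] H)) j
          k).topologicalClosure, a w ∈ (rowSpace (R := fun t => Fin (r i t))
        (fun x => (component B A (φ ∘ₗ reindexSymmMap B g f) i x :
          H →L[ℂ] H)) j k).topologicalClosure := by
      intro a ha w hw
      rw [h1] at hw ⊢
      refine map_mem_topologicalClosure ?_ hw
      rintro _ ⟨l, b, ξ, rfl⟩
      exact h.invariant _ _ a ha l b ξ
    exact mul_starProjection_comm (h2 a ha) (h2 _ (star_mem ha))

/-- The converse translation. The order zero condition yields the algebraic identity, and the
commutant condition, applied to one supporting homomorphism, yields invariance of the row spaces. -/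
theorem IsApproximation.approx' (hc : ∀ p, c (g p) = p.1) {ψ : A →ₗ[ℂ] ∀ i, MatSum (r i) B}
    {φ : (∀ i, MatSum (r i) B) →ₗ[ℂ] A} (h : IsApproximation B D A S ε ψ φ) :
    Approx B D A c S ε (reindexSymmMap B g f ∘ₗ ψ)
      (φ ∘ₗ reindexMap B g f) := by
  set φ' := φ ∘ₗ reindexMap B g f with hφ'
  have hφ : φ = φ' ∘ₗ reindexSymmMap B g f := by
    refine LinearMap.ext fun y => ?_
    exact congrArg φ (reindexHom_reindexSymm (B := B) g f y).symm
  have happ : ∀ i x, φ' (reindexSymm B g f (Pi.single i x)) = component B A φ i x := fun i x => by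
    rw [hφ]; rfl
  have hunit : ∀ i t k l b, φ' (blockUnit (g ⟨i, t⟩) (f ⟨i, t⟩ k) (f ⟨i, t⟩ l) b) =
      component B A φ i (unitTensor t k l b) := fun i t k l b => by
    rw [← happ, reindexSymm_unitTensor]
  refine ⟨(isCP_starHom (reindexSymm B g f)).comp h.cp_psi,
    h.cp_phi.comp (isCP_starHom (reindexHom B g f)), fun a =>
    (isContractive_starHom (reindexSymm B g f) _).trans (h.contractive_psi a), fun a ha => ?_,
    fun P hP x y z hx hy hz => ?_, fun P hP x hx => ?_, fun a ha => ?_, fun P hP x hx hx' => ?_,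
    fun j k l b => ?_, fun j k a ha l b ξ => ?_⟩
  · have h1 := h.approx a ha
    rw [hφ] at h1
    exact h1
  · obtain ⟨i, hi⟩ := exists_eq_reindexSymm (B := B) g f hc hP
    rw [hi x hx, hi y hy, hi z hz, ← map_mul (reindexSymm B g f), ← Pi.single_mul, ← map_mul (reindexSymm B g f), ← Pi.single_mul, happ,
      happ, happ, happ]
    exact (h.orderZero i).map_mul_map_mul _ _ _
  · obtain ⟨i, hi⟩ := exists_eq_reindexSymm (B := B) g f hc hP
    rw [hi x hx, happ, ← hi x hx]
    refine (h.contractive_phi i _).trans ((norm_le_pi_norm _ i).trans ?_)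
    exact isContractive_starHom (reindexHom B g f) x
  · intro j k l hkl
    obtain ⟨p, rfl⟩ := g.surjective j
    obtain ⟨k, rfl⟩ := (f p).surjective k
    obtain ⟨l, rfl⟩ := (f p).surjective l
    rw [LinearMap.comp_apply]
    refine (reindexSymm_apply g f (ψ a) p k l).trans ?_
    exact h.map_diagonal a ha _ _ _ _ fun h' => hkl (congrArg _ h')
  · obtain ⟨i, hi⟩ := exists_eq_reindexSymm (B := B) g f hc hP
    rw [hi x hx, happ]
    exact h.diagonal_normaliser i _ (isDiagonal_reindexHom g f hx' i)
  · obtain ⟨⟨i, t⟩, rfl⟩ := g.surjective j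
    obtain ⟨k, rfl⟩ := (f ⟨i, t⟩).surjective k
    obtain ⟨l, rfl⟩ := (f ⟨i, t⟩).surjective l
    rw [hunit]
    exact h.unit_normaliser i t k l b
  · obtain ⟨⟨i, t⟩, rfl⟩ := g.surjective j
    obtain ⟨k, rfl⟩ := (f ⟨i, t⟩).surjective k
    obtain ⟨l, rfl⟩ := (f ⟨i, t⟩).surjective l
    rw [← rowSpace_component g f φ' i t k, ← hφ, hunit]
    have hcp := (isCP_starHom (inclusionHom A)).comp (h.orderZero i).1
    -- The commutant condition would be empty without a supporting homomorphism. For this π the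
    -- limit T is the projection onto the closed row space W; as T commutes with a, the vector
    -- a(φ(e_kl ⊗ b)ξ) equals its own image under T and so lies in W.
    obtain ⟨π, hπ⟩ := exists_supportingHom hcp fun x y z => by
      have := (h.orderZero i).map_mul_map_mul x y z
      exact congrArg Subtype.val this
    have hl := CStarAlgebra.increasingApproximateUnit B
    obtain ⟨T, hT, hcomm⟩ := h.commutant i π hπ _ hl t k
    have h1 := IsSupportingHom.tendsto_blockUnit (R := fun t => Fin (r i t)) hcp.map_star hπ hl t k
    have h2 : ∀ η, T η = (rowSpace (R := fun t => Fin (r i t)) (fun x => (component B A φ i x :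
        H →L[ℂ] H)) t k).topologicalClosure.starProjection η := fun η =>
      tendsto_nhds_unique (hT η) (h1 η)
    set W := (rowSpace (R := fun t => Fin (r i t)) (fun x => (component B A φ i x :
        H →L[ℂ] H)) t k).topologicalClosure with hW
    have h3 : (component B A φ i (unitTensor t k l b) : H →L[ℂ] H) ξ ∈ W :=
      Submodule.le_topologicalClosure _ (Submodule.subset_span ⟨l, b, ξ, rfl⟩)
    rw [← Submodule.starProjection_eq_self_iff] at h3
    rw [← h3, ← h2, ← mul_apply_eq_comp, ← hcomm a ha, mul_apply_eq_comp, h2]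
    exact Submodule.starProjection_apply_mem _ _

end Equivalence

/-- Arbitrary index sets make disjoint unions and products of block families available directly.
Numbering them is needed only here. -/
theorem dimLE_iff {d : ℕ} : DimLE B D A d ↔ ∀ S : Set A, S.Finite → ∀ ε : ℝ, 0 < ε →
    ∃ (J : Type) (_ : Fintype J) (_ : DecidableEq J) (R : J → Type) (_ : ∀ j, Fintype (R j))
      (_ : ∀ j, DecidableEq (R j)) (c : J → Fin (d + 1)) (ψ : A →ₗ[ℂ] BlockSum R B)
      (φ : BlockSum R B →ₗ[ℂ] A), Approx B D A c S ε ψ φ := by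
  constructor
  · intro h S hS ε hε
    obtain ⟨m, r, ψ, φ, h⟩ := h S hS ε hε
    exact ⟨Σ i, Fin (m i), inferInstance, inferInstance, fun p => Fin (r p.1 p.2), inferInstance,
      inferInstance, Sigma.fst, _, _, h.approx' (Equiv.refl _) (fun p => Equiv.refl _) fun _ => rfl⟩
  · intro h S hS ε hε
    obtain ⟨J, _, _, R, _, _, c, ψ, φ, h⟩ := h S hS ε hε
    -- The blocks of colour i become the summands of F⁽ⁱ⁾ by numbering the fibre of `c` over i; a
    -- colour that does not occur gives a zero summand.
    let g : (Σ i, Fin (Fintype.card {j // c j = i})) ≃ J :=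
      (Equiv.sigmaCongrRight fun i => (Fintype.equivFin {j // c j = i}).symm).trans
        (Equiv.sigmaFiberEquiv c)
    have hg : ∀ p, c (g p) = p.1 := fun p =>
      ((Fintype.equivFin {j // c j = p.1}).symm p.2).2
    exact ⟨_, fun i t => Fintype.card (R (g ⟨i, t⟩)), _, _, h.isApproximation g
      (fun p => (Fintype.equivFin (R (g p))).symm) hg⟩

end Approx

end GenDiag
end

noncomputable section

namespace GenDiag

/-! ### Direct sums -/

section BlockSumElim

variable {J J' : Type} {R : J → Type} {R' : J' → Type}

instance fintypeSumElim [∀ j, Fintype (R j)] [∀ j, Fintype (R' j)] :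
    ∀ j, Fintype (Sum.elim R R' j)
  | .inl j => inferInstanceAs (Fintype (R j))
  | .inr j => inferInstanceAs (Fintype (R' j))

instance decidableEqSumElim [∀ j, DecidableEq (R j)] [∀ j, DecidableEq (R' j)] :
    ∀ j, DecidableEq (Sum.elim R R' j)
  | .inl j => inferInstanceAs (DecidableEq (R j))
  | .inr j => inferInstanceAs (DecidableEq (R' j))

variable [Fintype J] [Fintype J'] [∀ j, Fintype (R j)] [∀ j, Fintype (R' j)]
variable {B : Type*} [NonUnitalCStarAlgebra B] [PartialOrder B] [StarOrderedRing B]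

variable (R R' B) in
/-- The restriction to the first family of blocks. -/
def blockFst : BlockSum (Sum.elim R R') B →⋆ₙₐ[ℂ] BlockSum R B where
  toFun x := fun j => mkMat fun k l => x (.inl j) k l
  map_smul' _ _ := rfl
  map_zero' := rfl
  map_add' _ _ := rfl
  map_mul' x y := by
    ext j k l
    simp only [Pi.mul_apply, mkMat_apply, CStarMatrix.mul_apply]
    rfl
  map_star' _ := rfl

variable (R R' B) in
/-- The restriction to the second family of blocks. -/
def blockSnd : BlockSum (Sum.elim R R') B →⋆ₙₐ[ℂ] BlockSum R' B where
  toFun x := fun j => mkMat fun k l => x (.inr j) k l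
  map_smul' _ _ := rfl
  map_zero' := rfl
  map_add' _ _ := rfl
  map_mul' x y := by
    ext j k l
    simp only [Pi.mul_apply, mkMat_apply, CStarMatrix.mul_apply]
    rfl
  map_star' _ := rfl

variable (R R' B) in
/-- The inclusion of the first family of blocks. -/
def blockInl : BlockSum R B →⋆ₙₐ[ℂ] BlockSum (Sum.elim R R') B where
  toFun x := fun
    | .inl j => mkMat fun k l => x j k l
    | .inr _ => 0
  map_smul' z x := by
    ext j k l
    rcases j with j | j
    · rfl
    · exact (smul_zero z).symm
  map_zero' := by
    ext j k l
    rcases j with j | j <;> rfl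
  map_add' x y := by
    ext j k l
    rcases j with j | j
    · rfl
    · exact (add_zero (0 : B)).symm
  map_mul' x y := by
    ext j k l
    rcases j with j | j
    · simp only [Pi.mul_apply, mkMat_apply, CStarMatrix.mul_apply]
      rfl
    · rw [Pi.mul_apply, mul_zero]
  map_star' x := by
    ext j k l
    rcases j with j | j
    · rfl
    · exact (star_zero B).symm

variable (R R' B) in
/-- The inclusion of the second family of blocks. -/
def blockInr : BlockSum R' B →⋆ₙₐ[ℂ] BlockSum (Sum.elim R R') B where
  toFun x := fun
    | .inl _ => 0
    | .inr j => mkMat fun k l => x j k l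
  map_smul' z x := by
    ext j k l
    rcases j with j | j
    · exact (smul_zero z).symm
    · rfl
  map_zero' := by
    ext j k l
    rcases j with j | j <;> rfl
  map_add' x y := by
    ext j k l
    rcases j with j | j
    · exact (add_zero (0 : B)).symm
    · rfl
  map_mul' x y := by
    ext j k l
    rcases j with j | j
    · rw [Pi.mul_apply, mul_zero]
    · simp only [Pi.mul_apply, mkMat_apply, CStarMatrix.mul_apply]
      rfl
  map_star' x := by
    ext j k l
    rcases j with j | j
    · exact (star_zero B).symm
    · rfl

theorem blockFst_add (x : BlockSum R B) (y : BlockSum R' B) :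
    blockFst R R' B (blockInl R R' B x + blockInr R R' B y) = x := by
  ext j k l
  exact add_zero (x j k l)

theorem blockSnd_add (x : BlockSum R B) (y : BlockSum R' B) :
    blockSnd R R' B (blockInl R R' B x + blockInr R R' B y) = y := by
  ext j k l
  exact zero_add (y j k l)

theorem norm_inl_add_inr_le {x : BlockSum R B} {y : BlockSum R' B} {c : ℝ} (hx : ‖x‖ ≤ c)
    (hy : ‖y‖ ≤ c) : ‖blockInl R R' B x + blockInr R R' B y‖ ≤ c := by
  rw [pi_norm_le_iff_of_nonneg ((norm_nonneg x).trans hx)]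
  rintro (j | j)
  · refine le_trans (le_of_eq ?_) ((norm_le_pi_norm x j).trans hx)
    have h : (blockInl R R' B x + blockInr R R' B y) (.inl j) = x j := by
      ext k l
      exact add_zero (x j k l)
    rw [h]; rfl
  · refine le_trans (le_of_eq ?_) ((norm_le_pi_norm y j).trans hy)
    have h : (blockInl R R' B x + blockInr R R' B y) (.inr j) = y j := by
      ext k l
      exact zero_add (y j k l)
    rw [h]; rfl

variable [DecidableEq J] [DecidableEq J'] [∀ j, DecidableEq (R j)] [∀ j, DecidableEq (R' j)]

theorem blockFst_blockUnit_inl (j : J) (k l : R j) (b : B) :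
    blockFst R R' B (blockUnit (.inl j) k l b) = blockUnit j k l b := by
  ext j' k' l'
  rcases eq_or_ne j' j with rfl | hj
  · rw [blockUnit_self]
    exact blockUnit_self (R := Sum.elim R R') (.inl j') k l b k' l'
  · rw [blockUnit_of_ne hj]
    have h : (Sum.inl j' : J ⊕ J') ≠ .inl j := by simpa using hj
    exact congrFun (congrFun (blockUnit_of_ne (R := Sum.elim R R') h k l b) k') l'

theorem blockSnd_blockUnit_inr (j : J') (k l : R' j) (b : B) :
    blockSnd R R' B (blockUnit (.inr j) k l b) = blockUnit j k l b := by
  ext j' k' l'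
  rcases eq_or_ne j' j with rfl | hj
  · rw [blockUnit_self]
    exact blockUnit_self (R := Sum.elim R R') (.inr j') k l b k' l'
  · rw [blockUnit_of_ne hj]
    have h : (Sum.inr j' : J ⊕ J') ≠ .inr j := by simpa using hj
    exact congrFun (congrFun (blockUnit_of_ne (R := Sum.elim R R') h k l b) k') l'

theorem blockSnd_blockUnit_inl (j : J) (k l : R j) (b : B) :
    blockSnd R R' B (blockUnit (.inl j) k l b) = 0 := by
  ext j' k' l'
  have h : (Sum.inr j' : J ⊕ J') ≠ .inl j := by simp
  exact congrFun (congrFun (blockUnit_of_ne (R := Sum.elim R R') h k l b) k') l'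

theorem blockFst_blockUnit_inr (j : J') (k l : R' j) (b : B) :
    blockFst R R' B (blockUnit (.inr j) k l b) = 0 := by
  ext j' k' l'
  have h : (Sum.inl j' : J ⊕ J') ≠ .inr j := by simp
  exact congrFun (congrFun (blockUnit_of_ne (R := Sum.elim R R') h k l b) k') l'

end BlockSumElim

/-! ### Direct sums of operator algebras along two isometries with orthogonal ranges -/

section SumModel

variable {H K L : Type*} [NormedAddCommGroup H] [InnerProductSpace ℂ H] [CompleteSpace H]
  [NormedAddCommGroup K] [InnerProductSpace ℂ K] [CompleteSpace K]
  [NormedAddCommGroup L] [InnerProductSpace ℂ L] [CompleteSpace L]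

open ContinuousLinearMap (adjoint)

/-- `V` and `W` are isometries with orthogonal ranges. -/
structure IsOrthogonalPair (V : H →L[ℂ] L) (W : K →L[ℂ] L) : Prop where
  fst : ∀ ξ, adjoint V (V ξ) = ξ
  snd : ∀ ξ, adjoint W (W ξ) = ξ
  fst_snd : ∀ ξ, adjoint V (W ξ) = 0

namespace IsOrthogonalPair

variable {V : H →L[ℂ] L} {W : K →L[ℂ] L} (h : IsOrthogonalPair V W)

include h

theorem snd_fst (ξ : H) : adjoint W (V ξ) = 0 := by
  refine ext_inner_right ℂ fun ζ => ?_
  rw [ContinuousLinearMap.adjoint_inner_left, ← ContinuousLinearMap.adjoint_inner_right, h.fst_snd,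
    inner_zero_right, inner_zero_left]

/-- The block diagonal operator `a ⊕ c`. -/
def sumHom : (H →L[ℂ] H) × (K →L[ℂ] K) →⋆ₙₐ[ℂ] (L →L[ℂ] L) where
  toFun p := V ∘L p.1 ∘L adjoint V + W ∘L p.2 ∘L adjoint W
  map_smul' z p := by ext ξ; simp
  map_zero' := by ext ξ; simp
  map_add' p q := by ext ξ; simp; abel
  map_mul' p q := by ext ξ; simp [h.fst, h.snd, h.fst_snd, h.snd_fst]
  map_star' p := by
    simp [ContinuousLinearMap.star_eq_adjoint, ContinuousLinearMap.adjoint_comp,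
      ContinuousLinearMap.comp_assoc]

theorem sumHom_apply (a : H →L[ℂ] H) (c : K →L[ℂ] K) (ξ : L) :
    h.sumHom (a, c) ξ = V (a (adjoint V ξ)) + W (c (adjoint W ξ)) := rfl

theorem sumHom_fst (a : H →L[ℂ] H) (c : K →L[ℂ] K) (ξ : H) :
    h.sumHom (a, c) (V ξ) = V (a ξ) := by
  simp [sumHom_apply, h.fst, h.snd_fst]

theorem sumHom_snd (a : H →L[ℂ] H) (c : K →L[ℂ] K) (ξ : K) :
    h.sumHom (a, c) (W ξ) = W (c ξ) := by
  simp [sumHom_apply, h.snd, h.fst_snd]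

theorem compress_fst (a : H →L[ℂ] H) (c : K →L[ℂ] K) :
    adjoint V ∘L h.sumHom (a, c) ∘L V = a := by
  ext ξ
  simp [sumHom_fst, h.fst]

theorem compress_snd (a : H →L[ℂ] H) (c : K →L[ℂ] K) :
    adjoint W ∘L h.sumHom (a, c) ∘L W = c := by
  ext ξ
  simp [sumHom_snd, h.snd]

/-- The norm of a pair is the maximum, and *-homomorphisms are contractive. -/
theorem norm_sumHom_le (a : H →L[ℂ] H) (c : K →L[ℂ] K) :
    ‖h.sumHom (a, c)‖ ≤ max ‖a‖ ‖c‖ :=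
  isContractive_starHom h.sumHom (a, c)

end IsOrthogonalPair

/-- The algebra `G` is the direct sum of `A` and `C`, with respect to two isometries with orthogonal
ranges. -/
structure IsSumModel (V : H →L[ℂ] L) (W : K →L[ℂ] L) (A : NonUnitalStarSubalgebra ℂ (H →L[ℂ] H))
    (C : NonUnitalStarSubalgebra ℂ (K →L[ℂ] K)) (G : NonUnitalStarSubalgebra ℂ (L →L[ℂ] L)) :
    Prop extends IsOrthogonalPair V W where
  mem_iff : ∀ x, x ∈ G ↔ ∃ a ∈ A, ∃ c ∈ C, x = V ∘L a ∘L adjoint V + W ∘L c ∘L adjoint W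

namespace IsSumModel

variable {V : H →L[ℂ] L} {W : K →L[ℂ] L} {A : NonUnitalStarSubalgebra ℂ (H →L[ℂ] H)}
  {C : NonUnitalStarSubalgebra ℂ (K →L[ℂ] K)} {G : NonUnitalStarSubalgebra ℂ (L →L[ℂ] L)}
  [IsClosed (A : Set (H →L[ℂ] H))] [IsClosed (C : Set (K →L[ℂ] K))] [IsClosed (G : Set (L →L[ℂ] L))]
  (h : IsSumModel V W A C G)

include h

/-- The pair `(a, c)` as an element of the direct sum. -/
def pair (a : A) (c : C) : G := ⟨h.sumHom (a.1, c.1), (h.mem_iff _).2 ⟨a, a.2, c, c.2, rfl⟩⟩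

theorem exists_eq_pair (x : G) : ∃ a c, x = h.pair a c := by
  obtain ⟨a, ha, c, hc, hx⟩ := (h.mem_iff _).1 x.2
  exact ⟨⟨a, ha⟩, ⟨c, hc⟩, Subtype.ext hx⟩

theorem pair_add (a a' : A) (c c' : C) : h.pair (a + a') (c + c') = h.pair a c + h.pair a' c' :=
  Subtype.ext (map_add h.sumHom (a.1, c.1) (a'.1, c'.1))

theorem pair_mul (a a' : A) (c c' : C) : h.pair (a * a') (c * c') = h.pair a c * h.pair a' c' :=
  Subtype.ext (map_mul h.sumHom (a.1, c.1) (a'.1, c'.1))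

theorem pair_star (a : A) (c : C) : h.pair (star a) (star c) = star (h.pair a c) :=
  Subtype.ext (map_star h.sumHom (a.1, c.1))

/-- The projection onto the first summand. -/
def fstHom : G →⋆ₙₐ[ℂ] A where
  toFun x := ⟨adjoint V ∘L x.1 ∘L V, by
    obtain ⟨a, c, rfl⟩ := h.exists_eq_pair x
    exact (h.compress_fst a.1 c.1).symm ▸ a.2⟩
  map_smul' z x := Subtype.ext (by ext ξ; simp)
  map_zero' := Subtype.ext (by ext ξ; simp)
  map_add' x y := Subtype.ext (by ext ξ; simp)
  map_mul' x y := by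
    obtain ⟨a, c, rfl⟩ := h.exists_eq_pair x
    obtain ⟨a', c', rfl⟩ := h.exists_eq_pair y
    refine Subtype.ext ?_
    rw [← h.pair_mul]
    refine (h.compress_fst _ _).trans ?_
    exact congrArg₂ (· * ·) (h.compress_fst a.1 c.1).symm (h.compress_fst a'.1 c'.1).symm
  map_star' x := by
    obtain ⟨a, c, rfl⟩ := h.exists_eq_pair x
    refine Subtype.ext ?_
    rw [← h.pair_star]
    exact (h.compress_fst _ _).trans (congrArg star (h.compress_fst a.1 c.1).symm)

theorem fstHom_pair (a : A) (c : C) : h.fstHom (h.pair a c) = a := Subtype.ext (h.compress_fst _ _)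

/-- The projection onto the second summand. -/
def sndHom : G →⋆ₙₐ[ℂ] C where
  toFun x := ⟨adjoint W ∘L x.1 ∘L W, by
    obtain ⟨a, c, rfl⟩ := h.exists_eq_pair x
    exact (h.compress_snd a.1 c.1).symm ▸ c.2⟩
  map_smul' z x := Subtype.ext (by ext ξ; simp)
  map_zero' := Subtype.ext (by ext ξ; simp)
  map_add' x y := Subtype.ext (by ext ξ; simp)
  map_mul' x y := by
    obtain ⟨a, c, rfl⟩ := h.exists_eq_pair x
    obtain ⟨a', c', rfl⟩ := h.exists_eq_pair y
    refine Subtype.ext ?_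
    rw [← h.pair_mul]
    refine (h.compress_snd _ _).trans ?_
    exact congrArg₂ (· * ·) (h.compress_snd a.1 c.1).symm (h.compress_snd a'.1 c'.1).symm
  map_star' x := by
    obtain ⟨a, c, rfl⟩ := h.exists_eq_pair x
    refine Subtype.ext ?_
    rw [← h.pair_star]
    exact (h.compress_snd _ _).trans (congrArg star (h.compress_snd a.1 c.1).symm)

theorem sndHom_pair (a : A) (c : C) : h.sndHom (h.pair a c) = c := Subtype.ext (h.compress_snd _ _)

/-- The inclusion of the first summand. -/
def inlHom : A →⋆ₙₐ[ℂ] G where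
  toFun a := h.pair a 0
  map_smul' z a := by
    have e : (z • a.1, (0 : K →L[ℂ] K)) = z • (a.1, (0 : K →L[ℂ] K)) := by simp
    exact Subtype.ext ((congrArg h.sumHom e).trans (map_smul h.sumHom z _))
  map_zero' := Subtype.ext (map_zero h.sumHom)
  map_add' a b := by rw [← h.pair_add, add_zero]
  map_mul' a b := by rw [← h.pair_mul, mul_zero]
  map_star' a := by rw [← h.pair_star, star_zero]

/-- The inclusion of the second summand. -/
def inrHom : C →⋆ₙₐ[ℂ] G where
  toFun c := h.pair 0 c
  map_smul' z c := by
    have e : ((0 : H →L[ℂ] H), z • c.1) = z • ((0 : H →L[ℂ] H), c.1) := by simp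
    exact Subtype.ext ((congrArg h.sumHom e).trans (map_smul h.sumHom z _))
  map_zero' := Subtype.ext (map_zero h.sumHom)
  map_add' a b := by rw [← h.pair_add, add_zero]
  map_mul' a b := by rw [← h.pair_mul, mul_zero]
  map_star' a := by rw [← h.pair_star, star_zero]

theorem inlHom_add_inrHom (a : A) (c : C) : h.inlHom a + h.inrHom c = h.pair a c := by
  change h.pair a 0 + h.pair 0 c = h.pair a c
  rw [← h.pair_add, add_zero, zero_add]

theorem norm_pair_le (a : A) (c : C) : ‖h.pair a c‖ ≤ max ‖a‖ ‖c‖ := h.norm_sumHom_le a.1 c.1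

theorem pair_mem_normalisers {D : NonUnitalStarSubalgebra ℂ (H →L[ℂ] H)}
    {E : NonUnitalStarSubalgebra ℂ (K →L[ℂ] K)} {G' : NonUnitalStarSubalgebra ℂ (L →L[ℂ] L)}
    (h' : IsSumModel V W D E G') {a : A} {c : C}
    (ha : (a : H →L[ℂ] H) ∈ normalisers D A) (hc : (c : K →L[ℂ] K) ∈ normalisers E C) :
    (h.pair a c).1 ∈ normalisers G' G := by
  refine ⟨(h.pair a c).2, fun x hx => ?_⟩
  obtain ⟨d, hd, e, he, rfl⟩ := (h'.mem_iff x).1 hx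
  change h.sumHom (a.1, c.1) * h.sumHom (d, e) * star (h.sumHom (a.1, c.1)) ∈ _ ∧
    star (h.sumHom (a.1, c.1)) * h.sumHom (d, e) * h.sumHom (a.1, c.1) ∈ _
  rw [← map_star h.sumHom, ← map_mul h.sumHom, ← map_mul h.sumHom, ← map_mul h.sumHom,
    ← map_mul h.sumHom]
  exact ⟨(h'.mem_iff _).2 ⟨_, (ha.2 d hd).1, _, (hc.2 e he).1, rfl⟩,
    (h'.mem_iff _).2 ⟨_, (ha.2 d hd).2, _, (hc.2 e he).2, rfl⟩⟩

end IsSumModel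

end SumModel

end GenDiag
end

noncomputable section

namespace GenDiag

/-! ### The direct sum of two approximations -/

section DirectSum

variable {H K L : Type*} [NormedAddCommGroup H] [InnerProductSpace ℂ H] [CompleteSpace H]
  [NormedAddCommGroup K] [InnerProductSpace ℂ K] [CompleteSpace K]
  [NormedAddCommGroup L] [InnerProductSpace ℂ L] [CompleteSpace L]
variable {B : Type*} [NonUnitalCStarAlgebra B] [PartialOrder B] [StarOrderedRing B]
variable {D A : NonUnitalStarSubalgebra ℂ (H →L[ℂ] H)} [IsClosed (A : Set (H →L[ℂ] H))]
variable {E C : NonUnitalStarSubalgebra ℂ (K →L[ℂ] K)} [IsClosed (C : Set (K →L[ℂ] K))]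

theorem IsCP.add {X Y : Type*} [NonUnitalCStarAlgebra X] [NonUnitalCStarAlgebra Y]
    {φ χ : X →ₗ[ℂ] Y} (hφ : IsCP φ) (hχ : IsCP χ) : IsCP (φ + χ) :=
  isCP_of_isGram fun _ _ x => (hφ.isGram (isGram_star_mul x)).add (hχ.isGram (isGram_star_mul x))

/-- A `*`-homomorphism as a linear map. -/
abbrev homMap {X Y : Type*} [NonUnitalCStarAlgebra X] [NonUnitalCStarAlgebra Y]
    (σ : X →⋆ₙₐ[ℂ] Y) : X →ₗ[ℂ] Y := σ

theorem zero_mem_normalisers : (0 : H →L[ℂ] H) ∈ normalisers D A :=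
  ⟨zero_mem A, fun d _ => by simp [zero_mem]⟩

variable {J J' : Type} {R : J → Type} {R' : J' → Type} [Fintype J] [DecidableEq J]
  [∀ j, Fintype (R j)] [∀ j, DecidableEq (R j)] [Fintype J'] [DecidableEq J']
  [∀ j, Fintype (R' j)] [∀ j, DecidableEq (R' j)]
variable {V : H →L[ℂ] L} {W : K →L[ℂ] L} {G' G : NonUnitalStarSubalgebra ℂ (L →L[ℂ] L)}
  [IsClosed (G : Set (L →L[ℂ] L))] (hG : IsSumModel V W A C G)

namespace IsSumModel

/-- The direct sum of two downwards maps. -/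
def down (ψ : A →ₗ[ℂ] BlockSum R B) (ψ' : C →ₗ[ℂ] BlockSum R' B) :
    G →ₗ[ℂ] BlockSum (Sum.elim R R') B :=
  homMap (blockInl R R' B) ∘ₗ ψ ∘ₗ
      homMap (hG.fstHom) +
    homMap (blockInr R R' B) ∘ₗ ψ' ∘ₗ
      homMap (hG.sndHom)

/-- The direct sum of two upwards maps. -/
def up (φ : BlockSum R B →ₗ[ℂ] A) (φ' : BlockSum R' B →ₗ[ℂ] C) :
    BlockSum (Sum.elim R R') B →ₗ[ℂ] G :=
  homMap (hG.inlHom) ∘ₗ φ ∘ₗ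
      homMap (blockFst R R' B) +
    homMap (hG.inrHom) ∘ₗ φ' ∘ₗ
      homMap (blockSnd R R' B)

theorem down_pair (ψ : A →ₗ[ℂ] BlockSum R B) (ψ' : C →ₗ[ℂ] BlockSum R' B) (a : A) (c : C) :
    hG.down ψ ψ' (hG.pair a c) = blockInl R R' B (ψ a) + blockInr R R' B (ψ' c) := by
  change blockInl R R' B (ψ (hG.fstHom (hG.pair a c))) +
    blockInr R R' B (ψ' (hG.sndHom (hG.pair a c))) = _
  rw [hG.fstHom_pair, hG.sndHom_pair]

theorem up_apply (φ : BlockSum R B →ₗ[ℂ] A) (φ' : BlockSum R' B →ₗ[ℂ] C)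
    (x : BlockSum (Sum.elim R R') B) :
    hG.up φ φ' x = hG.pair (φ (blockFst R R' B x)) (φ' (blockSnd R R' B x)) :=
  hG.inlHom_add_inrHom _ _

theorem up_inl (φ : BlockSum R B →ₗ[ℂ] A) (φ' : BlockSum R' B →ₗ[ℂ] C) (j : J) (k l : R j) (b : B) :
    hG.up φ φ' (blockUnit (.inl j) k l b) = hG.pair (φ (blockUnit j k l b)) 0 :=
  (hG.up_apply φ φ' _).trans (congrArg₂ hG.pair (congrArg φ (blockFst_blockUnit_inl j k l b))
    ((congrArg φ' (blockSnd_blockUnit_inl j k l b)).trans (map_zero φ')))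

theorem up_inr (φ : BlockSum R B →ₗ[ℂ] A) (φ' : BlockSum R' B →ₗ[ℂ] C) (j : J') (k l : R' j)
    (b : B) : hG.up φ φ' (blockUnit (.inr j) k l b) = hG.pair 0 (φ' (blockUnit j k l b)) :=
  (hG.up_apply φ φ' _).trans (congrArg₂ hG.pair
    ((congrArg φ (blockFst_blockUnit_inr j k l b)).trans (map_zero φ))
    (congrArg φ' (blockSnd_blockUnit_inr j k l b)))

end IsSumModel

/-- A set of blocks that is monochromatic in the disjoint union is so on each side, and the two
sides have orthogonal images. So every condition splits into its two components, even though the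
colours are shared. -/
theorem Approx.directSum {ι : Type} {c : J → ι} {c' : J' → ι} {S : Set A} {S' : Set C} {ε : ℝ}
    {ψ : A →ₗ[ℂ] BlockSum R B} {φ : BlockSum R B →ₗ[ℂ] A} {ψ' : C →ₗ[ℂ] BlockSum R' B}
    {φ' : BlockSum R' B →ₗ[ℂ] C} (h : Approx B D A c S ε ψ φ) (h' : Approx B E C c' S' ε ψ' φ')
    (hG' : IsSumModel V W D E G') (T : Set G)
    (hT : ∀ a c, hG.pair a c ∈ T → a ∈ S ∧ c ∈ S') :
    Approx B G' G (Sum.elim c c') T ε (hG.down ψ ψ') (hG.up φ φ') := by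
  have hP1 : ∀ P, Mono (Sum.elim c c') P → Mono c (Sum.inl ⁻¹' P) :=
    fun P hP j hj j' hj' => hP _ hj _ hj'
  have hP2 : ∀ P, Mono (Sum.elim c c') P → Mono c' (Sum.inr ⁻¹' P) :=
    fun P hP j hj j' hj' => hP _ hj _ hj'
  have hS1 : ∀ P, ∀ x : BlockSum (Sum.elim R R') B, SuppIn P x →
      SuppIn (Sum.inl ⁻¹' P) (blockFst R R' B x) := fun P x hx j hj => hx (.inl j) hj
  have hS2 : ∀ P, ∀ x : BlockSum (Sum.elim R R') B, SuppIn P x →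
      SuppIn (Sum.inr ⁻¹' P) (blockSnd R R' B x) := fun P x hx j hj => hx (.inr j) hj
  refine ⟨?_, ?_, fun x => ?_, fun x hx => ?_, fun P hP x y z hx hy hz => ?_, fun P hP x hx => ?_,
    fun x hx => ?_, fun P hP x hx hx' => ?_, ?_, ?_⟩
  · exact ((isCP_starHom (blockInl R R' B)).comp (h.cp_psi.comp (isCP_starHom hG.fstHom))).add
      ((isCP_starHom (blockInr R R' B)).comp (h'.cp_psi.comp (isCP_starHom hG.sndHom)))
  · exact ((isCP_starHom hG.inlHom).comp (h.cp_phi.comp (isCP_starHom (blockFst R R' B)))).add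
      ((isCP_starHom hG.inrHom).comp (h'.cp_phi.comp (isCP_starHom (blockSnd R R' B))))
  · obtain ⟨a, c, rfl⟩ := hG.exists_eq_pair x
    rw [hG.down_pair]
    exact norm_inl_add_inr_le
      ((h.contractive_psi a).trans (by
        have h1 := isContractive_starHom hG.fstHom (hG.pair a c)
        rwa [hG.fstHom_pair] at h1))
      ((h'.contractive_psi c).trans (by
        have h1 := isContractive_starHom hG.sndHom (hG.pair a c)
        rwa [hG.sndHom_pair] at h1))
  · obtain ⟨a, c, rfl⟩ := hG.exists_eq_pair x
    obtain ⟨ha, hc⟩ := hT a c hx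
    rw [hG.down_pair, hG.up_apply, blockFst_add, blockSnd_add]
    have h1 : hG.pair (φ (ψ a)) (φ' (ψ' c)) - hG.pair a c = hG.pair (φ (ψ a) - a) (φ' (ψ' c) - c) := by
      rw [sub_eq_iff_eq_add, ← hG.pair_add, sub_add_cancel, sub_add_cancel]
    rw [h1]
    exact (hG.norm_pair_le _ _).trans_lt (max_lt (h.approx a ha) (h'.approx c hc))
  · rw [hG.up_apply, hG.up_apply, hG.up_apply, hG.up_apply]
    have h1 := h.map_mul_map_mul _ (hP1 P hP) _ _ _ (hS1 P x hx) (hS1 P y hy) (hS1 P z hz)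
    have h2 := h'.map_mul_map_mul _ (hP2 P hP) _ _ _ (hS2 P x hx) (hS2 P y hy) (hS2 P z hz)
    rw [← map_mul (blockFst R R' B), ← map_mul (blockFst R R' B)] at h1
    rw [← map_mul (blockSnd R R' B), ← map_mul (blockSnd R R' B)] at h2
    rw [← hG.pair_mul, ← hG.pair_mul, h1, h2]
  · rw [hG.up_apply]
    refine (hG.norm_pair_le _ _).trans (max_le
      ((h.contractive_phi _ (hP1 P hP) _ (hS1 P x hx)).trans
        (isContractive_starHom (blockFst R R' B) x))
      ((h'.contractive_phi _ (hP2 P hP) _ (hS2 P x hx)).trans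
        (isContractive_starHom (blockSnd R R' B) x)))
  · obtain ⟨a, c, rfl⟩ := hG.exists_eq_pair x
    obtain ⟨d, hd, e, he, hde⟩ := (hG'.mem_iff _).1 hx
    have hda : (a : H →L[ℂ] H) = d := by
      rw [← hG.compress_fst a.1 c.1, ← hG.compress_fst d e]
      exact congrArg (fun T => ContinuousLinearMap.adjoint V ∘L T ∘L V) hde
    have hec : (c : K →L[ℂ] K) = e := by
      rw [← hG.compress_snd a.1 c.1, ← hG.compress_snd d e]
      exact congrArg (fun T => ContinuousLinearMap.adjoint W ∘L T ∘L W) hde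
    rw [hG.down_pair]
    rintro (j | j) k l hkl
    · exact (add_zero (ψ a j k l)).trans (h.map_diagonal a (hda ▸ hd) j k l hkl)
    · exact (zero_add (ψ' c j k l)).trans (h'.map_diagonal c (hec ▸ he) j k l hkl)
  · rw [hG.up_apply]
    exact hG.pair_mem_normalisers hG'
      (h.diagonal_normaliser _ (hP1 P hP) _ (hS1 P x hx) fun j => hx' (.inl j))
      (h'.diagonal_normaliser _ (hP2 P hP) _ (hS2 P x hx) fun j => hx' (.inr j))
  · rintro (j | j) k l b
    · rw [hG.up_inl φ φ' j k l b]
      exact hG.pair_mem_normalisers hG' (h.unit_normaliser j k l b) zero_mem_normalisers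
    · rw [hG.up_inr φ φ' j k l b]
      exact hG.pair_mem_normalisers hG' zero_mem_normalisers (h'.unit_normaliser j k l b)
  · rintro (j | j) k x hx l b ξ
    all_goals obtain ⟨d, hd, e, he, rfl⟩ := (hG'.mem_iff x).1 hx
    -- The image of a block from the first family is V φ V^*, so its row space is the image under V
    -- of the original one.
    · have h0 : ∀ l b ξ, (hG.up φ φ' (blockUnit (.inl j) k l b)).1 ξ =
          V ((φ (blockUnit j k l b)).1 (ContinuousLinearMap.adjoint V ξ)) := fun l b ξ => by
        rw [hG.up_inl φ φ' j k l b]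
        change V _ + W (0 : K) = _
        rw [map_zero, add_zero]; rfl
      rw [h0]
      change hG.sumHom (d, e) (V _) ∈ _
      rw [hG.sumHom_fst]
      refine map_mem_topologicalClosure ?_ (h.invariant j k d hd l b (ContinuousLinearMap.adjoint V ξ))
      rintro _ ⟨l, b, ξ, rfl⟩
      exact Submodule.le_topologicalClosure _
        (Submodule.subset_span ⟨l, b, V ξ,
          ((h0 l b (V ξ)).trans (by rw [hG.fst])).symm⟩)
    · have h0 : ∀ l b ξ, (hG.up φ φ' (blockUnit (.inr j) k l b)).1 ξ =
          W ((φ' (blockUnit j k l b)).1 (ContinuousLinearMap.adjoint W ξ)) := fun l b ξ => by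
        rw [hG.up_inr φ φ' j k l b]
        change V (0 : H) + W _ = _
        rw [map_zero, zero_add]; rfl
      rw [h0]
      change hG.sumHom (d, e) (W _) ∈ _
      rw [hG.sumHom_snd]
      refine map_mem_topologicalClosure ?_ (h'.invariant j k e he l b (ContinuousLinearMap.adjoint W ξ))
      rintro _ ⟨l, b, ξ, rfl⟩
      exact Submodule.le_topologicalClosure _
        (Submodule.subset_span ⟨l, b, W ξ,
          ((h0 l b (W ξ)).trans (by rw [hG.snd])).symm⟩)

include hG in
theorem DimLE.directSum (hG' : IsSumModel V W D E G') {d d' : ℕ} (h : DimLE B D A d)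
    (h' : DimLE B E C d') : DimLE B G' G (max d d') := by
  rw [dimLE_iff] at h h' ⊢
  intro T hT ε hε
  obtain ⟨J, _, _, R, _, _, c, ψ, φ, h1⟩ := h (hG.fstHom '' T) (hT.image _) ε hε
  obtain ⟨J', _, _, R', _, _, c', ψ', φ', h2⟩ := h' (hG.sndHom '' T) (hT.image _) ε hε
  -- Both colour sets are embedded as initial segments of the same set of max(d, d') + 1 colours.
  have h3 := h1.recolour (c' := Fin.castLE (Nat.succ_le_succ (le_max_left d d')) ∘ c)
    fun j j' hj => Fin.castLE_injective _ hj
  have h4 := h2.recolour (c' := Fin.castLE (Nat.succ_le_succ (le_max_right d d')) ∘ c')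
    fun j j' hj => Fin.castLE_injective _ hj
  exact ⟨_, inferInstance, inferInstance, _, inferInstance, inferInstance, _, _, _,
    h3.directSum hG h4 hG' T fun a c hac => ⟨⟨_, hac, hG.fstHom_pair a c⟩,
      ⟨_, hac, hG.sndHom_pair a c⟩⟩⟩

end DirectSum

/-! ### The direct sum represented on H ⊕ K -/

section DirectSumInstance

variable {H K : Type*} [NormedAddCommGroup H] [InnerProductSpace ℂ H] [CompleteSpace H]
  [NormedAddCommGroup K] [InnerProductSpace ℂ K] [CompleteSpace K]

/-- The isometric inclusion of `H` into `H ⊕ K`. -/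
def inlCLM (H K : Type*) [NormedAddCommGroup H] [InnerProductSpace ℂ H]
    [NormedAddCommGroup K] [InnerProductSpace ℂ K] : H →L[ℂ] WithLp 2 (H × K) :=
  ((WithLp.prodContinuousLinearEquiv 2 ℂ H K).symm : H × K →L[ℂ] WithLp 2 (H × K)) ∘L
    ContinuousLinearMap.inl ℂ H K

/-- The isometric inclusion of `K` into `H ⊕ K`. -/
def inrCLM (H K : Type*) [NormedAddCommGroup H] [InnerProductSpace ℂ H]
    [NormedAddCommGroup K] [InnerProductSpace ℂ K] : K →L[ℂ] WithLp 2 (H × K) :=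
  ((WithLp.prodContinuousLinearEquiv 2 ℂ H K).symm : H × K →L[ℂ] WithLp 2 (H × K)) ∘L
    ContinuousLinearMap.inr ℂ H K

theorem adjoint_inlCLM (ξ : WithLp 2 (H × K)) :
    ContinuousLinearMap.adjoint (inlCLM H K) ξ = ξ.fst := by
  refine ext_inner_right ℂ fun ζ => ?_
  rw [ContinuousLinearMap.adjoint_inner_left]
  simp [WithLp.prod_inner_apply, inlCLM]

theorem adjoint_inrCLM (ξ : WithLp 2 (H × K)) :
    ContinuousLinearMap.adjoint (inrCLM H K) ξ = ξ.snd := by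
  refine ext_inner_right ℂ fun ζ => ?_
  rw [ContinuousLinearMap.adjoint_inner_left]
  simp [WithLp.prod_inner_apply, inrCLM]

theorem sumOp_eq (a : H →L[ℂ] H) (c : K →L[ℂ] K) : sumOp a c =
    inlCLM H K ∘L a ∘L ContinuousLinearMap.adjoint (inlCLM H K) +
      inrCLM H K ∘L c ∘L ContinuousLinearMap.adjoint (inrCLM H K) := by
  refine ContinuousLinearMap.ext fun ξ => ?_
  change _ = inlCLM H K (a (ContinuousLinearMap.adjoint (inlCLM H K) ξ)) +
    inrCLM H K (c (ContinuousLinearMap.adjoint (inrCLM H K) ξ))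
  rw [adjoint_inlCLM, adjoint_inrCLM]
  change WithLp.toLp 2 (a ξ.fst, c ξ.snd) = WithLp.toLp 2 (a ξ.fst + 0, 0 + c ξ.snd)
  rw [add_zero, zero_add]

theorem isSumModel_directSum (A : NonUnitalStarSubalgebra ℂ (H →L[ℂ] H))
    (C : NonUnitalStarSubalgebra ℂ (K →L[ℂ] K)) :
    IsSumModel (inlCLM H K) (inrCLM H K) A C (directSum A C) where
  fst ξ := adjoint_inlCLM _
  snd ξ := adjoint_inrCLM _
  fst_snd ξ := adjoint_inlCLM _
  mem_iff x := by
    simp only [← sumOp_eq]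
    rfl

theorem dimLE_directSum {B : Type*} [NonUnitalCStarAlgebra B] [PartialOrder B] [StarOrderedRing B]
    {D A : NonUnitalStarSubalgebra ℂ (H →L[ℂ] H)} [IsClosed (A : Set (H →L[ℂ] H))]
    {E C : NonUnitalStarSubalgebra ℂ (K →L[ℂ] K)} [IsClosed (C : Set (K →L[ℂ] K))] {d d' : ℕ}
    (h : DimLE B D A d) (h' : DimLE B E C d') :
    DimLE B (directSum D E) (directSum A C) (max d d') :=
  DimLE.directSum (isSumModel_directSum A C) (isSumModel_directSum D E) h h'

end DirectSumInstance

end GenDiag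
end

noncomputable section

namespace GenDiag

open scoped InnerProductSpace

/-! ### Spatial tensor products -/

section TensorModel

variable {H K L : Type*} [NormedAddCommGroup H] [InnerProductSpace ℂ H] [CompleteSpace H]
  [NormedAddCommGroup K] [InnerProductSpace ℂ K] [CompleteSpace K]
  [NormedAddCommGroup L] [InnerProductSpace ℂ L] [CompleteSpace L]

/-- A realisation of the Hilbert space tensor product of `H` and `K`, together with the
tensor products of operators. -/
structure TensorModel (H K L : Type*) [NormedAddCommGroup H] [InnerProductSpace ℂ H]
    [NormedAddCommGroup K] [InnerProductSpace ℂ K] [NormedAddCommGroup L]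
    [InnerProductSpace ℂ L] where
  /-- The tensor product of vectors. -/
  t : H →ₗ[ℂ] K →ₗ[ℂ] L
  inner_t : ∀ ξ ζ ξ' ζ', ⟪t ξ ζ, t ξ' ζ'⟫_ℂ = ⟪ξ, ξ'⟫_ℂ * ⟪ζ, ζ'⟫_ℂ
  dense : (Submodule.span ℂ {x | ∃ ξ ζ, x = t ξ ζ}).topologicalClosure = ⊤
  /-- The tensor product of operators. -/
  op : (H →L[ℂ] H) → (K →L[ℂ] K) → (L →L[ℂ] L)
  op_t : ∀ a c ξ ζ, op a c (t ξ ζ) = t (a ξ) (c ζ)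

namespace TensorModel

variable (M : TensorModel H K L)

theorem norm_t (ξ : H) (ζ : K) : ‖M.t ξ ζ‖ = ‖ξ‖ * ‖ζ‖ := by
  have h := M.inner_t ξ ζ ξ ζ
  rw [inner_self_eq_norm_sq_to_K, inner_self_eq_norm_sq_to_K, inner_self_eq_norm_sq_to_K] at h
  have h' : ‖M.t ξ ζ‖ ^ 2 = (‖ξ‖ * ‖ζ‖) ^ 2 := by
    rw [mul_pow]
    exact_mod_cast h
  exact (sq_eq_sq₀ (norm_nonneg _) (by positivity)).1 h'

theorem mem_of_isClosed {S : Submodule ℂ L} (hS : IsClosed (S : Set L))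
    (h : ∀ ξ ζ, M.t ξ ζ ∈ S) (x : L) : x ∈ S := by
  have h1 : (Submodule.span ℂ {x | ∃ ξ ζ, x = M.t ξ ζ}).topologicalClosure ≤ S := by
    refine Submodule.topologicalClosure_minimal _ (Submodule.span_le.2 ?_) hS
    rintro _ ⟨ξ, ζ, rfl⟩
    exact h ξ ζ
  exact h1 (M.dense ▸ Submodule.mem_top)

theorem ext {S T : L →L[ℂ] L} (h : ∀ ξ ζ, S (M.t ξ ζ) = T (M.t ξ ζ)) : S = T := by
  refine ContinuousLinearMap.ext fun x => ?_
  exact M.mem_of_isClosed (S := LinearMap.eqLocus (S : L →ₗ[ℂ] L) (T : L →ₗ[ℂ] L))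
    (isClosed_eq S.continuous T.continuous) h x

/-- The bounded operator `ξ ↦ ξ ⊗ ζ`. -/
def tLeft (ζ : K) : H →L[ℂ] L :=
  (M.t.flip ζ).mkContinuous ‖ζ‖ fun ξ => by
    rw [LinearMap.flip_apply, M.norm_t, mul_comm]

/-- The bounded operator `ζ ↦ ξ ⊗ ζ`. -/
def tRight (ξ : H) : K →L[ℂ] L :=
  (M.t ξ).mkContinuous ‖ξ‖ fun ζ => (M.norm_t ξ ζ).le

theorem tLeft_apply (ξ : H) (ζ : K) : M.tLeft ζ ξ = M.t ξ ζ := rfl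

theorem norm_tLeft_le (ζ : K) : ‖M.tLeft ζ‖ ≤ ‖ζ‖ :=
  LinearMap.mkContinuous_norm_le _ (norm_nonneg _) _

theorem op_add_left (a a' : H →L[ℂ] H) (c : K →L[ℂ] K) :
    M.op (a + a') c = M.op a c + M.op a' c := M.ext fun ξ ζ => by simp [op_t]

theorem op_add_right (a : H →L[ℂ] H) (c c' : K →L[ℂ] K) :
    M.op a (c + c') = M.op a c + M.op a c' := M.ext fun ξ ζ => by simp [op_t]

theorem op_smul_left (z : ℂ) (a : H →L[ℂ] H) (c : K →L[ℂ] K) :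
    M.op (z • a) c = z • M.op a c := M.ext fun ξ ζ => by simp [op_t]

theorem op_smul_right (z : ℂ) (a : H →L[ℂ] H) (c : K →L[ℂ] K) :
    M.op a (z • c) = z • M.op a c := M.ext fun ξ ζ => by simp [op_t]

theorem op_mul (a a' : H →L[ℂ] H) (c c' : K →L[ℂ] K) :
    M.op (a * a') (c * c') = M.op a c * M.op a' c' := M.ext fun ξ ζ => by simp [op_t]

theorem op_star (a : H →L[ℂ] H) (c : K →L[ℂ] K) : M.op (star a) (star c) = star (M.op a c) := by
  refine M.ext fun ξ ζ => ext_inner_right ℂ fun x => ?_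
  rw [ContinuousLinearMap.star_eq_adjoint (M.op a c), ContinuousLinearMap.adjoint_inner_left]
  refine M.mem_of_isClosed (S := LinearMap.eqLocus
    (innerSL ℂ (M.op (star a) (star c) (M.t ξ ζ)) : L →ₗ[ℂ] ℂ)
    ((innerSL ℂ (M.t ξ ζ) ∘L M.op a c : L →L[ℂ] ℂ) : L →ₗ[ℂ] ℂ))
    (isClosed_eq (ContinuousLinearMap.continuous _) (ContinuousLinearMap.continuous _))
    (fun ξ' ζ' => ?_) x
  change ⟪M.op (star a) (star c) (M.t ξ ζ), M.t ξ' ζ'⟫_ℂ = ⟪M.t ξ ζ, M.op a c (M.t ξ' ζ')⟫_ℂ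
  rw [op_t, op_t, M.inner_t, M.inner_t, ContinuousLinearMap.star_eq_adjoint,
    ContinuousLinearMap.star_eq_adjoint, ContinuousLinearMap.adjoint_inner_left,
    ContinuousLinearMap.adjoint_inner_left]

/-- The representation `a ↦ a ⊗ 1`. -/
def leftHom : (H →L[ℂ] H) →⋆ₙₐ[ℂ] (L →L[ℂ] L) where
  toFun a := M.op a 1
  map_smul' z a := M.op_smul_left z a 1
  map_zero' := M.ext fun ξ ζ => by simp [op_t]
  map_add' a a' := M.op_add_left a a' 1
  map_mul' a a' := by rw [← M.op_mul, mul_one]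
  map_star' a := by rw [← M.op_star, star_one]

/-- The representation `c ↦ 1 ⊗ c`. -/
def rightHom : (K →L[ℂ] K) →⋆ₙₐ[ℂ] (L →L[ℂ] L) where
  toFun c := M.op 1 c
  map_smul' z c := M.op_smul_right z 1 c
  map_zero' := M.ext fun ξ ζ => by simp [op_t]
  map_add' c c' := M.op_add_right 1 c c'
  map_mul' c c' := by rw [← M.op_mul, mul_one]
  map_star' c := by rw [← M.op_star, star_one]

/-- Factor a ⊗ c as (a ⊗ 1)(1 ⊗ c), where both factors depend on a and c through *-homomorphisms. -/
theorem norm_op_le (a : H →L[ℂ] H) (c : K →L[ℂ] K) : ‖M.op a c‖ ≤ ‖a‖ * ‖c‖ := by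
  have h : M.op a c = M.leftHom a * M.rightHom c := by
    change _ = M.op a 1 * M.op 1 c
    rw [← M.op_mul, mul_one, one_mul]
  rw [h]
  exact (norm_mul_le _ _).trans (mul_le_mul (isContractive_starHom _ _)
    (isContractive_starHom _ _) (norm_nonneg _) (norm_nonneg _))

/-- The spatial tensor product of two operator algebras. -/
def alg (A : NonUnitalStarSubalgebra ℂ (H →L[ℂ] H)) (C : NonUnitalStarSubalgebra ℂ (K →L[ℂ] K)) :
    NonUnitalStarSubalgebra ℂ (L →L[ℂ] L) :=
  cstarGenerated {x | ∃ a ∈ A, ∃ c ∈ C, x = M.op a c}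

instance isClosed_alg (A : NonUnitalStarSubalgebra ℂ (H →L[ℂ] H))
    (C : NonUnitalStarSubalgebra ℂ (K →L[ℂ] K)) : IsClosed (M.alg A C : Set (L →L[ℂ] L)) :=
  isClosed_cstarGenerated _

variable {A D : NonUnitalStarSubalgebra ℂ (H →L[ℂ] H)}
  {C E : NonUnitalStarSubalgebra ℂ (K →L[ℂ] K)}

theorem op_mem {a : H →L[ℂ] H} {c : K →L[ℂ] K} (ha : a ∈ A) (hc : c ∈ C) :
    M.op a c ∈ M.alg A C :=
  subset_cstarGenerated _ ⟨a, ha, c, hc, rfl⟩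

/-- The linear span of the elementary tensors is already a *-algebra, so only the closure has to be
added. -/
theorem mem_closure_span {x : L →L[ℂ] L} (hx : x ∈ M.alg A C) :
    x ∈ (Submodule.span ℂ {x | ∃ a ∈ A, ∃ c ∈ C, x = M.op a c}).topologicalClosure := by
  let S : Set (L →L[ℂ] L) := {x | ∃ a ∈ A, ∃ c ∈ C, x = M.op a c}
  let U : NonUnitalStarSubalgebra ℂ (L →L[ℂ] L) :=
    { Submodule.span ℂ S with
      mul_mem' := by
        intro x y hx hy
        change x ∈ Submodule.span ℂ S at hx
        change y ∈ Submodule.span ℂ S at hy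
        change x * y ∈ Submodule.span ℂ S
        induction hx using Submodule.span_induction with
        | mem x hx =>
          obtain ⟨a, ha, c, hc, rfl⟩ := hx
          induction hy using Submodule.span_induction with
          | mem y hy =>
            obtain ⟨a', ha', c', hc', rfl⟩ := hy
            rw [← M.op_mul]
            exact Submodule.subset_span ⟨_, mul_mem ha ha', _, mul_mem hc hc', rfl⟩
          | zero => rw [mul_zero]; exact zero_mem _
          | add u v _ _ hu hv => rw [mul_add]; exact add_mem hu hv
          | smul z u _ hu => rw [mul_smul_comm]; exact Submodule.smul_mem _ z hu
        | zero => rw [zero_mul]; exact zero_mem _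
        | add u v _ _ hu hv => rw [add_mul]; exact add_mem hu hv
        | smul z u _ hu => rw [smul_mul_assoc]; exact Submodule.smul_mem _ z hu
      star_mem' := by
        intro x hx
        change x ∈ Submodule.span ℂ S at hx
        change star x ∈ Submodule.span ℂ S
        induction hx using Submodule.span_induction with
        | mem x hx =>
          obtain ⟨a, ha, c, hc, rfl⟩ := hx
          rw [← M.op_star]
          exact Submodule.subset_span ⟨_, star_mem ha, _, star_mem hc, rfl⟩
        | zero => rw [star_zero]; exact zero_mem _
        | add u v _ _ hu hv => rw [star_add]; exact add_mem hu hv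
        | smul z u _ hu => rw [star_smul]; exact Submodule.smul_mem _ _ hu }
  have h1 : NonUnitalStarAlgebra.adjoin ℂ S ≤ U :=
    NonUnitalStarAlgebra.adjoin_le Submodule.subset_span
  exact closure_mono (s := (NonUnitalStarAlgebra.adjoin ℂ S : Set (L →L[ℂ] L))) h1 hx

variable [IsClosed (A : Set (H →L[ℂ] H))] [IsClosed (C : Set (K →L[ℂ] K))]

/-- The elementary tensor `a ⊗ c`. -/
def pure (a : A) (c : C) : M.alg A C := ⟨M.op a.1 c.1, M.op_mem a.2 c.2⟩

theorem pure_mul (a a' : A) (c c' : C) : M.pure (a * a') (c * c') = M.pure a c * M.pure a' c' :=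
  Subtype.ext (M.op_mul _ _ _ _)

theorem pure_star (a : A) (c : C) : M.pure (star a) (star c) = star (M.pure a c) :=
  Subtype.ext (M.op_star _ _)

theorem norm_pure_le (a : A) (c : C) : ‖M.pure a c‖ ≤ ‖a‖ * ‖c‖ := M.norm_op_le _ _

variable (A C) in
/-- The elementary tensor as a bilinear map. -/
def pureₗ : A →ₗ[ℂ] C →ₗ[ℂ] M.alg A C :=
  LinearMap.mk₂ ℂ M.pure (fun _ _ _ => Subtype.ext (M.op_add_left _ _ _))
    (fun _ _ _ => Subtype.ext (M.op_smul_left _ _ _))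
    (fun _ _ _ => Subtype.ext (M.op_add_right _ _ _))
    (fun _ _ _ => Subtype.ext (M.op_smul_right _ _ _))

theorem pureₗ_apply (a : A) (c : C) : M.pureₗ A C a c = M.pure a c := rfl

/-- Closed linear properties of elements of `D ⊗ E` can be checked on elementary tensors. -/
theorem induction (hD : D ≤ A) (hE : E ≤ C) {p : M.alg A C → Prop} (hp : IsClosed {x | p x})
    (zero : p 0) (add : ∀ x y, p x → p y → p (x + y)) (smul : ∀ (z : ℂ) x, p x → p (z • x))
    (elem : ∀ (a : A) (c : C), (a : H →L[ℂ] H) ∈ D → (c : K →L[ℂ] K) ∈ E → p (M.pure a c)) {x : M.alg A C}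
    (hx : (x : L →L[ℂ] L) ∈ M.alg D E) : p x := by
  have h1 : ∀ y ∈ Submodule.span ℂ {x | ∃ a ∈ D, ∃ c ∈ E, x = M.op a c},
      ∃ h : y ∈ M.alg A C, p ⟨y, h⟩ := by
    intro y hy
    induction hy using Submodule.span_induction with
    | mem y hy =>
      obtain ⟨a, ha, c, hc, rfl⟩ := hy
      exact ⟨M.op_mem (hD ha) (hE hc), elem ⟨a, hD ha⟩ ⟨c, hE hc⟩ ha hc⟩
    | zero => exact ⟨zero_mem _, zero⟩
    | add u v _ _ hu hv =>
      obtain ⟨hu, hpu⟩ := hu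
      obtain ⟨hv, hpv⟩ := hv
      exact ⟨add_mem hu hv, add _ _ hpu hpv⟩
    | smul z u _ hu =>
      obtain ⟨hu, hpu⟩ := hu
      exact ⟨SMulMemClass.smul_mem z hu, smul z _ hpu⟩
  have h2 : x ∈ closure {x | p x} := by
    rw [Metric.mem_closure_iff]
    intro ε hε
    obtain ⟨y, hy, hxy⟩ := Metric.mem_closure_iff.1 (M.mem_closure_span hx) ε hε
    obtain ⟨hy, hpy⟩ := h1 y hy
    exact ⟨⟨y, hy⟩, hpy, hxy⟩
  rwa [hp.closure_eq] at h2

end TensorModel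

end TensorModel

end GenDiag
end

noncomputable section

namespace GenDiag

open scoped InnerProductSpace

/-! ### Tensor products of direct sums of matrix algebras -/

section BlockTensor

variable {J J' : Type} {R : J → Type} {R' : J' → Type} [Fintype J] [Fintype J']
  [∀ j, Fintype (R j)] [∀ j, Fintype (R' j)]
variable {B : Type*} [NonUnitalCStarAlgebra B] [PartialOrder B] [StarOrderedRing B]

/-- The direct sum of the matrix algebras indexed by the products of the index sets. -/
abbrev BlockProd (R : J → Type) (R' : J' → Type) (B : Type*) : Type _ :=
  BlockSum (fun p : J × J' => R p.1 × R' p.2) B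

/-- The tensor product of elements of direct sums of matrix algebras. -/
def blockTensor : BlockSum R ℂ →ₗ[ℂ] BlockSum R' B →ₗ[ℂ] BlockProd R R' B :=
  LinearMap.mk₂ ℂ (fun a y p => mkMat fun k l => a p.1 k.1 l.1 • y p.2 k.2 l.2)
    (fun a a' y => by ext p k l; exact add_smul _ _ _)
    (fun z a y => by ext p k l; exact smul_assoc z (a p.1 k.1 l.1) _)
    (fun a y y' => by ext p k l; exact smul_add _ _ _)
    (fun z a y => by ext p k l; exact smul_comm (a p.1 k.1 l.1) z _)

theorem blockTensor_apply (a : BlockSum R ℂ) (y : BlockSum R' B) (p : J × J') (k l) :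
    blockTensor a y p k l = a p.1 k.1 l.1 • y p.2 k.2 l.2 := rfl

theorem blockTensor_mul (a a' : BlockSum R ℂ) (y y' : BlockSum R' B) :
    blockTensor (a * a') (y * y') = blockTensor a y * blockTensor a' y' := by
  ext p k l
  simp only [blockTensor_apply, Pi.mul_apply, CStarMatrix.mul_apply, Fintype.sum_prod_type,
    Finset.sum_smul_sum, smul_mul_smul_comm]

theorem blockTensor_star (a : BlockSum R ℂ) (y : BlockSum R' B) :
    blockTensor (star a) (star y) = star (blockTensor a y) := by
  ext p k l
  simp only [blockTensor_apply, Pi.star_apply, CStarMatrix.star_apply, star_smul]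

/-- The coefficient of the matrix unit `e_{kl}` of block `j`. -/
def blockPart (j : J) (k l : R j) : BlockProd R R' B →ₗ[ℂ] BlockSum R' B where
  toFun z := fun j' => mkMat fun k' l' => z (j, j') (k, k') (l, l')
  map_add' _ _ := rfl
  map_smul' _ _ := rfl

theorem blockPart_apply (j : J) (k l : R j) (z : BlockProd R R' B) (j' : J') (k' l' : R' j') :
    blockPart j k l z j' k' l' = z (j, j') (k, k') (l, l') := rfl

theorem blockPart_blockTensor (j : J) (k l : R j) (a : BlockSum R ℂ) (y : BlockSum R' B) :
    blockPart j k l (blockTensor a y) = a j k l • y := rfl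

theorem blockPart_mul (j : J) (k l : R j) (z w : BlockProd R R' B) :
    blockPart j k l (z * w) = ∑ q, blockPart j k q z * blockPart j q l w := by
  ext j' k' l'
  simp only [blockPart_apply, Finset.sum_apply, sum_matrix_apply, Pi.mul_apply,
    CStarMatrix.mul_apply, Fintype.sum_prod_type]

theorem suppIn_blockPart {P' : Set J'} {P : Set J} {z : BlockProd R R' B}
    (hz : SuppIn (P ×ˢ P') z) (j : J) (k l : R j) : SuppIn P' (blockPart j k l z) := by
  intro j' hj'
  ext k' l'
  rw [blockPart_apply, hz (j, j') fun h => hj' h.2]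
  rfl

theorem blockPart_eq_zero {P' : Set J'} {P : Set J} {z : BlockProd R R' B}
    (hz : SuppIn (P ×ˢ P') z) {j : J} (hj : j ∉ P) (k l : R j) : blockPart j k l z = 0 := by
  ext j' k' l'
  rw [blockPart_apply, hz (j, j') fun h => hj h.1]
  rfl

theorem suppIn_blockTensor {P' : Set J'} {P : Set J} {a : BlockSum R ℂ} {y : BlockSum R' B}
    (ha : SuppIn P a) (hy : SuppIn P' y) : SuppIn (P ×ˢ P') (blockTensor a y) := by
  intro p hp
  ext k l
  rw [blockTensor_apply]
  by_cases h : p.1 ∈ P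
  · rw [hy p.2 fun h' => hp ⟨h, h'⟩]
    exact smul_zero _
  · rw [ha p.1 h]
    exact zero_smul _ _

section Units

variable [DecidableEq J] [DecidableEq J'] [∀ j, DecidableEq (R j)] [∀ j, DecidableEq (R' j)]

theorem blockTensor_blockUnit (j : J) (k l : R j) (a : ℂ) (j' : J') (k' l' : R' j') (b : B) :
    blockTensor (blockUnit j k l a : BlockSum R ℂ) (blockUnit j' k' l' b : BlockSum R' B) =
      blockUnit (R := fun p : J × J' => R p.1 × R' p.2) (j, j') (k, k') (l, l') (a • b) := by
  ext ⟨i, i'⟩ ⟨p, p'⟩ ⟨q, q'⟩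
  rw [blockTensor_apply]
  dsimp only
  rcases eq_or_ne i j with rfl | hi
  · rcases eq_or_ne i' j' with rfl | hi'
    · rw [blockUnit_self, blockUnit_self]
      refine Eq.trans ?_ (blockUnit_self (R := fun p : J × J' => R p.1 × R' p.2) _ _ _ _ _ _).symm
      by_cases h1 : k = p <;> by_cases h2 : l = q <;> by_cases h3 : k' = p' <;>
        by_cases h4 : l' = q' <;> simp [h1, h2, h3, h4]
    · have h : (i, i') ≠ (i, j') := fun h => hi' (congrArg Prod.snd h)
      rw [blockUnit_of_ne hi',
        blockUnit_of_ne (R := fun p : J × J' => R p.1 × R' p.2) h (k, k') (l, l')]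
      exact smul_zero _
  · have h : (i, i') ≠ (j, j') := fun h => hi (congrArg Prod.fst h)
    rw [blockUnit_of_ne hi,
      blockUnit_of_ne (R := fun p : J × J' => R p.1 × R' p.2) h (k, k') (l, l')]
    exact zero_smul _ _

theorem sum_blockTensor (z : BlockProd R R' B) :
    ∑ j, ∑ k : R j, ∑ l : R j, blockTensor (blockUnit j k l (1 : ℂ)) (blockPart j k l z) = z := by
  ext ⟨i, i'⟩ ⟨p, p'⟩ ⟨q, q'⟩
  simp only [Finset.sum_apply, sum_matrix_apply, blockTensor_apply]
  rw [Finset.sum_eq_single i, Finset.sum_eq_single p, Finset.sum_eq_single q]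
  · rw [blockUnit_self]
    simp [blockPart_apply]
  · intro l _ hl
    rw [blockUnit_self]
    simp [hl]
  · simp
  · intro k _ hk
    refine Finset.sum_eq_zero fun l _ => ?_
    rw [blockUnit_self]
    simp [hk]
  · simp
  · intro j _ hj
    refine Finset.sum_eq_zero fun k _ => Finset.sum_eq_zero fun l _ => ?_
    rw [blockUnit_of_ne hj.symm]
    exact zero_smul _ _
  · simp

theorem sum_blockUnit (x : BlockSum R ℂ) :
    ∑ j, ∑ k : R j, ∑ l : R j, x j k l • blockUnit j k l (1 : ℂ) = x := by
  ext i p q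
  simp only [Finset.sum_apply, sum_matrix_apply, Pi.smul_apply, CStarMatrix.smul_apply]
  rw [Finset.sum_eq_single i, Finset.sum_eq_single p, Finset.sum_eq_single q]
  · rw [blockUnit_self]
    simp
  · intro l _ hl
    rw [blockUnit_self]
    simp [hl]
  · simp
  · intro k _ hk
    refine Finset.sum_eq_zero fun l _ => ?_
    rw [blockUnit_self]
    simp [hk]
  · simp
  · intro j _ hj
    refine Finset.sum_eq_zero fun k _ => Finset.sum_eq_zero fun l _ => ?_
    rw [blockUnit_of_ne hj.symm]
    exact smul_zero _
  · simp

/-- The identity of a sum of blocks. -/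
def blockOne (R : J → Type) [∀ j, DecidableEq (R j)] (P : Set J) : BlockSum R ℂ := by
  classical exact fun j => mkMat fun k l => if j ∈ P ∧ k = l then 1 else 0

theorem blockOne_apply (P : Set J) [DecidablePred (· ∈ P)] (j : J) (k l : R j) :
    blockOne R P j k l = if j ∈ P ∧ k = l then 1 else 0 := by
  rw [blockOne, mkMat_apply]
  congr

theorem suppIn_blockOne (P : Set J) : SuppIn P (blockOne R P) := by
  classical
  intro j hj
  ext k l
  rw [blockOne_apply, if_neg fun h => hj h.1]
  rfl

theorem blockOne_mul {P : Set J} {x : BlockSum R ℂ} (hx : SuppIn P x) : blockOne R P * x = x := by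
  classical
  ext j k l
  rw [Pi.mul_apply, CStarMatrix.mul_apply]
  simp only [blockOne_apply]
  by_cases h : j ∈ P
  · simp [h]
  · simp only [h, false_and, if_false, zero_mul, Finset.sum_const_zero]
    rw [hx j h]; rfl

theorem star_blockOne (P : Set J) : star (blockOne R P) = blockOne R P := by
  classical
  ext j k l
  rw [Pi.star_apply, CStarMatrix.star_apply, blockOne_apply, blockOne_apply, apply_ite star,
    star_one, star_zero]
  simp only [eq_comm]

theorem norm_blockOne_le (P : Set J) : ‖blockOne R P‖ ≤ 1 := by
  have h := CStarRing.norm_star_mul_self (x := blockOne R P)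
  rw [star_blockOne, blockOne_mul (suppIn_blockOne P)] at h
  nlinarith [norm_nonneg (blockOne R P)]

end Units

variable [DecidableEq J] [∀ j, DecidableEq (R j)]

variable (R) in
/-- Tensoring with the identity of a sum of blocks. -/
def oneTensorHom (P : Set J) : BlockSum R' B →⋆ₙₐ[ℂ] BlockProd R R' B where
  toFun y := blockTensor (blockOne R P) y
  map_smul' z y := map_smul _ z y
  map_zero' := map_zero _
  map_add' y y' := map_add _ y y'
  map_mul' y y' := by rw [← blockTensor_mul, blockOne_mul (suppIn_blockOne P)]
  map_star' y := by rw [← blockTensor_star, star_blockOne]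

/-- For fixed y the map a ↦ a ⊗ y^*y is completely positive on a unital algebra, so its norm is
attained at the unit, where 1 ⊗ y^*y is the image of y^*y under a *-homomorphism. -/
theorem norm_blockTensor_star_mul_le (a : BlockSum R ℂ) (y : BlockSum R' B) :
    ‖blockTensor a (star y * y)‖ ≤ ‖a‖ * ‖y‖ ^ 2 := by
  have hcp : IsCP (blockTensor.flip (star y * y) : BlockSum R ℂ →ₗ[ℂ] BlockProd R R' B) :=
    isCP_of_isGram fun n _ x => (isGram_star_mul x).map₂ (isGram_star_mul fun _ : n => y)
      blockTensor (fun _ _ _ _ => blockTensor_mul _ _ _ _) blockTensor_star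
  have h1 : ‖blockTensor (blockOne R Set.univ) (star y * y)‖ ≤ ‖y‖ ^ 2 := by
    refine (isContractive_starHom (oneTensorHom R Set.univ) (star y * y)).trans ?_
    rw [CStarRing.norm_star_mul_self, sq]
  obtain ⟨c, -, hc⟩ := hcp.exists_bound
  have h2 := le_of_sq_le (f := fun a => ‖blockTensor a (star y * y)‖)
    (c := ‖blockTensor (blockOne R Set.univ) (star y * y)‖) (fun _ => norm_nonneg _)
    (norm_nonneg _) (fun x => ?_) hc a
  · refine h2.trans ?_
    rw [mul_comm]
    gcongr
  · have h3 := hcp.norm_map_mul_sq_le (blockOne R Set.univ) x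
    rw [star_blockOne, blockOne_mul (suppIn_blockOne _),
      blockOne_mul (x := x) fun j hj => absurd (Set.mem_univ j) hj] at h3
    exact h3

end BlockTensor

end GenDiag
end

noncomputable section

namespace GenDiag

open scoped InnerProductSpace

section Gram

variable {X : Type*} [NonUnitalCStarAlgebra X]

theorem IsGram.collapse_sigma {n : Type} {κ : n → Type} [∀ i, Fintype (κ i)]
    {M : (Σ i, κ i) → (Σ i, κ i) → X} (h : IsGram M) :
    IsGram fun i j => ∑ a, ∑ b, M ⟨i, a⟩ ⟨j, b⟩ := by
  obtain ⟨ι, _, R, hR⟩ := h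
  refine ⟨ι, inferInstance, fun k i => ∑ a, R k ⟨i, a⟩, fun i j => ?_⟩
  have h1 : ∀ k, star (∑ a, R k ⟨i, a⟩) * ∑ b, R k ⟨j, b⟩ =
      ∑ a, ∑ b, star (R k ⟨i, a⟩) * R k ⟨j, b⟩ := fun k => by
    rw [star_sum, Finset.sum_mul_sum]
  simp only [hR, h1]
  exact ((Finset.sum_congr rfl fun a _ => Finset.sum_comm).trans Finset.sum_comm)

theorem IsGram.eval {n ι : Type} [Fintype ι] {Y : ι → Type*} [∀ i, NonUnitalCStarAlgebra (Y i)]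
    {M : n → n → ∀ i, Y i} (h : IsGram M) (a : ι) : IsGram fun i j => M i j a := by
  obtain ⟨κ, _, R, hR⟩ := h
  refine ⟨κ, inferInstance, fun k i => R k i a, fun i j => ?_⟩
  exact (congrFun (hR i j) a).trans (Finset.sum_apply a _ _)

end Gram

/-! ### Slice maps on the spatial tensor product -/

namespace TensorModel

variable {H K L : Type*} [NormedAddCommGroup H] [InnerProductSpace ℂ H] [CompleteSpace H]
  [NormedAddCommGroup K] [InnerProductSpace ℂ K] [CompleteSpace K]
  [NormedAddCommGroup L] [InnerProductSpace ℂ L] [CompleteSpace L]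
variable (M : TensorModel H K L)
variable {A D : NonUnitalStarSubalgebra ℂ (H →L[ℂ] H)}
  {C E : NonUnitalStarSubalgebra ℂ (K →L[ℂ] K)}
  [IsClosed (A : Set (H →L[ℂ] H))] [IsClosed (C : Set (K →L[ℂ] K))]

variable (A C) in
/-- The span of the elementary tensors. -/
def algSpan : Submodule ℂ (M.alg A C) := Submodule.span ℂ {x | ∃ a c, x = M.pure a c}

theorem mem_closure_algSpan (x : M.alg A C) : x ∈ (M.algSpan A C).topologicalClosure :=
  M.induction le_rfl le_rfl (p := fun x => x ∈ (M.algSpan A C).topologicalClosure)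
    (Submodule.isClosed_topologicalClosure _) (zero_mem _) (fun _ _ => add_mem)
    (fun z _ => Submodule.smul_mem _ z)
    (fun a c _ _ => Submodule.le_topologicalClosure _ (Submodule.subset_span ⟨a, c, rfl⟩)) x.2

theorem exists_eq_sum {x : M.alg A C} (hx : x ∈ M.algSpan A C) :
    ∃ (n : ℕ) (a : Fin n → A) (c : Fin n → C), x = ∑ p, M.pure (a p) (c p) := by
  obtain ⟨n, f, g, rfl⟩ := Submodule.mem_span_set'.1 hx
  choose a c hac using fun p => (g p).2
  refine ⟨n, fun p => f p • a p, c, Finset.sum_congr rfl fun p _ => ?_⟩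
  rw [hac]
  exact Subtype.ext (M.op_smul_left _ _ _).symm

variable (A C) in
/-- The map from the free vector space onto the algebraic tensor product. -/
def ofFree : (A × C →₀ ℂ) →ₗ[ℂ] M.alg A C :=
  Finsupp.linearCombination ℂ fun p : A × C => M.pure p.1 p.2

variable (A C) in
/-- The matrix coefficients with respect to two vectors of the second space. -/
def freeCoeff (ζ' ζ : K) : (A × C →₀ ℂ) →ₗ[ℂ] A :=
  Finsupp.linearCombination ℂ fun p : A × C => ⟪ζ', p.2.1 ζ⟫_ℂ • p.1

variable (C) in
/-- The slice map on the free vector space. -/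
def freeSlice (ω : A →L[ℂ] ℂ) : (A × C →₀ ℂ) →ₗ[ℂ] C :=
  Finsupp.linearCombination ℂ fun p : A × C => ω p.1 • p.2

/-- The coefficient compresses the operator between the copies H ⊗ ζ and H ⊗ ζ' of H. It therefore
depends only on the operator represented by z and is bounded by its norm, which is what makes slices
well defined. -/
theorem freeCoeff_eq (ζ' ζ : K) (z : A × C →₀ ℂ) :
    (freeCoeff A C ζ' ζ z).1 =
      ContinuousLinearMap.adjoint (M.tLeft ζ') ∘L (M.ofFree A C z).1 ∘L M.tLeft ζ := by
  induction z using Finsupp.induction_linear with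
  | zero =>
    rw [map_zero, map_zero]
    refine ContinuousLinearMap.ext fun ξ => ?_
    change (0 : H) = ContinuousLinearMap.adjoint (M.tLeft ζ') 0
    rw [map_zero]
  | add u v hu hv =>
    rw [map_add, map_add]
    refine (congrArg₂ (· + ·) hu hv).trans (ContinuousLinearMap.ext fun ξ => ?_)
    exact (map_add (ContinuousLinearMap.adjoint (M.tLeft ζ')) _ _).symm
  | single p w =>
    rw [ofFree, freeCoeff, Finsupp.linearCombination_single, Finsupp.linearCombination_single]
    refine ContinuousLinearMap.ext fun ξ => ext_inner_left ℂ fun ξ' => ?_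
    change ⟪ξ', w • ⟪ζ', p.2.1 ζ⟫_ℂ • p.1.1 ξ⟫_ℂ = ⟪ξ', ContinuousLinearMap.adjoint (M.tLeft ζ')
      (w • M.op p.1.1 p.2.1 (M.t ξ ζ))⟫_ℂ
    rw [ContinuousLinearMap.adjoint_inner_right, tLeft_apply, M.op_t, inner_smul_right,
      inner_smul_right, inner_smul_right, M.inner_t, mul_comm ⟪ζ', p.2.1 ζ⟫_ℂ]

theorem norm_freeCoeff_le (ζ' ζ : K) (z : A × C →₀ ℂ) :
    ‖freeCoeff A C ζ' ζ z‖ ≤ ‖ζ'‖ * (‖M.ofFree A C z‖ * ‖ζ‖) := by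
  change ‖(freeCoeff A C ζ' ζ z).1‖ ≤ _
  rw [M.freeCoeff_eq]
  refine (ContinuousLinearMap.opNorm_comp_le _ _).trans (mul_le_mul ?_ ?_ (norm_nonneg _)
    (norm_nonneg _))
  · exact (LinearIsometryEquiv.norm_map ContinuousLinearMap.adjoint (M.tLeft ζ')).trans_le
      (M.norm_tLeft_le ζ')
  · exact (ContinuousLinearMap.opNorm_comp_le _ _).trans
      (mul_le_mul_of_nonneg_left (M.norm_tLeft_le ζ) (norm_nonneg _))

theorem inner_freeSlice (ω : A →L[ℂ] ℂ) (ζ' ζ : K) (z : A × C →₀ ℂ) :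
    ⟪ζ', (freeSlice C ω z).1 ζ⟫_ℂ = ω (freeCoeff A C ζ' ζ z) := by
  induction z using Finsupp.induction_linear with
  | zero =>
    rw [map_zero, map_zero, map_zero]
    exact inner_zero_right _
  | add u v hu hv =>
    rw [map_add, map_add, map_add, ← hu, ← hv, ← inner_add_right]; rfl
  | single p w =>
    rw [freeSlice, freeCoeff, Finsupp.linearCombination_single, Finsupp.linearCombination_single]
    change ⟪ζ', w • ω p.1 • p.2.1 ζ⟫_ℂ = _
    rw [inner_smul_right, inner_smul_right, map_smul, map_smul, smul_eq_mul, smul_eq_mul,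
      mul_comm (ω p.1)]

/-- Apply ω to the matrix coefficients with ζ' chosen as the vector S(z)ζ itself, where S(z) is the
slice, and cancel one factor ‖S(z)ζ‖. For an arbitrary bounded functional this replaces a
representation of ω by vectors. -/
theorem norm_freeSlice_le (ω : A →L[ℂ] ℂ) (z : A × C →₀ ℂ) :
    ‖freeSlice C ω z‖ ≤ ‖ω‖ * ‖M.ofFree A C z‖ := by
  refine ContinuousLinearMap.opNorm_le_bound (freeSlice C ω z).1 (by positivity) fun ζ => ?_
  have h : ‖(freeSlice C ω z).1 ζ‖ * ‖(freeSlice C ω z).1 ζ‖ ≤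
      ‖ω‖ * (‖(freeSlice C ω z).1 ζ‖ * (‖M.ofFree A C z‖ * ‖ζ‖)) := by
    rw [← inner_self_eq_norm_mul_norm (𝕜 := ℂ), inner_freeSlice]
    exact (RCLike.re_le_norm _).trans <| (ω.le_opNorm _).trans
      (mul_le_mul_of_nonneg_left (M.norm_freeCoeff_le _ _ _) (norm_nonneg _))
  rcases (norm_nonneg ((freeSlice C ω z).1 ζ)).eq_or_lt with h5 | h5
  · rw [← h5]; positivity
  · refine le_of_mul_le_mul_right (h.trans_eq ?_) h5
    ring

/-- Slice maps. -/
theorem exists_slice (ω : A →L[ℂ] ℂ) :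
    ∃ S : M.alg A C →L[ℂ] C, ∀ a c, S (M.pure a c) = ω a • c := by
  have hd : DenseRange (M.ofFree A C) := fun x => by
    refine closure_mono ?_ (M.mem_closure_algSpan x)
    have h : M.algSpan A C ≤ LinearMap.range (M.ofFree A C) := by
      refine Submodule.span_le.2 ?_
      rintro _ ⟨a, c, rfl⟩
      exact ⟨Finsupp.single (a, c) 1,
        by rw [ofFree, Finsupp.linearCombination_single, one_smul]⟩
    exact h
  -- The norm bound shows both that the slice factors through the algebraic tensor product and that
  -- it extends to the closure.
  refine ⟨(freeSlice C ω).extendOfNorm (M.ofFree A C), fun a c => ?_⟩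
  have h := LinearMap.extendOfNorm_eq hd ⟨‖ω‖, M.norm_freeSlice_le ω⟩ (Finsupp.single (a, c) 1)
  rw [ofFree, freeSlice, Finsupp.linearCombination_single, Finsupp.linearCombination_single,
    one_smul, one_smul] at h
  exact h

/-- The slice map of a bounded functional on the first factor. -/
def slice (ω : A →L[ℂ] ℂ) : M.alg A C →L[ℂ] C := (M.exists_slice ω).choose

theorem slice_pure (ω : A →L[ℂ] ℂ) (a : A) (c : C) : M.slice ω (M.pure a c) = ω a • c :=
  (M.exists_slice ω).choose_spec a c

end TensorModel

end GenDiag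
end

noncomputable section

namespace GenDiag

open scoped InnerProductSpace

theorem norm_mul_star_le_one {X : Type*} [NonUnitalCStarAlgebra X] {u : X} (hu : ‖u‖ ≤ 1) :
    ‖u * star u‖ ≤ 1 := by
  rw [CStarRing.norm_self_mul_star]
  exact mul_le_one₀ hu (norm_nonneg _) hu

/-! ### The tensor product of the downward maps -/

namespace TensorModel

variable {H K L : Type*} [NormedAddCommGroup H] [InnerProductSpace ℂ H] [CompleteSpace H]
  [NormedAddCommGroup K] [InnerProductSpace ℂ K] [CompleteSpace K]
  [NormedAddCommGroup L] [InnerProductSpace ℂ L] [CompleteSpace L]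
variable (M : TensorModel H K L)
variable {A D : NonUnitalStarSubalgebra ℂ (H →L[ℂ] H)}
  {C E : NonUnitalStarSubalgebra ℂ (K →L[ℂ] K)}
  [IsClosed (A : Set (H →L[ℂ] H))] [IsClosed (C : Set (K →L[ℂ] K))]
variable {J J' : Type} {R : J → Type} {R' : J' → Type} [Fintype J] [Fintype J']
  [∀ j, Fintype (R j)] [∀ j, Fintype (R' j)]
variable {B : Type*} [NonUnitalCStarAlgebra B] [PartialOrder B] [StarOrderedRing B]
variable {ψ : A →ₗ[ℂ] BlockSum R ℂ} {ψ' : C →ₗ[ℂ] BlockSum R' B}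

/-- The matrix coefficients of a completely positive map. -/
def coeff (hψ : IsCP ψ) (j : J) (k l : R j) : A →L[ℂ] ℂ where
  toFun a := ψ a j k l
  map_add' a b := by rw [map_add]; rfl
  map_smul' z a := by rw [map_smul]; rfl
  cont := ((continuous_apply l).comp ((continuous_apply k).comp ((continuous_apply j).comp
    hψ.continuous)))

theorem slice_star_sum_mul_sum (ω : A →L[ℂ] ℂ) {n m : Type} [Fintype n] [Fintype m]
    (a : n → A) (c : n → C) (b : m → A) (d : m → C) :
    M.slice ω (star (∑ s, M.pure (a s) (c s)) * ∑ t, M.pure (b t) (d t)) =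
      ∑ s, ∑ t, ω (star (a s) * b t) • (star (c s) * d t) := by
  simp only [star_sum, Finset.sum_mul_sum, map_sum, ← pure_star, ← pure_mul, slice_pure]

/-- This is positivity of (ψ ⊗ id)(x_p^* x_q) block by block. For x = Σ a_s ⊗ c_s the entries are
sums of ψ(a_s^* a_t)_kl · c_s^* c_t, that is, a Schur product of two Gram matrices, collapsed over
the summation indices s and t. -/
theorem isGram_slice_of_mem_algSpan (hψ : IsCP ψ) (j : J) {n : Type} [Fintype n]
    {x : n → M.alg A C} (hx : ∀ i, x i ∈ M.algSpan A C) :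
    IsGram fun p q : n × R j => M.slice (coeff hψ j p.2 q.2) (star (x p.1) * x q.1) := by
  choose N a c hac using fun i => M.exists_eq_sum (hx i)
  have h1 := ((hψ.isGram (isGram_star_mul fun s : Σ i, Fin (N i) => a s.1 s.2)).eval j).ofMatrix
  have h2 := h1.map₂ (isGram_star_mul fun s : (Σ i, Fin (N i)) × R j => c s.1.1 s.1.2)
    (LinearMap.lsmul ℂ C) (fun z x z' x' => (smul_mul_smul_comm z x z' x').symm)
    (fun z x => (star_smul z x).symm)
  have h3 := (h2.comp fun s : Σ p : n × R j, Fin (N p.1) =>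
    ((⟨s.1.1, s.2⟩ : Σ i, Fin (N i)), s.1.2)).collapse_sigma
  refine h3.congr fun p q => ?_
  rw [hac p.1, hac q.1, slice_star_sum_mul_sum]
  rfl

/-- Approximate each x_i by elements of the algebraic tensor product; slices are continuous and
limits of Gram matrices are Gram matrices. -/
theorem isGram_slice (hψ : IsCP ψ) (j : J) {n : Type} [Fintype n] (x : n → M.alg A C) :
    IsGram fun p q : n × R j => M.slice (coeff hψ j p.2 q.2) (star (x p.1) * x q.1) := by
  let _ := CStarAlgebra.spectralOrder C
  have _ := CStarAlgebra.spectralOrderedRing (A := C)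
  choose y hy hyx using fun i => mem_closure_iff_seq_limit.1 (M.mem_closure_algSpan (x i))
  refine IsGram.of_tendsto (l := atTop) (Eventually.of_forall fun m : ℕ =>
    M.isGram_slice_of_mem_algSpan hψ j (x := fun i => y i m) fun i => hy i m) fun p q => ?_
  exact ((M.slice _).continuous.tendsto _).comp ((hyx p.1).star.mul (hyx q.1))

/-- The tensor product of two maps into direct sums of matrix algebras. -/
def down (hψ : IsCP ψ) (ψ' : C →ₗ[ℂ] BlockSum R' B) : M.alg A C →ₗ[ℂ] BlockProd R R' B where
  toFun x p := mkMat fun k l => ψ' (M.slice (coeff hψ p.1 k.1 l.1) x) p.2 k.2 l.2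
  map_add' x y := by ext p k l; simp only [map_add]; rfl
  map_smul' z x := by ext p k l; simp only [map_smul]; rfl

theorem down_pure (hψ : IsCP ψ) (a : A) (c : C) :
    M.down hψ ψ' (M.pure a c) = blockTensor (ψ a) (ψ' c) := by
  ext p k l
  change ψ' (M.slice (coeff hψ p.1 k.1 l.1) (M.pure a c)) p.2 k.2 l.2 = _
  rw [slice_pure, map_smul]
  rfl

/-- The map is the composition of ψ ⊗ id, positive by `isGram_slice`, with ψ' applied entrywise; the
two matrix indices are then merged into one. -/
theorem isCP_down (hψ : IsCP ψ) (hψ' : IsCP ψ') : IsCP (M.down hψ ψ') := by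
  refine isCP_of_isGram fun n _ x => isGram_pi fun p => ?_
  have h1 := (((hψ'.isGram (M.isGram_slice hψ p.1 x)).eval p.2).ofMatrix).comp
    fun s : n × (R p.1 × R' p.2) => ((s.1, s.2.1), s.2.2)
  exact h1.toMatrix

/-- On elementary tensors this is joint continuity of the tensor product; the uniform bound ‖u ⊗ u'‖
≤ 1 extends it to the closure. -/
theorem tendsto_pure_mul {l : Filter A} {l' : Filter C}
    (h : ∀ a, Tendsto (fun u => u * a) l (𝓝 a)) (h' : ∀ c, Tendsto (fun u => u * c) l' (𝓝 c))
    (h1 : ∀ᶠ u in l, ‖u‖ ≤ 1) (h1' : ∀ᶠ u in l', ‖u‖ ≤ 1) (x : M.alg A C) :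
    Tendsto (fun u : A × C => M.pure u.1 u.2 * x) (l ×ˢ l') (𝓝 x) := by
  have hpure : ∀ (a : A) (c : C),
      Tendsto (fun u : A × C => M.pure (u.1 * a) (u.2 * c)) (l ×ˢ l') (𝓝 (M.pure a c)) := by
    intro a c
    have hb : Continuous fun p : A × C => M.pure p.1 p.2 := by
      have := ((M.pureₗ A C).mkContinuous₂ 1 fun a c => by
        rw [one_mul]; exact M.norm_pure_le a c).continuous₂
      exact this
    exact (hb.tendsto (a, c)).comp
      (((h a).comp tendsto_fst).prodMk_nhds ((h' c).comp tendsto_snd))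
  refine tendsto_apply_of_topologicalClosure
    (f := fun u : A × C => ContinuousLinearMap.mul ℂ (M.alg A C) (M.pure u.1 u.2))
    (T := ContinuousLinearMap.id ℂ _) ?_ (L := M.algSpan A C) ?_ (M.mem_closure_algSpan x)
  · filter_upwards [tendsto_fst.eventually h1, tendsto_snd.eventually h1'] with u hu hu'
    refine (ContinuousLinearMap.opNorm_mul_apply_le ℂ _ _).trans ((M.norm_pure_le _ _).trans ?_)
    exact mul_le_one₀ hu (norm_nonneg _) hu'
  · intro y hy
    induction hy using Submodule.span_induction with
    | mem y hy =>
      obtain ⟨a, c, rfl⟩ := hy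
      refine (hpure a c).congr fun u => ?_
      exact M.pure_mul _ _ _ _
    | zero => simpa using tendsto_const_nhds
    | add u v _ _ hu hv => simpa only [map_add] using hu.add hv
    | smul z u _ hu => simpa only [map_smul] using hu.const_smul z

/-- It suffices to test on (u ⊗ u')(u ⊗ u')^*, whose image ψ(uu^*) ⊗ ψ'(u'u'^*) is an elementary
tensor with positive second factor, so that `norm_blockTensor_star_mul_le` applies. -/
theorem isContractive_down (hψ : IsCP ψ) (hψ' : IsCP ψ') (h : IsContractive ψ)
    (h' : IsContractive ψ') : IsContractive (M.down hψ ψ') := by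
  obtain ⟨l, hl, hl1, -, hl2, -⟩ := exists_approximateUnit A
  obtain ⟨l', hl', hl1', -, hl2', -⟩ := exists_approximateUnit C
  refine (M.isCP_down hψ hψ').isContractive (M.tendsto_pure_mul hl1 hl1' hl2 hl2') ?_
  filter_upwards [tendsto_fst.eventually hl2, tendsto_snd.eventually hl2'] with u hu hu'
  have e : u.2 * star u.2 = star (star u.2) * star u.2 := by rw [star_star]
  obtain ⟨y, hy⟩ : ∃ y, ψ' (u.2 * star u.2) = star y * y := by
    obtain ⟨y, hy⟩ := hψ'.exists_eq_star_mul_self (star u.2)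
    exact ⟨y, by rw [e, hy]⟩
  rw [← M.pure_star, ← M.pure_mul, down_pure, hy]
  have n1 : ‖ψ (u.1 * star u.1)‖ ≤ 1 := (h _).trans (norm_mul_star_le_one hu)
  have n2 : ‖y‖ ^ 2 ≤ 1 := by
    rw [sq, ← CStarRing.norm_star_mul_self, ← hy]
    exact (h' _).trans (norm_mul_star_le_one hu')
  classical
  exact (norm_blockTensor_star_mul_le _ _).trans (mul_le_one₀ n1 (by positivity) n2)

theorem isDiag_blockTensor {x : BlockSum R ℂ} {y : BlockSum R' B} (hx : IsDiag x)
    (hy : IsDiag y) : IsDiag (blockTensor x y) := by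
  intro p k l hkl
  rw [blockTensor_apply]
  by_cases h : k.1 = l.1
  · rw [hy p.2 k.2 l.2 fun h' => hkl (Prod.ext h h'), smul_zero]
  · rw [hx p.1 k.1 l.1 h, zero_smul]

theorem isDiag_down (hψ : IsCP ψ) (hψ' : IsCP ψ') (hD : D ≤ A) (hE : E ≤ C)
    (h : ∀ a : A, (a : H →L[ℂ] H) ∈ D → IsDiag (ψ a))
    (h' : ∀ c : C, (c : K →L[ℂ] K) ∈ E → IsDiag (ψ' c)) {x : M.alg A C}
    (hx : (x : L →L[ℂ] L) ∈ M.alg D E) : IsDiag (M.down hψ ψ' x) := by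
  intro p k l hkl
  have hc : Continuous fun x => M.down hψ ψ' x p k l :=
    (continuous_apply l).comp ((continuous_apply k).comp ((continuous_apply p).comp
      (M.isCP_down hψ hψ').continuous))
  refine M.induction hD hE (p := fun x => M.down hψ ψ' x p k l = 0)
    (isClosed_eq hc continuous_const) (by rw [map_zero]; rfl) (fun x y hx hy => ?_)
    (fun z x hx => ?_) (fun a c ha hc => ?_) hx
  · rw [map_add]
    exact (congrArg₂ (· + ·) hx hy).trans (add_zero _)
  · rw [map_smul]
    exact (congrArg (z • ·) hx).trans (smul_zero _)
  · rw [down_pure]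
    exact isDiag_blockTensor (h a ha) (h' c hc) p k l hkl

end TensorModel

end GenDiag
end

noncomputable section

namespace GenDiag

open scoped InnerProductSpace

/-! ### Block supports and elementary tensors -/

section Blocks

variable {J J' : Type} {R : J → Type} {R' : J' → Type} [Fintype J] [Fintype J']
  [∀ j, Fintype (R j)] [∀ j, Fintype (R' j)]
variable {B : Type*} [NonUnitalCStarAlgebra B] [PartialOrder B] [StarOrderedRing B]

/-- The restriction to a set of blocks. -/
def cutHom (R : J → Type) [∀ j, Fintype (R j)] (B : Type*) [NonUnitalCStarAlgebra B]
    [PartialOrder B] [StarOrderedRing B] (P : Set J) [DecidablePred (· ∈ P)] :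
    BlockSum R B →⋆ₙₐ[ℂ] BlockSum R B where
  toFun x j := if j ∈ P then x j else 0
  map_smul' z x := by ext j : 1; by_cases h : j ∈ P <;> simp [h]
  map_zero' := by ext j : 1; simp
  map_add' x y := by ext j : 1; by_cases h : j ∈ P <;> simp [h]
  map_mul' x y := by ext j : 1; by_cases h : j ∈ P <;> simp [h]
  map_star' x := by ext j : 1; by_cases h : j ∈ P <;> simp [h]

theorem suppIn_cutHom (P : Set J) [DecidablePred (· ∈ P)] (x : BlockSum R B) :
    SuppIn P (cutHom R B P x) := fun _ hj => if_neg hj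

theorem cutHom_of_suppIn {P : Set J} [DecidablePred (· ∈ P)] {x : BlockSum R B}
    (hx : SuppIn P x) : cutHom R B P x = x := by
  ext j : 1
  change (if j ∈ P then x j else 0) = x j
  split_ifs with h
  · rfl
  · exact (hx j h).symm

theorem cutHom_blockTensor (P : Set J) (P' : Set J') [DecidablePred (· ∈ P)]
    [DecidablePred (· ∈ P')] [DecidablePred (· ∈ P ×ˢ P')] (a : BlockSum R ℂ) (y : BlockSum R' B) :
    cutHom (fun p : J × J' => R p.1 × R' p.2) B (P ×ˢ P') (blockTensor a y) =
      blockTensor (cutHom R ℂ P a) (cutHom R' B P' y) := by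
  refine funext fun p => ?_
  by_cases hp : p ∈ P ×ˢ P'
  · refine (if_pos hp).trans ?_
    have h1 : cutHom R ℂ P a p.1 = a p.1 := if_pos hp.1
    have h2 : cutHom R' B P' y p.2 = y p.2 := if_pos hp.2
    ext k l
    rw [blockTensor_apply, blockTensor_apply, h1, h2]
  · exact (if_neg hp).trans (suppIn_blockTensor (suppIn_cutHom P a) (suppIn_cutHom P' y) p hp).symm

/-- If the colour is a pair, the two projections of a monochromatic set are monochromatic. So the
hypotheses on the factors apply on a rectangle containing the set. -/
theorem Mono.subset_prod {ι ι' : Type} {c : J → ι} {c' : J' → ι'} {P : Set (J × J')}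
    (hP : Mono (fun p : J × J' => (c p.1, c' p.2)) P) :
    ∃ (Q : Set J) (Q' : Set J'), Mono c Q ∧ Mono c' Q' ∧ P ⊆ Q ×ˢ Q' := by
  refine ⟨Prod.fst '' P, Prod.snd '' P, ?_, ?_, fun p hp => ⟨⟨p, hp, rfl⟩, ⟨p, hp, rfl⟩⟩⟩
  · rintro _ ⟨p, hp, rfl⟩ _ ⟨q, hq, rfl⟩
    exact congrArg Prod.fst (hP p hp q hq)
  · rintro _ ⟨p, hp, rfl⟩ _ ⟨q, hq, rfl⟩
    exact congrArg Prod.snd (hP p hp q hq)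

theorem SuppIn.mono {P Q : Set J} (h : P ⊆ Q) {x : BlockSum R B} (hx : SuppIn P x) : SuppIn Q x :=
  fun j hj => hx j fun h' => hj (h h')

variable [DecidableEq J] [∀ j, DecidableEq (R j)]

/-- For a fixed index k₀, e_kl = (e_{k₀k})^* e_{k₀l}: the matrix of matrix units is a Gram matrix
with a single vector. -/
theorem isGram_blockUnit (j : J) :
    IsGram fun k l : R j => (blockUnit j k l 1 : BlockSum R ℂ) := by
  rcases isEmpty_or_nonempty (R j) with h | ⟨⟨k₀⟩⟩
  · exact ⟨Unit, inferInstance, fun _ _ => 0, fun k => h.elim k⟩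
  · refine ⟨Unit, inferInstance, fun _ k => blockUnit j k₀ k 1, fun k l => ?_⟩
    beta_reduce
    rw [Finset.univ_unique, Finset.sum_singleton]
    ext j' p q
    rw [Pi.mul_apply, Pi.star_apply]
    rcases eq_or_ne j' j with rfl | hj
    · rw [CStarMatrix.mul_apply, Finset.sum_eq_single k₀]
      · rw [CStarMatrix.star_apply, blockUnit_self, blockUnit_self, blockUnit_self]
        by_cases h1 : k = p <;> by_cases h2 : l = q <;> simp [h1, h2]
      · intro i _ hi
        rw [blockUnit_self (k := k₀) (l := l), if_neg fun h => hi h.1.symm, mul_zero]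
      · simp
    · rw [blockUnit_of_ne hj, blockUnit_of_ne hj, blockUnit_of_ne hj, mul_zero]

theorem mem_span_blockTensor {P : Set J} {P' : Set J'} {z : BlockProd R R' B}
    (hz : SuppIn (P ×ˢ P') z) :
    z ∈ Submodule.span ℂ {x | ∃ (a : BlockSum R ℂ) (y : BlockSum R' B), SuppIn P a ∧ SuppIn P' y ∧
      x = blockTensor a y} := by
  classical
  rw [← sum_blockTensor z]
  refine sum_mem fun j _ => sum_mem fun k _ => sum_mem fun l _ => ?_
  by_cases hj : j ∈ P
  · exact Submodule.subset_span ⟨_, _, (suppIn_blockUnit j k l 1).mono (by simpa using hj),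
      suppIn_blockPart hz j k l, rfl⟩
  · rw [blockPart_eq_zero hz hj, map_zero]
    exact zero_mem _

theorem tendsto_oneTensorHom_mul {l : Filter (BlockSum R' B)}
    (hl : ∀ y, Tendsto (fun u => u * y) l (𝓝 y)) (x : BlockProd R R' B) :
    Tendsto (fun u : BlockSum R' B =>
      (oneTensorHom (R' := R') (B := B) R (Set.univ : Set J) u : BlockProd R R' B) * x) l (𝓝 x) := by
  have hx := mem_span_blockTensor (P := Set.univ) (P' := Set.univ) (z := x)
    fun p hp => absurd (Set.mem_univ p) (by simp at hp)
  induction hx using Submodule.span_induction with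
  | mem x hx =>
    obtain ⟨a, y, -, -, rfl⟩ := hx
    have h1 : Continuous (blockTensor a : BlockSum R' B → BlockProd R R' B) :=
      continuous_pi fun p => continuous_pi fun k => continuous_pi fun l => by
        have h2 : Continuous fun y : BlockSum R' B => y p.2 k.2 l.2 :=
          (continuous_apply l.2).comp ((continuous_apply k.2).comp (continuous_apply p.2))
        exact h2.const_smul (a p.1 k.1 l.1)
    refine ((h1.tendsto y).comp (hl y)).congr fun u => ?_
    change _ = blockTensor _ _ * _
    rw [← blockTensor_mul, blockOne_mul fun j hj => absurd (Set.mem_univ j) hj]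
    rfl
  | zero => simpa only [mul_zero] using tendsto_const_nhds
  | add u v _ _ hu hv => simpa only [mul_add] using hu.add hv
  | smul z u _ hu => simpa only [mul_smul_comm] using hu.const_smul z

end Blocks

theorem map_mul_map_mul_of_mem_span {X Y : Type*} [NonUnitalCStarAlgebra X]
    [NonUnitalCStarAlgebra Y] (θ : X →ₗ[ℂ] Y) {S : Set X}
    (h : ∀ x ∈ S, ∀ y ∈ S, ∀ z ∈ S, θ x * θ (y * z) = θ (x * y) * θ z) {x y z : X}
    (hx : x ∈ Submodule.span ℂ S) (hy : y ∈ Submodule.span ℂ S) (hz : z ∈ Submodule.span ℂ S) :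
    θ x * θ (y * z) = θ (x * y) * θ z := by
  induction hx using Submodule.span_induction with
  | mem x hx =>
    induction hy using Submodule.span_induction with
    | mem y hy =>
      induction hz using Submodule.span_induction with
      | mem z hz => exact h x hx y hy z hz
      | zero => rw [mul_zero, map_zero, mul_zero, mul_zero]
      | add u v _ _ hu hv => rw [mul_add, map_add, map_add, mul_add, mul_add, hu, hv]
      | smul w u _ hu => rw [mul_smul_comm, map_smul, map_smul, mul_smul_comm, mul_smul_comm, hu]
    | zero => rw [mul_zero, zero_mul, map_zero, mul_zero, zero_mul]
    | add u v _ _ hu hv => rw [mul_add, add_mul, map_add, map_add, add_mul, mul_add, hu, hv]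
    | smul w u _ hu =>
      rw [mul_smul_comm, smul_mul_assoc, map_smul, map_smul, mul_smul_comm, smul_mul_assoc, hu]
  | zero => rw [zero_mul, map_zero, zero_mul, zero_mul]
  | add u v _ _ hu hv => rw [add_mul, map_add, map_add, add_mul, add_mul, hu, hv]
  | smul w u _ hu => rw [smul_mul_assoc, map_smul, map_smul, smul_mul_assoc, smul_mul_assoc, hu]

/-! ### The tensor product of the upward maps -/

namespace TensorModel

variable {H K L : Type*} [NormedAddCommGroup H] [InnerProductSpace ℂ H] [CompleteSpace H]
  [NormedAddCommGroup K] [InnerProductSpace ℂ K] [CompleteSpace K]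
  [NormedAddCommGroup L] [InnerProductSpace ℂ L] [CompleteSpace L]
variable (M : TensorModel H K L)
variable {A D : NonUnitalStarSubalgebra ℂ (H →L[ℂ] H)}
  {C E : NonUnitalStarSubalgebra ℂ (K →L[ℂ] K)}
  [IsClosed (A : Set (H →L[ℂ] H))] [IsClosed (C : Set (K →L[ℂ] K))]
variable {J J' : Type} {R : J → Type} {R' : J' → Type} [Fintype J] [Fintype J']
  [∀ j, Fintype (R j)] [∀ j, Fintype (R' j)] [DecidableEq J] [∀ j, DecidableEq (R j)]
variable {B : Type*} [NonUnitalCStarAlgebra B] [PartialOrder B] [StarOrderedRing B]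

/-- The tensor product of maps out of direct sums of matrix algebras. -/
def up (φ : BlockSum R ℂ →ₗ[ℂ] A) (φ' : BlockSum R' B →ₗ[ℂ] C) :
    BlockProd R R' B →ₗ[ℂ] M.alg A C :=
  ∑ j, ∑ k : R j, ∑ l : R j, M.pureₗ A C (φ (blockUnit j k l 1)) ∘ₗ φ' ∘ₗ blockPart j k l

variable (φ : BlockSum R ℂ →ₗ[ℂ] A) (φ' : BlockSum R' B →ₗ[ℂ] C)

theorem up_apply (z : BlockProd R R' B) : M.up φ φ' z =
    ∑ j, ∑ k : R j, ∑ l : R j, M.pure (φ (blockUnit j k l 1)) (φ' (blockPart j k l z)) := by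
  simp only [up, LinearMap.sum_apply]
  rfl

theorem up_blockTensor (x : BlockSum R ℂ) (y : BlockSum R' B) :
    M.up φ φ' (blockTensor x y) = M.pure (φ x) (φ' y) := by
  rw [up_apply]
  nth_rewrite 2 [← sum_blockUnit x]
  simp only [← pureₗ_apply, map_sum, map_smul, LinearMap.sum_apply, LinearMap.smul_apply,
    blockPart_blockTensor]

variable {φ φ'}

/-- The (k, l) part of x^*x' is Σ_i (x_ik)^* x'_il, a Gram matrix that φ' preserves, and φ preserves
the Gram matrix (e_kl). Their Schur product under the elementary tensor map, summed over k and l, is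
the matrix in question. -/
theorem isCP_up (hφ : IsCP φ) (hφ' : IsCP φ') : IsCP (M.up φ φ') := by
  refine isCP_of_isGram fun n _ x => ?_
  have h : ∀ j, IsGram fun p q : n × R j => M.pureₗ A C (φ (blockUnit j p.2 q.2 1))
      (φ' (∑ i, star (blockPart j i p.2 (x p.1)) * blockPart j i q.2 (x q.1))) := fun j =>
    ((hφ.isGram (isGram_blockUnit j)).comp Prod.snd).map₂
      (hφ'.isGram (IsGram.sum fun i => isGram_star_mul fun p : n × R j => blockPart j i p.2 (x p.1)))
      (M.pureₗ A C) (fun _ _ _ _ => M.pure_mul _ _ _ _) fun _ _ => M.pure_star _ _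
  refine (IsGram.sum fun j => (h j).collapse).congr fun i i' => ?_
  rw [up_apply]
  refine Finset.sum_congr rfl fun j _ => Finset.sum_congr rfl fun k _ =>
    Finset.sum_congr rfl fun l _ => ?_
  rw [blockPart_mul]
  rfl

/-- The identity is trilinear and multiplicative on elementary tensors, and elements supported in P
× P' are sums of elementary tensors with supports in P and P'. This is the gain over the definition
of order zero, which cannot be tested on elementary tensors. -/
theorem up_mul_up_mul {P : Set J} {P' : Set J'}
    (h : ∀ x y z, SuppIn P x → SuppIn P y → SuppIn P z → φ x * φ (y * z) = φ (x * y) * φ z)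
    (h' : ∀ x y z, SuppIn P' x → SuppIn P' y → SuppIn P' z →
      φ' x * φ' (y * z) = φ' (x * y) * φ' z) {x y z : BlockProd R R' B}
    (h1 : SuppIn (P ×ˢ P') x) (h2 : SuppIn (P ×ˢ P') y) (h3 : SuppIn (P ×ˢ P') z) :
    M.up φ φ' x * M.up φ φ' (y * z) = M.up φ φ' (x * y) * M.up φ φ' z := by
  refine map_mul_map_mul_of_mem_span (M.up φ φ') ?_ (mem_span_blockTensor h1)
    (mem_span_blockTensor h2) (mem_span_blockTensor h3)
  rintro _ ⟨a, b, ha, hb, rfl⟩ _ ⟨a', b', ha', hb', rfl⟩ _ ⟨a'', b'', ha'', hb'', rfl⟩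
  rw [← blockTensor_mul, ← blockTensor_mul, up_blockTensor, up_blockTensor, up_blockTensor,
    up_blockTensor, ← pure_mul, ← pure_mul, h _ _ _ ha ha' ha'', h' _ _ _ hb hb' hb'']

theorem norm_up_le (hφ : IsCP φ) (hφ' : IsCP φ') {P : Set J} {P' : Set J'}
    (h : ∀ x, SuppIn P x → ‖φ x‖ ≤ ‖x‖) (h' : ∀ x, SuppIn P' x → ‖φ' x‖ ≤ ‖x‖)
    {x : BlockProd R R' B} (hx : SuppIn (P ×ˢ P') x) : ‖M.up φ φ' x‖ ≤ ‖x‖ := by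
  classical
  obtain ⟨l, hl, hl1, -, hl2, -⟩ := exists_approximateUnit (BlockSum R' B)
  -- The factors are contractive only on monochromatic supports, so the map is first cut down to P ×
  -- P'. The result is completely positive on the whole algebra and can be tested on 1 ⊗ u.
  have hcp : IsCP (M.up φ φ' ∘ₗ homMap (cutHom (fun p : J × J' => R p.1 × R' p.2) B (P ×ˢ P'))) :=
    (M.isCP_up hφ hφ').comp
      (isCP_starHom (cutHom (fun p : J × J' => R p.1 × R' p.2) B (P ×ˢ P')))
  have hc := hcp.isContractive (u := fun u : BlockSum R' B =>
    (oneTensorHom (R' := R') (B := B) R (Set.univ : Set J) u : BlockProd R R' B))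
    (tendsto_oneTensorHom_mul hl1) (hl2.mono fun u hu => ?_)
  · have := hc x
    change ‖M.up φ φ' (cutHom (fun p : J × J' => R p.1 × R' p.2) B (P ×ˢ P') x)‖ ≤ _ at this
    rwa [cutHom_of_suppIn hx] at this
  · rw [← map_star, ← map_mul]
    change ‖M.up φ φ' (cutHom (fun p : J × J' => R p.1 × R' p.2) B (P ×ˢ P')
      (blockTensor (blockOne R Set.univ) (u * star u)))‖ ≤ 1
    rw [cutHom_blockTensor, up_blockTensor]
    refine (M.norm_pure_le _ _).trans (mul_le_one₀ ?_ (norm_nonneg _) ?_)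
    · exact (h _ (suppIn_cutHom _ _)).trans ((isContractive_starHom _ _).trans
        (norm_blockOne_le _))
    · exact (h' _ (suppIn_cutHom _ _)).trans ((isContractive_starHom _ _).trans
        (norm_mul_star_le_one hu))

end TensorModel

end GenDiag
end

noncomputable section

namespace GenDiag

open scoped InnerProductSpace

/-! ### Normalisers of tensor products by polarisation -/

section Normalisers

variable {H : Type*} [NormedAddCommGroup H] [InnerProductSpace ℂ H] [CompleteSpace H]
  {A D : NonUnitalStarSubalgebra ℂ (H →L[ℂ] H)}

theorem mem_of_polarisation {X : Type*} [AddCommGroup X] [Module ℂ X] {V : Submodule ℂ X} {x y : X}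
    (h1 : x + y ∈ V) (h2 : Complex.I • (x - y) ∈ V) : x ∈ V := by
  have h3 : x - y ∈ V := by
    have := V.smul_mem (-Complex.I) h2
    rwa [smul_smul, neg_mul, Complex.I_mul_I, neg_neg, one_smul] at this
  have h4 : x = (2⁻¹ : ℂ) • ((x + y) + (x - y)) := by
    rw [show x + y + (x - y) = (2 : ℂ) • x by rw [two_smul]; abel, smul_smul]
    norm_num
  rw [h4]
  exact V.smul_mem _ (V.add_mem h1 h3)

theorem add_mul_mul_add_sub {X : Type*} [Ring X] (v w d s t : X) :
    (v + w) * d * (s + t) - v * d * s - w * d * t = v * d * t + w * d * s := by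
  noncomm_ring

theorem add_smul_mul_mul_sub {X : Type*} [Ring X] [Algebra ℂ X] (v w d s t : X) :
    (s + (-Complex.I) • t) * d * (v + Complex.I • w) - s * d * v - t * d * w =
      Complex.I • (s * d * w - t * d * v) := by
  simp only [add_mul, mul_add, smul_mul_assoc, mul_smul_comm]
  match_scalars <;> first | ring1 | linear_combination -Complex.I_mul_I

theorem neg_add_smul_mul_mul_sub {X : Type*} [Ring X] [Algebra ℂ X] (v w d s t : X) :
    -((v + Complex.I • w) * d * (s + (-Complex.I) • t) - v * d * s - w * d * t) =
      Complex.I • (v * d * t - w * d * s) := by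
  simp only [add_mul, mul_add, smul_mul_assoc, mul_smul_comm]
  match_scalars <;> first | ring1 | linear_combination Complex.I_mul_I

/-- Polarisation of the normaliser condition. -/
theorem mul_mul_star_mem {v w d : H →L[ℂ] H} (hv : v ∈ normalisers D A) (hw : w ∈ normalisers D A)
    (h1 : v + w ∈ normalisers D A) (h2 : v + Complex.I • w ∈ normalisers D A) (hd : d ∈ D) :
    v * d * star w ∈ D ∧ star v * d * w ∈ D := by
  have hv' := hv.2 d hd
  have hw' := hw.2 d hd
  have h1' := h1.2 d hd
  have h2' := h2.2 d hd
  have hs : star (v + Complex.I • w) = star v + (-Complex.I) • star w := by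
    rw [star_add, star_smul, Complex.star_def, Complex.conj_I]
  rw [star_add] at h1'
  rw [hs] at h2'
  constructor
  -- Conjugating d by v + w gives vdw^* + wdv^* modulo D, and conjugating by v + iw gives i(vdw^* −
  -- wdv^*) up to sign; together they isolate vdw^*.
  · refine mem_of_polarisation (V := D.toSubmodule) (y := w * d * star v) ?_ ?_
    · rw [← add_mul_mul_add_sub]
      exact sub_mem (sub_mem h1'.1 hv'.1) hw'.1
    · rw [← neg_add_smul_mul_mul_sub]
      exact neg_mem (sub_mem (sub_mem h2'.1 hv'.1) hw'.1)
  · refine mem_of_polarisation (V := D.toSubmodule) (y := star w * d * v) ?_ ?_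
    · rw [← add_mul_mul_add_sub]
      exact sub_mem (sub_mem h1'.2 hv'.2) hw'.2
    · rw [← add_smul_mul_mul_sub]
      exact sub_mem (sub_mem h2'.2 hv'.2) hw'.2

end Normalisers

namespace TensorModel

variable {H K L : Type*} [NormedAddCommGroup H] [InnerProductSpace ℂ H] [CompleteSpace H]
  [NormedAddCommGroup K] [InnerProductSpace ℂ K] [CompleteSpace K]
  [NormedAddCommGroup L] [InnerProductSpace ℂ L] [CompleteSpace L]
variable (M : TensorModel H K L)
variable {A D : NonUnitalStarSubalgebra ℂ (H →L[ℂ] H)}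
  {C E : NonUnitalStarSubalgebra ℂ (K →L[ℂ] K)}

theorem mul_mul_mem_alg {m : Type} [Fintype m] {v v' : m → (H →L[ℂ] H)} {w w' : m → (K →L[ℂ] K)}
    (hv : ∀ s t, ∀ d ∈ D, v s * d * v' t ∈ D) (hw : ∀ s t, ∀ e ∈ E, w s * e * w' t ∈ E)
    {x : L →L[ℂ] L} (hx : x ∈ M.alg D E) :
    (∑ s, M.op (v s) (w s)) * x * (∑ s, M.op (v' s) (w' s)) ∈ M.alg D E := by
  set T := ∑ s, M.op (v s) (w s)
  set T' := ∑ s, M.op (v' s) (w' s)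
  have h1 : IsClosed {x : L →L[ℂ] L | T * x * T' ∈ M.alg D E} :=
    (M.isClosed_alg D E).preimage (by fun_prop)
  refine h1.closure_subset_iff.2 (fun y hy => ?_) (M.mem_closure_span hx)
  induction hy using Submodule.span_induction with
  | mem y hy =>
    obtain ⟨d, hd, e, he, rfl⟩ := hy
    change T * M.op d e * T' ∈ M.alg D E
    rw [Finset.sum_mul, Finset.sum_mul_sum]
    refine sum_mem fun s _ => sum_mem fun t _ => ?_
    rw [← op_mul, ← op_mul]
    exact M.op_mem (hv s t d hd) (hw s t e he)
  | zero =>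
    change T * 0 * T' ∈ M.alg D E
    rw [mul_zero, zero_mul]; exact zero_mem _
  | add u v _ _ hu hv =>
    change T * (u + v) * T' ∈ M.alg D E
    rw [mul_add, add_mul]; exact add_mem hu hv
  | smul z u _ hu =>
    change T * (z • u) * T' ∈ M.alg D E
    rw [mul_smul_comm, smul_mul_assoc]; exact SMulMemClass.smul_mem z hu

/-- Conjugating d ⊗ e by a sum of elementary tensors produces the cross terms (v_s d v_t^*) ⊗ (w_s e
w_t^*), so the hypotheses must cover s ≠ t. Being normalisers individually would not suffice. -/
theorem sum_op_mem_normalisers {m : Type} [Fintype m] {v : m → (H →L[ℂ] H)}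
    {w : m → (K →L[ℂ] K)} (hvA : ∀ s, v s ∈ A) (hwC : ∀ s, w s ∈ C)
    (hv : ∀ s t, ∀ d ∈ D, v s * d * star (v t) ∈ D ∧ star (v s) * d * v t ∈ D)
    (hw : ∀ s t, ∀ e ∈ E, w s * e * star (w t) ∈ E ∧ star (w s) * e * w t ∈ E) :
    ∑ s, M.op (v s) (w s) ∈ normalisers (M.alg D E) (M.alg A C) := by
  refine ⟨sum_mem fun s _ => M.op_mem (hvA s) (hwC s), fun x hx => ?_⟩
  have h : star (∑ s, M.op (v s) (w s)) = ∑ s, M.op (star (v s)) (star (w s)) := by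
    rw [star_sum]
    exact Finset.sum_congr rfl fun s _ => (M.op_star _ _).symm
  rw [h]
  exact ⟨M.mul_mul_mem_alg (fun s t d hd => (hv s t d hd).1) (fun s t e he => (hw s t e he).1) hx,
    M.mul_mul_mem_alg (fun s t d hd => (hv s t d hd).2) (fun s t e he => (hw s t e he).2) hx⟩

theorem op_mem_normalisers {v : H →L[ℂ] H} {w : K →L[ℂ] K} (hv : v ∈ normalisers D A)
    (hw : w ∈ normalisers E C) : M.op v w ∈ normalisers (M.alg D E) (M.alg A C) := by
  have := M.sum_op_mem_normalisers (m := Unit) (v := fun _ => v) (w := fun _ => w)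
    (fun _ => hv.1) (fun _ => hw.1) (fun _ _ => hv.2) (fun _ _ => hw.2)
  simpa using this

variable [IsClosed (A : Set (H →L[ℂ] H))] [IsClosed (C : Set (K →L[ℂ] K))]
variable {J J' : Type} {R : J → Type} {R' : J' → Type} [Fintype J] [Fintype J']
  [∀ j, Fintype (R j)] [∀ j, Fintype (R' j)] [DecidableEq J] [∀ j, DecidableEq (R j)]
variable {B : Type*} [NonUnitalCStarAlgebra B] [PartialOrder B] [StarOrderedRing B]
variable {φ : BlockSum R ℂ →ₗ[ℂ] A} {φ' : BlockSum R' B →ₗ[ℂ] C}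

/-- Since V is a linear space, x + y and x + iy are also mapped to normalisers, and this is all that
polarisation requires. -/
theorem polarise_map {X : Type*} [AddCommGroup X] [Module ℂ X] (θ : X →ₗ[ℂ] A) {V : Submodule ℂ X}
    (h : ∀ x ∈ V, (θ x : H →L[ℂ] H) ∈ normalisers D A) {x y : X} (hx : x ∈ V) (hy : y ∈ V)
    {d : H →L[ℂ] H} (hd : d ∈ D) :
    (θ x).1 * d * star (θ y).1 ∈ D ∧ star (θ x).1 * d * (θ y).1 ∈ D := by
  refine mul_mul_star_mem (h x hx) (h y hy) ?_ ?_ hd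
  · have := h _ (add_mem hx hy)
    rw [map_add] at this
    exact this
  · have := h _ (add_mem hx (V.smul_mem Complex.I hy))
    rw [map_add, map_smul] at this
    exact this

end TensorModel

/-- The diagonal elements supported in a set of blocks. -/
def diagSubmodule {J : Type} (R : J → Type) (B : Type*) [NonUnitalCStarAlgebra B] (P : Set J) :
    Submodule ℂ (BlockSum R B) where
  carrier := {x | SuppIn P x ∧ IsDiag x}
  add_mem' := by
    rintro x y ⟨hx, hx'⟩ ⟨hy, hy'⟩
    refine ⟨fun j hj => ?_, fun j k l hkl => ?_⟩
    · rw [Pi.add_apply, hx j hj, hy j hj, add_zero]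
    · rw [Pi.add_apply, CStarMatrix.add_apply, hx' j k l hkl, hy' j k l hkl, add_zero]
  zero_mem' := ⟨fun _ _ => rfl, fun _ _ _ _ => rfl⟩
  smul_mem' := by
    rintro z x ⟨hx, hx'⟩
    refine ⟨fun j hj => ?_, fun j k l hkl => ?_⟩
    · rw [Pi.smul_apply, hx j hj, smul_zero]
    · rw [Pi.smul_apply, CStarMatrix.smul_apply, hx' j k l hkl, smul_zero]

/-! ### Normalisers and row spaces of the tensor product map -/

namespace TensorModel

variable {H K L : Type*} [NormedAddCommGroup H] [InnerProductSpace ℂ H] [CompleteSpace H]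
  [NormedAddCommGroup K] [InnerProductSpace ℂ K] [CompleteSpace K]
  [NormedAddCommGroup L] [InnerProductSpace ℂ L] [CompleteSpace L]
variable (M : TensorModel H K L)
variable {A D : NonUnitalStarSubalgebra ℂ (H →L[ℂ] H)}
  {C E : NonUnitalStarSubalgebra ℂ (K →L[ℂ] K)}
variable [IsClosed (A : Set (H →L[ℂ] H))] [IsClosed (C : Set (K →L[ℂ] K))]
variable {J J' : Type} {R : J → Type} {R' : J' → Type} [Fintype J] [Fintype J']
  [∀ j, Fintype (R j)] [∀ j, Fintype (R' j)] [DecidableEq J] [∀ j, DecidableEq (R j)]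
variable {B : Type*} [NonUnitalCStarAlgebra B] [PartialOrder B] [StarOrderedRing B]
variable {φ : BlockSum R ℂ →ₗ[ℂ] A} {φ' : BlockSum R' B →ₗ[ℂ] C}

/-- A diagonal element is a sum of tensors e_ss ⊗ x_s with both factors diagonal. Diagonal elements
with monochromatic support form linear spaces that the two maps send to normalisers, so polarisation
supplies the cross terms. -/
theorem up_mem_normalisers {P : Set J} {P' : Set J'}
    (h : ∀ x, SuppIn P x → IsDiag x → (φ x : H →L[ℂ] H) ∈ normalisers D A)
    (h' : ∀ x, SuppIn P' x → IsDiag x → (φ' x : K →L[ℂ] K) ∈ normalisers E C)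
    {x : BlockProd R R' B} (hx : SuppIn (P ×ˢ P') x) (hx' : IsDiag x) :
    (M.up φ φ' x : L →L[ℂ] L) ∈ normalisers (M.alg D E) (M.alg A C) := by
  classical
  -- Indices outside P are sent to zero, so that every v_s has support in P; the corresponding w_s
  -- vanishes there, and the sum is unchanged.
  let v : (Σ j, R j) → BlockSum R ℂ := fun s => if s.1 ∈ P then blockUnit s.1 s.2 s.2 1 else 0
  let w : (Σ j, R j) → BlockSum R' B := fun s => blockPart s.1 s.2 s.2 x
  have hv : ∀ s, v s ∈ diagSubmodule R ℂ P := fun s => by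
    by_cases hs : s.1 ∈ P
    · simp only [v, if_pos hs]
      exact ⟨(suppIn_blockUnit _ _ _ _).mono (by simpa using hs), isDiag_blockUnit _ _ _⟩
    · simp only [v, if_neg hs]
      exact zero_mem _
  have hw : ∀ s, w s ∈ diagSubmodule R' B P' := fun s =>
    ⟨suppIn_blockPart hx _ _ _, fun j' k' l' hkl => by
      exact hx' (s.1, j') (s.2, k') (s.2, l') fun h => hkl (congrArg Prod.snd h)⟩
  have h1 : (M.up φ φ' x).1 = ∑ s, M.op (φ (v s)).1 (φ' (w s)).1 := by
    have h2 : M.up φ φ' x = ∑ s, M.pure (φ (v s)) (φ' (w s)) := by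
      rw [up_apply, Fintype.sum_sigma]
      refine Finset.sum_congr rfl fun j _ => Finset.sum_congr rfl fun k _ => ?_
      rw [Finset.sum_eq_single k]
      · by_cases hj : j ∈ P
        · simp only [v, if_pos hj, w]
        · have h0 : w ⟨j, k⟩ = 0 := blockPart_eq_zero hx hj k k
          change M.pure _ (φ' (w ⟨j, k⟩)) = M.pure _ (φ' (w ⟨j, k⟩))
          rw [h0, map_zero, ← pureₗ_apply, ← pureₗ_apply, map_zero, map_zero]
      · intro l _ hl
        have h0 : blockPart j k l x = 0 := by
          ext j' k' l'
          rw [blockPart_apply]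
          exact hx' _ _ _ fun h => hl (congrArg Prod.fst h).symm
        rw [h0, map_zero, ← pureₗ_apply, map_zero]
      · simp
    rw [h2]
    exact map_sum (inclusionHom (M.alg A C)) _ _
  rw [h1]
  exact M.sum_op_mem_normalisers (fun s => (φ (v s)).2) (fun s => (φ' (w s)).2)
    (fun s t d hd => polarise_map φ (V := diagSubmodule R ℂ P) (fun x hx => h x hx.1 hx.2) (hv s) (hv t) hd)
    (fun s t d hd => polarise_map φ' (V := diagSubmodule R' B P') (fun x hx => h' x hx.1 hx.2) (hw s) (hw t) hd)

variable [DecidableEq J'] [∀ j, DecidableEq (R' j)]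

theorem up_blockUnit (p : J × J') (k l : R p.1 × R' p.2) (b : B) :
    M.up φ φ' (blockUnit (R := fun p : J × J' => R p.1 × R' p.2) p k l b) =
      M.pure (φ (blockUnit p.1 k.1 l.1 1)) (φ' (blockUnit p.2 k.2 l.2 b)) := by
  rw [← up_blockTensor, blockTensor_blockUnit, one_smul]

/-- Vectors x ⊗ y with x and y in the closed row spaces of the factors lie in the closed row space
of the tensor product. An operator d ⊗ e preserves the form of such vectors, and these operators
span a dense subspace. -/
theorem up_invariant {p : J × J'} {k : R p.1 × R' p.2}
    (h : ∀ a ∈ D, ∀ l b ξ, a ((φ (blockUnit p.1 k.1 l b) : H →L[ℂ] H) ξ) ∈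
      (rowSpace (fun x => (φ x : H →L[ℂ] H)) p.1 k.1).topologicalClosure)
    (h' : ∀ a ∈ E, ∀ l b ξ, a ((φ' (blockUnit p.2 k.2 l b) : K →L[ℂ] K) ξ) ∈
      (rowSpace (fun x => (φ' x : K →L[ℂ] K)) p.2 k.2).topologicalClosure)
    {a : L →L[ℂ] L} (ha : a ∈ M.alg D E) (l : R p.1 × R' p.2) (b : B) (ξ : L) :
    a ((M.up φ φ' (blockUnit (R := fun p : J × J' => R p.1 × R' p.2) p k l b)).1 ξ) ∈
      (rowSpace (R := fun p : J × J' => R p.1 × R' p.2)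
        (fun x => (M.up φ φ' x : L →L[ℂ] L)) p k).topologicalClosure := by
  set W := rowSpace (R := fun p : J × J' => R p.1 × R' p.2)
    (fun x => (M.up φ φ' x : L →L[ℂ] L)) p k with hW
  have h1 : ∀ l b ξ l' b' ζ, M.t ((φ (blockUnit p.1 k.1 l b)).1 ξ)
      ((φ' (blockUnit p.2 k.2 l' b')).1 ζ) ∈ W.topologicalClosure := by
    intro l b ξ l' b' ζ
    refine Submodule.le_topologicalClosure _ (Submodule.subset_span
      ⟨(l, l'), b • b', M.t ξ ζ, ?_⟩)
    have h2 := blockTensor_blockUnit p.1 k.1 l b p.2 k.2 l' b'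
    have h3 : M.up φ φ' (blockUnit (R := fun p : J × J' => R p.1 × R' p.2) p k (l, l') (b • b')) =
      M.pure (φ (blockUnit p.1 k.1 l b)) (φ' (blockUnit p.2 k.2 l' b')) := by
      rw [← up_blockTensor, h2]
    exact (M.op_t _ _ _ _).symm.trans (congrArg (fun x => x.1 (M.t ξ ζ)) h3.symm)
  have h2 : ∀ x ∈ (rowSpace (fun x => (φ x : H →L[ℂ] H)) p.1 k.1).topologicalClosure,
      ∀ y ∈ (rowSpace (fun x => (φ' x : K →L[ℂ] K)) p.2 k.2).topologicalClosure,
      M.t x y ∈ W.topologicalClosure := by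
    intro x hx y hy
    refine map_mem_topologicalClosure (a := M.tLeft y) ?_ hx
    rintro _ ⟨l, b, ξ, rfl⟩
    refine map_mem_topologicalClosure (a := M.tRight _) ?_ hy
    rintro _ ⟨l', b', ζ, rfl⟩
    exact h1 l b ξ l' b' ζ
  have h3 : ∀ d ∈ D, ∀ e ∈ E, ∀ ξ, M.op d e
      ((M.up φ φ' (blockUnit (R := fun p : J × J' => R p.1 × R' p.2) p k l b)).1 ξ) ∈
      W.topologicalClosure := by
    intro d hd e he ξ
    set T := M.up φ φ' (blockUnit (R := fun p : J × J' => R p.1 × R' p.2) p k l b) with hT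
    refine M.mem_of_isClosed (S := W.topologicalClosure.comap
      ((M.op d e ∘L T.1 : L →L[ℂ] L) : L →ₗ[ℂ] L))
      ((Submodule.isClosed_topologicalClosure _).preimage (M.op d e ∘L T.1).continuous)
      (fun x y => ?_) ξ
    rw [up_blockUnit] at hT
    change M.op d e (T.1 (M.t x y)) ∈ W.topologicalClosure
    rw [hT]
    change M.op d e (M.op _ _ (M.t x y)) ∈ W.topologicalClosure
    rw [op_t, op_t]
    exact h2 _ (h d hd _ _ _) _ (h' e he _ _ _)
  set η := (M.up φ φ' (blockUnit (R := fun p : J × J' => R p.1 × R' p.2) p k l b)).1 ξ with hη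
  have h4 : IsClosed {x : L →L[ℂ] L | x η ∈ W.topologicalClosure} :=
    (Submodule.isClosed_topologicalClosure _).preimage (by fun_prop)
  refine h4.closure_subset_iff.2 (fun y hy => ?_) (M.mem_closure_span ha)
  induction hy using Submodule.span_induction with
  | mem y hy =>
    obtain ⟨d, hd, e, he, rfl⟩ := hy
    exact h3 d hd e he ξ
  | zero => exact zero_mem W.topologicalClosure
  | add u v _ _ hu hv => exact W.topologicalClosure.add_mem hu hv
  | smul z u _ hu => exact W.topologicalClosure.smul_mem z hu

end TensorModel

end GenDiag
end

noncomputable section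

namespace GenDiag

/-! ### Assembly of the tensor product approximation -/

open scoped InnerProductSpace

/-- Split x by colour; each part is mapped contractively. The bound depends only on the number of
colours, not on the approximation. -/
theorem norm_map_le_card_mul {J ι : Type} [Fintype J] [Fintype ι] {R : J → Type}
    [∀ j, Fintype (R j)] {B Y : Type*} [NonUnitalCStarAlgebra B] [PartialOrder B] [StarOrderedRing B]
    [NonUnitalCStarAlgebra Y] (θ : BlockSum R B →ₗ[ℂ] Y) (c : J → ι)
    (h : ∀ i x, SuppIn (c ⁻¹' {i}) x → ‖θ x‖ ≤ ‖x‖) (x : BlockSum R B) :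
    ‖θ x‖ ≤ Fintype.card ι * ‖x‖ := by
  classical
  have hx : x = ∑ i, cutHom R B (c ⁻¹' {i}) x := by
    refine funext fun j => ?_
    rw [Finset.sum_apply, Finset.sum_eq_single (c j)]
    · exact (if_pos (rfl : j ∈ c ⁻¹' {c j})).symm
    · exact fun i _ hi => if_neg fun hj : c j = i => hi hj.symm
    · simp
  calc ‖θ x‖ = ‖∑ i, θ (cutHom R B (c ⁻¹' {i}) x)‖ := by rw [← map_sum, ← hx]
    _ ≤ ∑ i : ι, ‖x‖ := norm_sum_le_of_le _ fun i _ =>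
        (h i _ (suppIn_cutHom _ _)).trans (isContractive_starHom _ _)
    _ = Fintype.card ι * ‖x‖ := by rw [Finset.sum_const, nsmul_eq_mul]; rfl

namespace TensorModel

variable {H K L : Type*} [NormedAddCommGroup H] [InnerProductSpace ℂ H] [CompleteSpace H]
  [NormedAddCommGroup K] [InnerProductSpace ℂ K] [CompleteSpace K]
  [NormedAddCommGroup L] [InnerProductSpace ℂ L] [CompleteSpace L]
variable (M : TensorModel H K L)
variable {A D : NonUnitalStarSubalgebra ℂ (H →L[ℂ] H)}
  {C E : NonUnitalStarSubalgebra ℂ (K →L[ℂ] K)}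
variable [IsClosed (A : Set (H →L[ℂ] H))] [IsClosed (C : Set (K →L[ℂ] K))]

theorem norm_pure_sub_pure_le {a a' : A} {c c' : C} {δ : ℝ} (hδ : δ ≤ 1) (ha : ‖a' - a‖ ≤ δ)
    (hc : ‖c' - c‖ ≤ δ) : ‖M.pure a' c' - M.pure a c‖ ≤ δ * (‖c‖ + 1 + ‖a‖) := by
  have h0 : 0 ≤ δ := (norm_nonneg _).trans ha
  have h1 : M.pure a' c' - M.pure a c = M.pure (a' - a) c' + M.pure a (c' - c) := by
    simp only [← pureₗ_apply, map_sub, LinearMap.sub_apply]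
    abel
  have h2 : ‖c'‖ ≤ ‖c‖ + 1 := by
    have := norm_add_le (c' - c) c
    rw [sub_add_cancel] at this
    linarith
  rw [h1]
  refine (norm_add_le _ _).trans ?_
  rw [mul_add]
  refine add_le_add ((M.norm_pure_le _ _).trans ?_) ((M.norm_pure_le _ _).trans ?_)
  · exact mul_le_mul ha h2 (norm_nonneg _) h0
  · rw [mul_comm]
    exact mul_le_mul_of_nonneg_right hc (norm_nonneg _)

theorem exists_norm_sub_lt_of_mem_algSpan {y : M.alg A C} (hy : y ∈ M.algSpan A C) {ε : ℝ}
    (hε : 0 < ε) : ∃ (S : Set A) (S' : Set C) (δ : ℝ), S.Finite ∧ S'.Finite ∧ 0 < δ ∧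
      ∀ (α : A →ₗ[ℂ] A) (γ : C →ₗ[ℂ] C) (β : M.alg A C →ₗ[ℂ] M.alg A C),
        (∀ a c, β (M.pure a c) = M.pure (α a) (γ c)) → (∀ a ∈ S, ‖α a - a‖ < δ) →
        (∀ c ∈ S', ‖γ c - c‖ < δ) → ‖β y - y‖ < ε := by
  obtain ⟨n, a, c, rfl⟩ := M.exists_eq_sum hy
  set N : ℝ := ∑ p, (‖c p‖ + 1 + ‖a p‖) with hN
  have hN0 : 0 ≤ N := Finset.sum_nonneg fun p _ => by positivity
  -- The minimum with 1 bounds ‖γ c‖ by ‖c‖ + 1, and the factor N + 1 instead of N keeps the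
  -- inequality strict and the quotient meaningful when N = 0.
  refine ⟨Set.range a, Set.range c, min 1 (ε / (N + 1)), Set.finite_range a, Set.finite_range c,
    lt_min one_pos (by positivity), fun α γ β hβ hα hγ => ?_⟩
  rw [map_sum, ← Finset.sum_sub_distrib]
  have h1 : ‖∑ p, (β (M.pure (a p) (c p)) - M.pure (a p) (c p))‖ ≤
      ∑ p, min 1 (ε / (N + 1)) * (‖c p‖ + 1 + ‖a p‖) := norm_sum_le_of_le _ fun p _ => by
    rw [hβ]
    exact M.norm_pure_sub_pure_le (min_le_left _ _) (hα _ ⟨p, rfl⟩).le (hγ _ ⟨p, rfl⟩).le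
  refine h1.trans_lt ?_
  rw [← Finset.mul_sum, ← hN]
  calc min 1 (ε / (N + 1)) * N ≤ ε / (N + 1) * N := by gcongr; exact min_le_right _ _
    _ < ε := by rw [div_mul_eq_mul_div, div_lt_iff₀ (by positivity)]; nlinarith

/-- The data S, S', δ depend on x, ε and r only, not on the maps that are chosen afterwards. This
requires the bound r on β to be known in advance, since x is merely a limit of sums of elementary
tensors. -/
theorem exists_norm_sub_lt (x : M.alg A C) {ε r : ℝ} (hε : 0 < ε) (hr : 0 ≤ r) :
    ∃ (S : Set A) (S' : Set C) (δ : ℝ), S.Finite ∧ S'.Finite ∧ 0 < δ ∧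
      ∀ (α : A →ₗ[ℂ] A) (γ : C →ₗ[ℂ] C) (β : M.alg A C →ₗ[ℂ] M.alg A C),
        (∀ a c, β (M.pure a c) = M.pure (α a) (γ c)) → (∀ x, ‖β x‖ ≤ r * ‖x‖) →
        (∀ a ∈ S, ‖α a - a‖ < δ) → (∀ c ∈ S', ‖γ c - c‖ < δ) → ‖β x - x‖ < ε := by
  obtain ⟨y, hy, hxy⟩ := Metric.mem_closure_iff.1 (M.mem_closure_algSpan x) (ε / (2 * (r + 1)))
    (by positivity)
  obtain ⟨S, S', δ, hS, hS', hδ, h⟩ := M.exists_norm_sub_lt_of_mem_algSpan hy (half_pos hε)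
  refine ⟨S, S', δ, hS, hS', hδ, fun α γ β hβ hr' hα hγ => ?_⟩
  rw [dist_eq_norm] at hxy
  have h1 : β x - x = β (x - y) + (β y - y) - (x - y) := by rw [map_sub]; abel
  have h2 : ‖β (x - y)‖ + ‖x - y‖ < ε / 2 := by
    calc ‖β (x - y)‖ + ‖x - y‖ ≤ r * ‖x - y‖ + ‖x - y‖ := by gcongr; exact hr' _
      _ = (r + 1) * ‖x - y‖ := by ring
      _ < (r + 1) * (ε / (2 * (r + 1))) := by gcongr
      _ = ε / 2 := by field_simp
  have h3 := h α γ β hβ hα hγ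
  rw [h1]
  refine (norm_sub_le _ _).trans_lt ?_
  have h4 := norm_add_le (β (x - y)) (β y - y)
  linarith

theorem exists_norm_sub_lt_of_finite {T : Set (M.alg A C)} (hT : T.Finite) {ε r : ℝ} (hε : 0 < ε)
    (hr : 0 ≤ r) : ∃ (S : Set A) (S' : Set C) (δ : ℝ), S.Finite ∧ S'.Finite ∧ 0 < δ ∧
      ∀ (α : A →ₗ[ℂ] A) (γ : C →ₗ[ℂ] C) (β : M.alg A C →ₗ[ℂ] M.alg A C),
        (∀ a c, β (M.pure a c) = M.pure (α a) (γ c)) → (∀ x, ‖β x‖ ≤ r * ‖x‖) →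
        (∀ a ∈ S, ‖α a - a‖ < δ) → (∀ c ∈ S', ‖γ c - c‖ < δ) → ∀ x ∈ T, ‖β x - x‖ < ε := by
  induction T, hT using Set.Finite.induction_on with
  | empty => exact ⟨∅, ∅, 1, Set.finite_empty, Set.finite_empty, one_pos, by simp⟩
  | @insert x T _ _ ih =>
    obtain ⟨S, S', δ, hS, hS', hδ, h⟩ := ih
    obtain ⟨S₁, S₁', δ₁, hS₁, hS₁', hδ₁, h₁⟩ := M.exists_norm_sub_lt x hε hr
    refine ⟨S ∪ S₁, S' ∪ S₁', min δ δ₁, hS.union hS₁, hS'.union hS₁', lt_min hδ hδ₁,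
      fun α γ β hβ hr' hα hγ => ?_⟩
    rintro y (rfl | hy)
    · exact h₁ α γ β hβ hr' (fun a ha => (hα a (.inr ha)).trans_le (min_le_right _ _))
        fun c hc => (hγ c (.inr hc)).trans_le (min_le_right _ _)
    · exact h α γ β hβ hr' (fun a ha => (hα a (.inl ha)).trans_le (min_le_left _ _))
        (fun c hc => (hγ c (.inl hc)).trans_le (min_le_left _ _)) y hy

variable {B : Type*} [NonUnitalCStarAlgebra B] [PartialOrder B] [StarOrderedRing B]
variable {J J' ι ι' : Type} {R : J → Type} {R' : J' → Type} [Fintype J] [Fintype J']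
  [∀ j, Fintype (R j)] [∀ j, Fintype (R' j)] [DecidableEq J] [∀ j, DecidableEq (R j)]
  [DecidableEq J'] [∀ j, DecidableEq (R' j)]

theorem norm_up_le_of_mono {c : J → ι} {c' : J' → ι'} {S : Set A} {S' : Set C} {δ : ℝ}
    {ψ : A →ₗ[ℂ] BlockSum R ℂ} {φ : BlockSum R ℂ →ₗ[ℂ] A} {ψ' : C →ₗ[ℂ] BlockSum R' B}
    {φ' : BlockSum R' B →ₗ[ℂ] C} (h : Approx ℂ D A c S δ ψ φ) (h' : Approx B E C c' S' δ ψ' φ')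
    {P : Set (J × J')} (hP : Mono (fun p : J × J' => (c p.1, c' p.2)) P) {x : BlockProd R R' B}
    (hx : SuppIn P x) : ‖M.up φ φ' x‖ ≤ ‖x‖ := by
  obtain ⟨Q, Q', hQ, hQ', hPQ⟩ := hP.subset_prod
  exact M.norm_up_le h.cp_phi h'.cp_phi (h.contractive_phi Q hQ) (h'.contractive_phi Q' hQ')
    (hx.mono hPQ)

theorem approx_tensor (hD : D ≤ A) (hE : E ≤ C) {c : J → ι} {c' : J' → ι'} {S : Set A}
    {S' : Set C} {δ : ℝ}
    {ψ : A →ₗ[ℂ] BlockSum R ℂ} {φ : BlockSum R ℂ →ₗ[ℂ] A} {ψ' : C →ₗ[ℂ] BlockSum R' B}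
    {φ' : BlockSum R' B →ₗ[ℂ] C} (h : Approx ℂ D A c S δ ψ φ) (h' : Approx B E C c' S' δ ψ' φ')
    {T : Set (M.alg A C)} {ε : ℝ}
    (hT : ∀ x ∈ T, ‖M.up φ φ' (M.down h.cp_psi ψ' x) - x‖ < ε) :
    Approx B (M.alg D E) (M.alg A C) (R := fun p : J × J' => R p.1 × R' p.2)
      (fun p : J × J' => (c p.1, c' p.2)) T ε (M.down h.cp_psi ψ') (M.up φ φ') where
  cp_psi := M.isCP_down h.cp_psi h'.cp_psi
  cp_phi := M.isCP_up h.cp_phi h'.cp_phi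
  contractive_psi := M.isContractive_down h.cp_psi h'.cp_psi h.contractive_psi h'.contractive_psi
  approx := hT
  map_mul_map_mul P hP x y z hx hy hz := by
    obtain ⟨Q, Q', hQ, hQ', hPQ⟩ := hP.subset_prod
    exact M.up_mul_up_mul (h.map_mul_map_mul Q hQ) (h'.map_mul_map_mul Q' hQ') (hx.mono hPQ)
      (hy.mono hPQ) (hz.mono hPQ)
  contractive_phi P hP x hx := M.norm_up_le_of_mono h h' hP hx
  map_diagonal x hx := M.isDiag_down h.cp_psi h'.cp_psi hD hE h.map_diagonal h'.map_diagonal hx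
  diagonal_normaliser P hP x hx hx' := by
    obtain ⟨Q, Q', hQ, hQ', hPQ⟩ := hP.subset_prod
    exact M.up_mem_normalisers (h.diagonal_normaliser Q hQ) (h'.diagonal_normaliser Q' hQ')
      (hx.mono hPQ) hx'
  unit_normaliser p k l b := by
    rw [M.up_blockUnit p k l b]
    exact M.op_mem_normalisers (h.unit_normaliser _ _ _ _) (h'.unit_normaliser _ _ _ _)
  invariant p k a ha l b ξ := M.up_invariant (h.invariant p.1 k.1) (h'.invariant p.2 k.2) ha l b ξ

/-- Subadditivity of the generalised diagonal dimension for tensor products. -/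
theorem dimLE_alg (hD : D ≤ A) (hE : E ≤ C) {d d' n : ℕ} (hn : n + 1 = (d + 1) * (d' + 1))
    (h : DimLE ℂ D A d) (h' : DimLE B E C d') : DimLE B (M.alg D E) (M.alg A C) n := by
  rw [dimLE_iff] at h h' ⊢
  intro T hT ε hε
  -- The number of colours (d + 1)(d' + 1) bounds every composition that can arise, so it may be
  -- used before the two approximations are chosen.
  obtain ⟨S, S', δ, hS, hS', hδ, hST⟩ := M.exists_norm_sub_lt_of_finite hT hε
    (r := (Fintype.card (Fin (d + 1) × Fin (d' + 1)) : ℝ)) (by positivity)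
  obtain ⟨J, _, _, R, _, _, c, ψ, φ, h1⟩ := h S hS δ hδ
  obtain ⟨J', _, _, R', _, _, c', ψ', φ', h2⟩ := h' S' hS' δ hδ
  have h3 : ∀ x, ‖M.up φ φ' (M.down h1.cp_psi ψ' x)‖ ≤
      (Fintype.card (Fin (d + 1) × Fin (d' + 1)) : ℝ) * ‖x‖ := by
    intro x
    refine (norm_map_le_card_mul (M.up φ φ') (fun p : J × J' => (c p.1, c' p.2))
      (fun i y hy => M.norm_up_le_of_mono h1 h2 ?_ hy) _).trans ?_
    · rintro p rfl q hq
      exact hq.symm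
    · exact mul_le_mul_of_nonneg_left (M.isContractive_down h1.cp_psi h2.cp_psi h1.contractive_psi
        h2.contractive_psi x) (Nat.cast_nonneg _)
  have h4 := M.approx_tensor hD hE h1 h2 (T := T) (ε := ε)
    (hST (φ ∘ₗ ψ) (φ' ∘ₗ ψ') (M.up φ φ' ∘ₗ M.down h1.cp_psi ψ')
      (fun a b => by
        change M.up φ φ' (M.down h1.cp_psi ψ' (M.pure a b)) = _
        rw [down_pure, up_blockTensor]
        rfl)
      h3 h1.approx h2.approx)
  -- Pairs of colours are numbered by the n + 1 = (d + 1)(d' + 1) colours.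
  have h5 := h4.recolour
    (c' := fun p : J × J' => Fin.cast hn.symm (finProdFinEquiv (c p.1, c' p.2)))
    fun p q hpq => finProdFinEquiv.injective (Fin.cast_injective _ hpq)
  exact ⟨_, inferInstance, inferInstance, _, inferInstance, inferInstance, _, _, _, h5⟩

end TensorModel

end GenDiag
end

noncomputable section

namespace GenDiag

open scoped InnerProductSpace

/-! ### Realisations of the tensor product: the completed tensor product and Hⁿ -/

section Models

variable {H K : Type*} [NormedAddCommGroup H] [InnerProductSpace ℂ H] [CompleteSpace H]
  [NormedAddCommGroup K] [InnerProductSpace ℂ K] [CompleteSpace K]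

variable (H K) in
/-- The Hilbert space tensor product. -/
def hilbertTensorModel : TensorModel H K (HilbertTensor H K) where
  t := LinearMap.mk₂ ℂ (fun ξ ζ => ((ξ ⊗ₜ[ℂ] ζ : H ⊗[ℂ] K) : HilbertTensor H K))
    (fun _ _ _ => by rw [TensorProduct.add_tmul, UniformSpace.Completion.coe_add])
    (fun _ _ _ => by rw [← TensorProduct.smul_tmul', UniformSpace.Completion.coe_smul])
    (fun _ _ _ => by rw [TensorProduct.tmul_add, UniformSpace.Completion.coe_add])
    (fun _ _ _ => by rw [TensorProduct.tmul_smul, UniformSpace.Completion.coe_smul])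
  inner_t ξ ζ ξ' ζ' := by
    change ⟪((ξ ⊗ₜ[ℂ] ζ : H ⊗[ℂ] K) : HilbertTensor H K),
      ((ξ' ⊗ₜ[ℂ] ζ' : H ⊗[ℂ] K) : HilbertTensor H K)⟫_ℂ = _
    rw [UniformSpace.Completion.inner_coe, TensorProduct.inner_tmul]
  dense := by
    refine eq_top_iff.2 fun x _ => ?_
    refine closure_mono (s := Set.range ((↑) : H ⊗[ℂ] K → HilbertTensor H K)) ?_
      (UniformSpace.Completion.denseRange_coe x)
    rintro _ ⟨z, rfl⟩
    induction z using TensorProduct.induction_on with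
    | zero =>
      rw [UniformSpace.Completion.coe_zero]
      exact zero_mem (Submodule.span ℂ _)
    | tmul ξ ζ => exact Submodule.subset_span ⟨ξ, ζ, rfl⟩
    | add u v hu hv =>
      rw [UniformSpace.Completion.coe_add]
      exact add_mem (S := Submodule ℂ (HilbertTensor H K)) hu hv
  op := tensorOp
  op_t a c ξ ζ := by
    change (TensorProduct.mapL a c).completion ((ξ ⊗ₜ[ℂ] ζ : H ⊗[ℂ] K) : HilbertTensor H K) = _
    rw [ContinuousLinearMap.completion_apply_coe]
    rfl

theorem dimLE_tensor {B : Type*} [NonUnitalCStarAlgebra B] [PartialOrder B] [StarOrderedRing B]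
    {D A : NonUnitalStarSubalgebra ℂ (H →L[ℂ] H)} [IsClosed (A : Set (H →L[ℂ] H))]
    {E C : NonUnitalStarSubalgebra ℂ (K →L[ℂ] K)} [IsClosed (C : Set (K →L[ℂ] K))]
    (hD : D ≤ A) (hE : E ≤ C) {d d' n : ℕ} (hn : n + 1 = (d + 1) * (d' + 1))
    (h : DimLE ℂ D A d) (h' : DimLE B E C d') : DimLE B (tensor D E) (tensor A C) n :=
  (hilbertTensorModel H K).dimLE_alg hD hE hn h h'

variable {n : ℕ}

/-- The coordinate inclusions of `Hⁿ`. -/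
abbrev coordInl (H : Type*) [NormedAddCommGroup H] [InnerProductSpace ℂ H] [CompleteSpace H]
    (k : Fin n) : H →L[ℂ] PiLp 2 (fun _ : Fin n => H) :=
  ContinuousLinearMap.adjoint (PiLp.proj 2 (fun _ : Fin n => H) k)

theorem coordInl_apply (k l : Fin n) (ξ : H) : coordInl H k ξ l = if k = l then ξ else 0 := by
  have h : coordInl H k ξ = WithLp.toLp 2 (Pi.single k ξ) := by
    refine ext_inner_right ℂ fun ζ => ?_
    rw [ContinuousLinearMap.adjoint_inner_left, PiLp.inner_apply, Finset.sum_eq_single k]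
    · simp
    · intro i _ hi
      simp [hi]
    · simp
  rw [h, PiLp.toLp_apply, Pi.single_apply]
  simp only [eq_comm]

theorem piLp_sum_apply {α : Type*} (s : Finset α) (x : α → PiLp 2 (fun _ : Fin n => H))
    (k : Fin n) : (∑ a ∈ s, x a) k = ∑ a ∈ s, x a k :=
  map_sum (PiLp.proj 2 (fun _ : Fin n => H) k : PiLp 2 (fun _ : Fin n => H) →L[ℂ] H) x s

theorem sum_coordInl (x : PiLp 2 (fun _ : Fin n => H)) : ∑ k, coordInl H k (x k) = x := by
  ext i
  rw [piLp_sum_apply]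
  simp only [coordInl_apply]
  simp

/-- The operator on `Hⁿ` with a single nonzero entry. -/
def matUnit (k l : Fin n) (a : H →L[ℂ] H) :
    PiLp 2 (fun _ : Fin n => H) →L[ℂ] PiLp 2 (fun _ : Fin n => H) :=
  coordInl H k ∘L a ∘L (PiLp.proj 2 (fun _ : Fin n => H) l : PiLp 2 (fun _ : Fin n => H) →L[ℂ] H)

theorem matUnit_apply (k l i : Fin n) (a : H →L[ℂ] H) (x : PiLp 2 (fun _ : Fin n => H)) :
    matUnit k l a x i = if k = i then a (x l) else 0 := by
  rw [← coordInl_apply k i (a (x l))]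
  rfl

theorem entry_apply (T : PiLp 2 (fun _ : Fin n => H) →L[ℂ] PiLp 2 (fun _ : Fin n => H))
    (k l : Fin n) (ξ : H) : entry T k l ξ = T (coordInl H l ξ) k := rfl

theorem entry_matUnit (k l i j : Fin n) (a : H →L[ℂ] H) :
    entry (matUnit k l a) i j = if k = i ∧ j = l then a else 0 := by
  ext ξ
  rw [entry_apply, matUnit_apply, coordInl_apply]
  by_cases h1 : k = i <;> by_cases h2 : j = l <;> simp [h1, h2]

theorem sum_matUnit_entry (T : PiLp 2 (fun _ : Fin n => H) →L[ℂ] PiLp 2 (fun _ : Fin n => H)) :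
    ∑ k, ∑ l, matUnit k l (entry T k l) = T := by
  refine ContinuousLinearMap.ext fun x => ?_
  ext i
  simp only [_root_.sum_apply, piLp_sum_apply, matUnit_apply]
  rw [Finset.sum_eq_single i]
  · simp only [if_true, entry_apply]
    rw [← piLp_sum_apply, ← map_sum, sum_coordInl]
  · intro k _ hk
    simp [hk]
  · simp

theorem entry_ext {S T : PiLp 2 (fun _ : Fin n => H) →L[ℂ] PiLp 2 (fun _ : Fin n => H)}
    (h : ∀ k l, entry S k l = entry T k l) : S = T := by
  rw [← sum_matUnit_entry S, ← sum_matUnit_entry T]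
  simp only [h]

/-- The scalar entries of an operator on `ℂⁿ`. -/
def scalarEntry (T : EuclideanSpace ℂ (Fin n) →L[ℂ] EuclideanSpace ℂ (Fin n)) (k l : Fin n) : ℂ :=
  entry T k l 1

theorem entry_eq_smul (T : EuclideanSpace ℂ (Fin n) →L[ℂ] EuclideanSpace ℂ (Fin n)) (k l : Fin n) :
    entry T k l = scalarEntry T k l • (1 : ℂ →L[ℂ] ℂ) := by
  ext
  simp [scalarEntry]

theorem apply_eq_sum (T : EuclideanSpace ℂ (Fin n) →L[ℂ] EuclideanSpace ℂ (Fin n))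
    (v : EuclideanSpace ℂ (Fin n)) (k : Fin n) : T v k = ∑ l, scalarEntry T k l * v l := by
  conv_lhs => rw [← sum_matUnit_entry T]
  simp only [_root_.sum_apply, piLp_sum_apply, matUnit_apply]
  rw [Finset.sum_eq_single k]
  · refine Finset.sum_congr rfl fun l _ => ?_
    rw [if_pos rfl, entry_eq_smul]
    simp
  · intro i _ hi
    simp [hi]
  · simp

variable (H n) in
/-- The space `Hⁿ` as a tensor product of `ℂⁿ` and `H`. -/
def powerModel : TensorModel (EuclideanSpace ℂ (Fin n)) H (PiLp 2 (fun _ : Fin n => H)) where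
  t := LinearMap.mk₂ ℂ (fun v ξ => WithLp.toLp 2 fun k => v k • ξ)
    (fun _ _ _ => by ext k; exact add_smul _ _ _)
    (fun z v ξ => by ext k; exact smul_assoc z (v k) ξ)
    (fun _ _ _ => by ext k; exact smul_add _ _ _)
    (fun z v ξ => by ext k; exact smul_comm (v k) z ξ)
  inner_t v ξ v' ξ' := by
    rw [PiLp.inner_apply, PiLp.inner_apply, Finset.sum_mul]
    refine Finset.sum_congr rfl fun k _ => ?_
    change ⟪v k • ξ, v' k • ξ'⟫_ℂ = _
    rw [inner_smul_left, inner_smul_right, RCLike.inner_apply]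
    ring
  dense := by
    refine eq_top_iff.2 fun x _ => Submodule.le_topologicalClosure _ ?_
    rw [← sum_coordInl x]
    refine sum_mem fun k _ => Submodule.subset_span ⟨coordInl ℂ k 1, x k, ?_⟩
    ext i
    rw [coordInl_apply]
    change _ = (coordInl ℂ k 1) i • x k
    rw [coordInl_apply]
    split_ifs <;> simp
  op m a := ∑ k, ∑ l, scalarEntry m k l • matUnit k l a
  op_t m a v ξ := by
    ext i
    change _ = (m v) i • a ξ
    rw [apply_eq_sum]
    simp only [_root_.sum_apply, piLp_sum_apply, _root_.smul_apply, PiLp.smul_apply, matUnit_apply]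
    rw [Finset.sum_eq_single i]
    · rw [Finset.sum_smul]
      refine Finset.sum_congr rfl fun l _ => ?_
      rw [if_pos rfl]
      change scalarEntry m i l • a (v l • ξ) = _
      rw [map_smul, smul_smul]
    · intro k _ hk
      simp [hk]
    · simp

theorem entry_op (m : EuclideanSpace ℂ (Fin n) →L[ℂ] EuclideanSpace ℂ (Fin n)) (a : H →L[ℂ] H)
    (k l : Fin n) : entry ((powerModel H n).op m a) k l = scalarEntry m k l • a := by
  change entry (∑ k, ∑ l, scalarEntry m k l • matUnit k l a) k l = _
  ext ξ
  simp only [entry_apply, _root_.sum_apply, piLp_sum_apply, _root_.smul_apply, PiLp.smul_apply,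
    matUnit_apply, coordInl_apply]
  rw [Finset.sum_eq_single k, Finset.sum_eq_single l]
  · simp
  · intro i _ hi
    simp [hi.symm]
  · simp
  · intro i _ hi
    simp [hi]
  · simp

theorem op_matUnit (k l : Fin n) (a : H →L[ℂ] H) :
    (powerModel H n).op (matUnit k l (1 : ℂ →L[ℂ] ℂ)) a = matUnit k l a := by
  refine entry_ext fun i j => ?_
  rw [entry_op, scalarEntry, entry_matUnit, entry_matUnit]
  split_ifs <;> simp

/-- An operator on Hⁿ is a finite sum of its entries placed at their positions, so membership may be
decided entry by entry. -/
theorem alg_eq_of_forall {D : NonUnitalStarSubalgebra ℂ (H →L[ℂ] H)}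
    {F : NonUnitalStarSubalgebra ℂ (EuclideanSpace ℂ (Fin n) →L[ℂ] EuclideanSpace ℂ (Fin n))}
    {G : NonUnitalStarSubalgebra ℂ (PiLp 2 (fun _ : Fin n => H) →L[ℂ] PiLp 2 (fun _ : Fin n => H))}
    (hG : IsClosed (G : Set (PiLp 2 (fun _ : Fin n => H) →L[ℂ] PiLp 2 (fun _ : Fin n => H))))
    (h1 : ∀ m ∈ F, ∀ a ∈ D, (powerModel H n).op m a ∈ G)
    (h2 : ∀ T ∈ G, ∀ k l, matUnit k l (entry T k l) ∈ (powerModel H n).alg F D) :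
    (powerModel H n).alg F D = G := by
  refine le_antisymm (?_ : cstarGenerated _ ≤ G) fun T hT => ?_
  · refine NonUnitalStarSubalgebra.topologicalClosure_minimal _ (NonUnitalStarAlgebra.adjoin_le ?_) hG
    rintro _ ⟨m, hm, a, ha, rfl⟩
    exact h1 m hm a ha
  · rw [← sum_matUnit_entry T]
    exact sum_mem fun k _ => sum_mem fun l _ => h2 T hT k l

/-- The operators on `ℂⁿ`. -/
def scalarAlgebra (n : ℕ) :
    NonUnitalStarSubalgebra ℂ (EuclideanSpace ℂ (Fin n) →L[ℂ] EuclideanSpace ℂ (Fin n)) := ⊤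

theorem mem_scalarAlgebra (T : EuclideanSpace ℂ (Fin n) →L[ℂ] EuclideanSpace ℂ (Fin n)) :
    T ∈ scalarAlgebra n := NonUnitalStarAlgebra.mem_top

instance isClosed_scalarAlgebra (n : ℕ) : IsClosed (scalarAlgebra n :
    Set (EuclideanSpace ℂ (Fin n) →L[ℂ] EuclideanSpace ℂ (Fin n))) := isClosed_univ

/-- The diagonal operators on `ℂⁿ`. -/
def scalarDiagonal (n : ℕ) :
    NonUnitalStarSubalgebra ℂ (EuclideanSpace ℂ (Fin n) →L[ℂ] EuclideanSpace ℂ (Fin n)) :=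
  diagonalAlgebra n ⊤

theorem mem_scalarDiagonal {T : EuclideanSpace ℂ (Fin n) →L[ℂ] EuclideanSpace ℂ (Fin n)} :
    T ∈ scalarDiagonal n ↔ ∀ k l, k ≠ l → scalarEntry T k l = 0 := by
  constructor
  · intro h k l hkl
    rw [scalarEntry, h.2 k l hkl]
    rfl
  · intro h
    refine ⟨fun _ _ => NonUnitalStarAlgebra.mem_top, fun k l hkl => ?_⟩
    rw [entry_eq_smul, h k l hkl]
    exact zero_smul ℂ (1 : ℂ →L[ℂ] ℂ)

theorem alg_scalarAlgebra_eq (A : NonUnitalStarSubalgebra ℂ (H →L[ℂ] H))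
    [IsClosed (A : Set (H →L[ℂ] H))] :
    (powerModel H n).alg (scalarAlgebra n) A = matrixAlgebra n A := by
  refine alg_eq_of_forall (isClosed_matrixAlgebra n A) (fun m _ a ha k l => ?_) fun T hT k l => ?_
  · rw [entry_op]
    exact SMulMemClass.smul_mem _ ha
  · rw [← op_matUnit]
    exact TensorModel.op_mem _ (mem_scalarAlgebra _) (hT k l)

theorem alg_scalarDiagonal_eq (D : NonUnitalStarSubalgebra ℂ (H →L[ℂ] H))
    (hD : IsClosed (D : Set (H →L[ℂ] H))) :
    (powerModel H n).alg (scalarDiagonal n) D = diagonalAlgebra n D := by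
  have hc : IsClosed (diagonalAlgebra n D :
      Set (PiLp 2 (fun _ : Fin n => H) →L[ℂ] PiLp 2 (fun _ : Fin n => H))) := by
    have h : (diagonalAlgebra n D :
        Set (PiLp 2 (fun _ : Fin n => H) →L[ℂ] PiLp 2 (fun _ : Fin n => H))) =
        (matrixAlgebra n D : Set (PiLp 2 (fun _ : Fin n => H) →L[ℂ] PiLp 2 (fun _ : Fin n => H))) ∩
          ⋂ k, ⋂ l, ⋂ (_ : k ≠ l), (fun T => entry T k l) ⁻¹' {0} := by
      ext T
      simp only [Set.mem_inter_iff, Set.mem_iInter, Set.mem_preimage]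
      rfl
    rw [h]
    exact (isClosed_matrixAlgebra n D).inter (isClosed_iInter fun k => isClosed_iInter fun l =>
      isClosed_iInter fun _ => isClosed_singleton.preimage (continuous_entry k l))
  refine alg_eq_of_forall hc (fun m hm a ha => ⟨fun k l => ?_, fun k l hkl => ?_⟩)
    fun T hT k l => ?_
  · rw [entry_op]
    exact SMulMemClass.smul_mem _ ha
  · rw [entry_op, mem_scalarDiagonal.1 hm k l hkl, zero_smul]
  · by_cases hkl : k = l
    · subst hkl
      rw [← op_matUnit]
      refine TensorModel.op_mem _ (mem_scalarDiagonal.2 fun i j hij => ?_) (hT.1 k k)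
      rw [scalarEntry, entry_matUnit, if_neg]
      · rfl
      · rintro ⟨rfl, rfl⟩
        exact hij rfl
    · rw [hT.2 k l hkl]
      have h0 : matUnit k l (0 : H →L[ℂ] H) = 0 := by
        ext x i
        rw [matUnit_apply]
        simp
      rw [h0]
      exact zero_mem _

end Models

end GenDiag
end

noncomputable section

namespace GenDiag

open scoped InnerProductSpace

/-! ### Scalar matrices have dimension zero over their diagonal -/

section ScalarMatrices

variable {n : ℕ}

variable {H : Type*} [NormedAddCommGroup H] [InnerProductSpace ℂ H] [CompleteSpace H]
variable {D A : NonUnitalStarSubalgebra ℂ (H →L[ℂ] H)} [IsClosed (A : Set (H →L[ℂ] H))]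
variable (e : (H →L[ℂ] H) ≃⋆ₐ[ℂ] CStarMatrix (Fin n) (Fin n) ℂ)

variable (A) in
/-- The matrix of an operator, as an element of a direct sum with one summand. -/
def toBlock : A →⋆ₙₐ[ℂ] BlockSum (fun _ : Unit => Fin n) ℂ where
  toFun T _ := e T.1
  map_smul' z T := funext fun _ => map_smul e z T.1
  map_zero' := funext fun _ => map_zero e
  map_add' S T := funext fun _ => map_add e S.1 T.1
  map_mul' S T := funext fun _ => map_mul e S.1 T.1
  map_star' T := funext fun _ => map_star e T.1

variable (hA : ∀ T, T ∈ A)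

/-- The operator with a given matrix. -/
def ofBlock : BlockSum (fun _ : Unit => Fin n) ℂ →⋆ₙₐ[ℂ] A where
  toFun x := ⟨e.symm (x ()), hA _⟩
  map_smul' z x := Subtype.ext (map_smul e.symm z (x ()))
  map_zero' := Subtype.ext (map_zero e.symm)
  map_add' x y := Subtype.ext (map_add e.symm (x ()) (y ()))
  map_mul' x y := Subtype.ext (map_mul e.symm (x ()) (y ()))
  map_star' x := Subtype.ext (map_star e.symm (x ()))

theorem ofBlock_toBlock (T : A) : ofBlock e hA (toBlock A e T) = T :=
  Subtype.ext (e.symm_apply_apply T.1)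

variable (hD : ∀ T, T ∈ D ↔ ∀ k l, k ≠ l → e T k l = 0)

include hD in
theorem ofBlock_mem_iff {x : BlockSum (fun _ : Unit => Fin n) ℂ} :
    (ofBlock e hA x).1 ∈ D ↔ IsDiag x := by
  have h : e (ofBlock e hA x).1 = x () := e.apply_symm_apply (x ())
  rw [hD, h]
  exact ⟨fun h _ => h, fun h => h ()⟩

include hD in
theorem exists_ofBlock_eq {a : H →L[ℂ] H} (ha : a ∈ D) :
    ∃ y, IsDiag y ∧ (ofBlock e hA y).1 = a := by
  have h := congrArg Subtype.val (ofBlock_toBlock e hA ⟨a, hA a⟩)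
  exact ⟨_, (ofBlock_mem_iff e hA hD).1 (by rw [h]; exact ha), h⟩

theorem mul_blockUnit_apply (y : BlockSum (fun _ : Unit => Fin n) ℂ) (k l : Fin n) (b : ℂ)
    (p q : Fin n) : (y * blockUnit (R := fun _ : Unit => Fin n) () k l b) () p q = if l = q then y () p k * b else 0 := by
  rw [Pi.mul_apply, CStarMatrix.mul_apply, Finset.sum_eq_single k]
  · rw [blockUnit_self]
    by_cases h : l = q <;> simp [h]
  · intro i _ hi
    rw [blockUnit_self, if_neg fun h => hi h.1.symm, mul_zero]
  · simp

theorem star_blockUnit_unit (k l : Fin n) (b : ℂ) :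
    star (blockUnit () k l b : BlockSum (fun _ : Unit => Fin n) ℂ) = blockUnit () l k (star b) := by
  ext j p q
  rw [Pi.star_apply, CStarMatrix.star_apply, blockUnit_self, blockUnit_self]
  by_cases h1 : k = q <;> by_cases h2 : l = p <;> simp [h1, h2]

/-- Conjugation by b e_kl leaves only a multiple of e_kk, even when y is not diagonal. -/
theorem isDiag_conj (y : BlockSum (fun _ : Unit => Fin n) ℂ) (k l : Fin n) (b : ℂ) :
    IsDiag (blockUnit (R := fun _ : Unit => Fin n) () k l b * y *
      star (blockUnit (R := fun _ : Unit => Fin n) () k l b)) := by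
  rintro ⟨⟩ p q hpq
  rw [star_blockUnit_unit, mul_blockUnit_apply]
  split_ifs with h
  · have h2 : (blockUnit () k l b * y : BlockSum (fun _ : Unit => Fin n) ℂ) () p l = 0 := by
      rw [Pi.mul_apply, CStarMatrix.mul_apply]
      refine Finset.sum_eq_zero fun i _ => ?_
      rw [blockUnit_self, if_neg, zero_mul]
      rintro ⟨rfl, -⟩
      exact hpq h
    rw [h2, zero_mul]
  · rfl

include hD in
theorem ofBlock_blockUnit_mem_normalisers (k l : Fin n) (b : ℂ) :
    (ofBlock e hA (blockUnit () k l b)).1 ∈ normalisers D A := by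
  refine ⟨hA _, fun d hd => ?_⟩
  obtain ⟨y, -, rfl⟩ := exists_ofBlock_eq e hA hD hd
  have h1 : ∀ x z : BlockSum (fun _ : Unit => Fin n) ℂ, (ofBlock e hA x).1 * (ofBlock e hA y).1 *
      (ofBlock e hA z).1 = (ofBlock e hA (x * y * z)).1 := fun x z => by
    rw [map_mul, map_mul]; rfl
  have h2 : ∀ x : BlockSum (fun _ : Unit => Fin n) ℂ,
      star (ofBlock e hA x).1 = (ofBlock e hA (star x)).1 := fun x => by
    rw [map_star]; rfl
  rw [h2, h1, h1, ofBlock_mem_iff e hA hD, ofBlock_mem_iff e hA hD]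
  refine ⟨isDiag_conj y k l b, ?_⟩
  have h3 := isDiag_conj y l k (star b)
  rwa [star_blockUnit_unit, star_star, ← star_blockUnit_unit] at h3

include hA hD in
-- The algebra is a matrix algebra with its canonical diagonal, so ψ and φ can be the given
-- isomorphism and its inverse, with one block and one colour. The approximation is exact.
theorem dimLE_zero_of_starAlgEquiv : DimLE ℂ D A 0 := by
  rw [dimLE_iff]
  intro S _ ε hε
  refine ⟨Unit, inferInstance, inferInstance, fun _ => Fin n, inferInstance, inferInstance,
    fun _ => 0, homMap (toBlock A e), homMap (ofBlock e hA),
    isCP_starHom (toBlock A e), isCP_starHom (ofBlock e hA),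
    fun x => isContractive_starHom (toBlock A e) x,
    fun a _ => ?_, fun P _ x y z _ _ _ => ?_, fun P _ x _ => isContractive_starHom (ofBlock e hA) x,
    fun a ha => ?_, fun P _ x _ hx => ?_,
    fun _ k l b => ofBlock_blockUnit_mem_normalisers e hA hD k l b,
    fun _ k a ha l b ξ => ?_⟩
  · change ‖ofBlock e hA (toBlock A e a) - a‖ < ε
    rwa [ofBlock_toBlock, sub_self, norm_zero]
  · change ofBlock e hA x * ofBlock e hA (y * z) = ofBlock e hA (x * y) * ofBlock e hA z
    rw [map_mul, map_mul, mul_assoc]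
  · change IsDiag (toBlock A e a)
    rw [← ofBlock_mem_iff e hA hD, ofBlock_toBlock]
    exact ha
  · have h : (ofBlock e hA x).1 ∈ D := (ofBlock_mem_iff e hA hD).2 hx
    exact ⟨hA _, fun d hd =>
      ⟨mul_mem (mul_mem h hd) (star_mem h), mul_mem (mul_mem (star_mem h) hd) h⟩⟩
  · obtain ⟨y, hy, rfl⟩ := exists_ofBlock_eq e hA hD ha
    -- A diagonal matrix y only rescales rows: y(e_kl b) = e_kl(y_kk b).
    refine Submodule.le_topologicalClosure _ (Submodule.subset_span ⟨l, y () k k * b, ξ, ?_⟩)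
    have h : y * blockUnit () k l b = blockUnit () k l (y () k k * b) := by
      ext j p q
      refine (mul_blockUnit_apply y k l b p q).trans ?_
      rw [blockUnit_self]
      by_cases h1 : k = p
      · subst h1; by_cases h2 : l = q <;> simp [h2]
      · rw [hy () p k (Ne.symm h1)]; simp [h1]
    change ((ofBlock e hA y).1 * (ofBlock e hA (blockUnit () k l b)).1) ξ = (ofBlock e hA _).1 ξ
    rw [← h, map_mul]
    rfl

theorem toEuclideanCLM_symm_apply (T : EuclideanSpace ℂ (Fin n) →L[ℂ] EuclideanSpace ℂ (Fin n))
    (k l : Fin n) : Matrix.toEuclideanCLM (n := Fin n) (𝕜 := ℂ).symm T k l = scalarEntry T k l := by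
  obtain ⟨x, rfl⟩ : ∃ x, Matrix.toEuclideanCLM (n := Fin n) (𝕜 := ℂ) x = T :=
    ⟨_, StarAlgEquiv.apply_symm_apply _ T⟩
  rw [StarAlgEquiv.symm_apply_apply, scalarEntry, entry_apply]
  have h : coordInl ℂ l 1 = WithLp.toLp 2 (Pi.single l (1 : ℂ)) := by
    ext i
    rw [coordInl_apply]
    simp [Pi.single_apply, eq_comm]
  rw [h, Matrix.toEuclideanCLM_toLp]
  simp

theorem dimLE_scalarDiagonal (n : ℕ) : DimLE ℂ (scalarDiagonal n) (scalarAlgebra n) 0 :=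
  dimLE_zero_of_starAlgEquiv
    (Matrix.toEuclideanCLM (n := Fin n) (𝕜 := ℂ).symm.trans CStarMatrix.ofMatrixStarAlgEquiv)
    mem_scalarAlgebra fun T => by
      rw [mem_scalarDiagonal]
      simp only [← toEuclideanCLM_symm_apply]
      rfl

end ScalarMatrices

/-! ### From bounds to the dimension -/

section Dimension

variable {H K : Type*} [NormedAddCommGroup H] [InnerProductSpace ℂ H] [CompleteSpace H]
  [NormedAddCommGroup K] [InnerProductSpace ℂ K] [CompleteSpace K]
variable {B : Type*} [NonUnitalCStarAlgebra B] [PartialOrder B] [StarOrderedRing B]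
variable {D A : NonUnitalStarSubalgebra ℂ (H →L[ℂ] H)} [IsClosed (A : Set (H →L[ℂ] H))]
  {E C : NonUnitalStarSubalgebra ℂ (K →L[ℂ] K)} [IsClosed (C : Set (K →L[ℂ] K))]

theorem DimLE.congr {D' A' : NonUnitalStarSubalgebra ℂ (H →L[ℂ] H)}
    [IsClosed (A' : Set (H →L[ℂ] H))] {d : ℕ} (h : DimLE B D A d) (hD : D = D') (hA : A = A') :
    DimLE B D' A' d := by
  subst hD hA
  exact h

/-- Tensoring with M_n on the left uses scalar coefficients there and multiplies the number of
colours by one. Closedness of `D` is needed because the spatial tensor product with the diagonal is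
closed by definition. -/
theorem dimLE_matrixAlgebra (hD : IsClosed (D : Set (H →L[ℂ] H))) (hDA : D ≤ A) (n : ℕ) {d : ℕ}
    (h : DimLE B D A d) : DimLE B (diagonalAlgebra n D) (matrixAlgebra n A) d :=
  ((powerModel H n).dimLE_alg (fun _ _ => mem_scalarAlgebra _) hDA (by ring) (dimLE_scalarDiagonal n) h).congr
    (alg_scalarDiagonal_eq D hD) (alg_scalarAlgebra_eq A)

theorem genDiagDim_le {d : ℕ} (h : DimLE B D A d) : genDiagDim B D A ≤ d := iInf₂_le d h

/-- A nonempty set of natural numbers has a least element, so a finite dimension is attained by an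
actual bound. -/
theorem genDiagDim_eq_top_or (B : Type*) [NonUnitalCStarAlgebra B] [PartialOrder B]
    [StarOrderedRing B] (D A : NonUnitalStarSubalgebra ℂ (H →L[ℂ] H))
    [IsClosed (A : Set (H →L[ℂ] H))] :
    genDiagDim B D A = ⊤ ∨ ∃ d : ℕ, DimLE B D A d ∧ genDiagDim B D A = d := by
  classical
  by_cases h : ∃ d, DimLE B D A d
  · exact .inr ⟨Nat.find h, Nat.find_spec h, le_antisymm (genDiagDim_le (Nat.find_spec h))
      (le_iInf₂ fun d hd => Nat.cast_le.2 (Nat.find_min' h hd))⟩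
  · exact .inl (by rw [genDiagDim]; simp [not_exists.1 h])

theorem genDiagDim_directSum_le : genDiagDim B (directSum D E) (directSum A C) ≤
    max (genDiagDim B D A) (genDiagDim B E C) := by
  rcases genDiagDim_eq_top_or B D A with h | ⟨d, hd, h⟩
  · rw [h, top_sup_eq]; exact le_top
  rcases genDiagDim_eq_top_or B E C with h' | ⟨d', hd', h'⟩
  · rw [h', sup_top_eq]; exact le_top
  rw [h, h']
  exact (genDiagDim_le (dimLE_directSum hd hd')).trans
    (Nat.mono_cast (α := ℕ∞)).map_max.le

theorem genDiagDim_tensor_le (hD : D ≤ A) (hE : E ≤ C) :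
    genDiagDim B (tensor D E) (tensor A C) + 1 ≤
      (genDiagDim ℂ D A + 1) * (genDiagDim B E C + 1) := by
  rcases genDiagDim_eq_top_or ℂ D A with h | ⟨d, hd, h⟩
  -- The other factor is at least 1, so the product is infinite.
  · rw [h, top_add, ENat.top_mul (by simp)]; exact le_top
  rcases genDiagDim_eq_top_or B E C with h' | ⟨d', hd', h'⟩
  · rw [h', top_add, ENat.mul_top (by simp)]; exact le_top
  -- The dimension is one less than the number of colours, which is why the bound is stated with +
  -- 1.
  have hn : (d * d' + d + d') + 1 = (d + 1) * (d' + 1) := by ring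
  rw [h, h']
  refine (add_le_add_left (genDiagDim_le (dimLE_tensor hD hE hn hd hd')) 1).trans ?_
  exact_mod_cast hn.le

theorem genDiagDim_matrixAlgebra_le (hD : IsClosed (D : Set (H →L[ℂ] H))) (hDA : D ≤ A) (n : ℕ) :
    genDiagDim B (diagonalAlgebra n D) (matrixAlgebra n A) ≤ genDiagDim B D A := by
  rcases genDiagDim_eq_top_or B D A with h | ⟨d, hd, h⟩
  · rw [h]; exact le_top
  · rw [h]; exact genDiagDim_le (dimLE_matrixAlgebra hD hDA n hd)

end Dimension

end GenDiag
end

theorem mainTheorem3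
    {H K : Type*} [NormedAddCommGroup H] [InnerProductSpace ℂ H] [CompleteSpace H]
    [NormedAddCommGroup K] [InnerProductSpace ℂ K] [CompleteSpace K]
    {B : Type*} [NonUnitalCStarAlgebra B] [PartialOrder B] [StarOrderedRing B]
    (A D_A : NonUnitalStarSubalgebra ℂ (H →L[ℂ] H)) [IsClosed (A : Set (H →L[ℂ] H))]
    (C D_C : NonUnitalStarSubalgebra ℂ (K →L[ℂ] K)) [IsClosed (C : Set (K →L[ℂ] K))]
    (hA : GenDiag.IsNondegenerateSubalgebra D_A A)
    (hC : GenDiag.IsNondegenerateSubalgebra D_C C) :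
    GenDiag.genDiagDim B (GenDiag.directSum D_A D_C) (GenDiag.directSum A C) ≤
        max (GenDiag.genDiagDim B D_A A) (GenDiag.genDiagDim B D_C C) ∧
      GenDiag.genDiagDim B (GenDiag.tensor D_A D_C) (GenDiag.tensor A C) + 1 ≤
        (GenDiag.genDiagDim ℂ D_A A + 1) * (GenDiag.genDiagDim B D_C C + 1) ∧
      ∀ n : ℕ, GenDiag.genDiagDim B (GenDiag.diagonalAlgebra n D_A) (GenDiag.matrixAlgebra n A) ≤
        GenDiag.genDiagDim B D_A A :=
  ⟨GenDiag.genDiagDim_directSum_le, GenDiag.genDiagDim_tensor_le hA.2.1 hC.2.1,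
    GenDiag.genDiagDim_matrixAlgebra_le hA.1 hA.2.1⟩
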